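/- **Proposition 3.6 (control of $\|\nabla_1 q_1\Phi_N^\varepsilon\|_{L^2}^2$).** Let $V:\mathbb R\to[0,\infty)$ be even, bounded and continuous with $\int_{\mathbb R}V=1$ and $\int_{\mathbb R}|x|^{1/2}V(x)\,dx<\infty$, and put $V_\varepsilon(x)=\varepsilon^{-1}V(\varepsilon^{-1}x)$. There are constants $C_1,C_2>0$, depending only on $V$, such that the following holds for every $\kappa\in\{1,-1\}$ (repulsive and attractive case), every $\varepsilon>0$ and every integer $N\ge 1$. Let $\phi\in C(\mathbb R;H^2(\mathbb R))\cap C^1(\mathbb R;L^2(\mathbb R))$ be a solution of the cubic nonlinear Schrödinger equation $(i\partial_t+\Delta)\phi=\kappa|\phi|^2\phi$ with $\|\phi(0)\|_{L^2(\mathbb R)}=1$. Let $\Phi_N^\varepsilon\in C(\mathbb R;H^1(\mathbb R^N))$, with values in the wave functions that are symmetric under permutations of $x_1,\dots,x_N$, be a solution (in $H^{-1}(\mathbb R^N)$, at every time) of $i\partial_t\Phi_N^\varepsilon=H_{N,\varepsilon}\Phi_N^\varepsilon$ with $\|\Phi_N^\varepsilon(0)\|_{L^2(\mathbb R^N)}=1$,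 where $$H_{N,\varepsilon}=\sum_{i=1}^N-\Delta_i+\frac{\kappa}{N}\sum_{1\le i<j\le N}V_\varepsilon(x_i-x_j).$$ At each time $t$ let $p_j(t)$ be the operator $|\phi(t)\rangle\langle\phi(t)|$ acting in the variable $x_j$, let $q_j(t)=\mathbf 1-p_j(t)$, let $P_k(t)=\sum_{\alpha\in\{0,1\}^N,\ |\alpha|=k}\prod_{j=1}^N p_j(t)^{1-\alpha_j}q_j(t)^{\alpha_j}$ for $0\le k\le N$, and let $$\beta_{N,\varepsilon}(t)=\sum_{k=0}^N\sqrt{\tfrac kN}\,\langle\Phi_N^\varepsilon(t),P_k(t)\Phi_N^\varepsilon(t)\rangle,\qquad E_{N,\varepsilon}=\tfrac1N\langle\Phi_N^\varepsilon(t),H_{N,\varepsilon}\Phi_N^\varepsilon(t)\rangle,\qquad E^\phi=\|\nabla\phi(t)\|_{L^2}^2+\tfrac\kappa2\|\phi(t)\|_{L^4}^4,$$ the second being understood in the sense of quadratic forms. Then, for every $t\in\mathbb R$, the weak derivative $\nabla_1q_1(t)\Phi_N^\varepsilon(t)$ exists in $L^2(\mathbb R^N)$, and $$\|\nabla_1q_1(t)\Phi_N^\varepsilon(t)\|_{L^2(\mathbb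 R^N)}^2\le C_1\big(E_{N,\varepsilon}-E^\phi\big)+C_2\Big(\varepsilon^{1/2}\|\phi(t)\|_{C^{1/2}(\mathbb R)}^2+\|\phi(t)\|_{H^2(\mathbb R)}\,\beta_{N,\varepsilon}(t)+\frac{\|\phi(t)\|_{H^2(\mathbb R)}}{\sqrt N}\Big).$$ Here $\|f\|_{C^{1/2}}=\|f\|_{L^\infty}+\sup_{x\ne y}|f(x)-f(y)|/|x-y|^{1/2}$ and $\|f\|_{H^2}^2=\|f\|_{L^2}^2+2\|\nabla f\|_{L^2}^2+\|\Delta f\|_{L^2}^2$. -/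

import Mathlib

open MeasureTheory Filter Topology
open scoped ComplexConjugate ContDiff

noncomputable section

namespace LiebLiniger

/-! ### L² and weak derivatives -/

section WeakDerivatives

variable {E : Type*} [NormedAddCommGroup E] [NormedSpace ℝ E] [MeasureSpace E]

/-- The `L²` norm. -/
def l2Norm (f : E → ℂ) : ℝ := (eLpNorm f 2 volume).toReal

/-- The `L²` pairing, conjugate linear in the first entry. -/
def l2Inner (f g : E → ℂ) : ℂ := ∫ x, conj (f x) * g x

/-- `g` is the weak derivative of `f` in the direction `v`, tested against all real-valued
compactly supported smooth functions. -/
def HasWeakDeriv (v : E) (f g : E → ℂ) : Prop :=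
  ∀ ψ : E → ℝ, ContDiff ℝ ∞ ψ → HasCompactSupport ψ →
    ∫ x, (fderiv ℝ ψ x v) • f x = -∫ x, ψ x • g x

/-- `f` has a weak derivative in the direction `v` that belongs to `L²`. -/
def HasL2Deriv (v : E) (f : E → ℂ) : Prop :=
  ∃ g : E → ℂ, MemLp g 2 volume ∧ HasWeakDeriv v f g

open Classical in
/-- The weak `L²` derivative of `f` in the direction `v` (a representative of it; it is unique
almost everywhere). It is only used for functions that possess one. -/
def weakDeriv (v : E) (f : E → ℂ) : E → ℂ :=
  if h : HasL2Deriv v f then h.choose else 0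

theorem weakDeriv_spec {v : E} {f : E → ℂ} (h : HasL2Deriv v f) :
    MemLp (weakDeriv v f) 2 volume ∧ HasWeakDeriv v f (weakDeriv v f) := by
  unfold weakDeriv
  rw [dif_pos h]
  exact h.choose_spec

end WeakDerivatives

/-! ### The one-particle space -/

/-- Membership in `H²(ℝ)`. Every class in `H²(ℝ)` has exactly one continuous representative, and
it is this representative that we work with. -/
structure MemH2 (f : ℝ → ℂ) : Prop where
  continuous : Continuous f
  memLp : MemLp f 2 volume
  deriv_one : HasL2Deriv (1 : ℝ) f
  deriv_two : HasL2Deriv (1 : ℝ) (weakDeriv (1 : ℝ) f)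

/-- The gradient of a function on the line. -/
def grad (f : ℝ → ℂ) : ℝ → ℂ := weakDeriv (1 : ℝ) f

/-- The Laplacian of a function on the line. -/
def lap (f : ℝ → ℂ) : ℝ → ℂ := weakDeriv (1 : ℝ) (grad f)

/-- The `H²(ℝ)` norm: as `(1 + ξ²)² = 1 + 2 ξ² + ξ⁴`, this is the `L²` norm of
`(1 + ξ²)` times the (unitary) Fourier transform. -/
def h2Norm (f : ℝ → ℂ) : ℝ :=
  Real.sqrt (l2Norm f ^ 2 + 2 * l2Norm (grad f) ^ 2 + l2Norm (lap f) ^ 2)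

/-- The `C^{1/2}(ℝ)` norm: the supremum norm plus the Hölder seminorm of exponent `1/2`. -/
def holderHalfNorm (f : ℝ → ℂ) : ℝ :=
  (eLpNorm f ⊤ volume).toReal + (eHolderNorm (1 / 2) f).toReal

/-- The NLS energy `‖∇φ‖² + (κ/2) ‖φ‖_{L⁴}⁴`. -/
def nlsEnergy (κ : ℝ) (φ : ℝ → ℂ) : ℝ :=
  l2Norm (grad φ) ^ 2 + κ / 2 * ∫ x, ‖φ x‖ ^ 4

/-- `φ` is a global `H²` solution of `(i ∂ₜ + Δ) φ = κ |φ|² φ`: it is a continuous curve in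
`H²(ℝ)` that is differentiable as a curve in `L²(ℝ)`, and the equation holds in `L²(ℝ)` at every
time. -/
structure IsNLSSolution (κ : ℝ) (φ : ℝ → ℝ → ℂ) : Prop where
  memH2 : ∀ t, MemH2 (φ t)
  continuous : ∀ t, Tendsto (fun s => h2Norm (φ s - φ t)) (𝓝 t) (𝓝 0)
  equation : ∀ t, Tendsto
    (fun s => l2Norm (fun x => (φ s x - φ t x) / ((s - t : ℝ) : ℂ) -
      Complex.I * (lap (φ t) x - ((κ * ‖φ t x‖ ^ 2 : ℝ) : ℂ) * φ t x)))
    (𝓝[≠] t) (𝓝 0)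

/-! ### The N-particle space -/

/-- Membership in `H¹(ℝᴺ)`. -/
structure MemH1 {N : ℕ} (f : (Fin N → ℝ) → ℂ) : Prop where
  memLp : MemLp f 2 volume
  deriv : ∀ i : Fin N, HasL2Deriv (Pi.single i (1 : ℝ)) f

/-- The gradient `∇ᵢ` in the variable of the `i`-th particle. -/
def partialGrad {N : ℕ} (i : Fin N) (f : (Fin N → ℝ) → ℂ) : (Fin N → ℝ) → ℂ :=
  weakDeriv (Pi.single i (1 : ℝ)) f

/-- The `H¹(ℝᴺ)` norm. -/
def h1Norm {N : ℕ} (f : (Fin N → ℝ) → ℂ) : ℝ :=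
  Real.sqrt (l2Norm f ^ 2 + ∑ i, l2Norm (partialGrad i f) ^ 2)

/-- Invariance of a wave function under permutations of the particle labels. -/
def IsBosonic {N : ℕ} (f : (Fin N → ℝ) → ℂ) : Prop :=
  ∀ σ : Equiv.Perm (Fin N), (fun x => f (x ∘ σ)) =ᵐ[volume] f

/-- The pair potentials under consideration: nonnegative, even, bounded, continuous, of integral
one, and with a finite moment of order `1/2`. Every even standard mollifier is of this kind. -/
structure IsShortRange (V : ℝ → ℝ) : Prop where
  continuous : Continuous V
  nonneg : ∀ x, 0 ≤ V x
  even : ∀ x, V (-x) = V x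
  bounded : ∃ M, ∀ x, V x ≤ M
  integrable : Integrable V
  integral_eq_one : ∫ x, V x = 1
  moment : Integrable (fun x => |x| ^ (1 / 2 : ℝ) * V x)

/-- The rescaled potential `V_ε = ε⁻¹ V(ε⁻¹ ·)`. -/
def scaled (V : ℝ → ℝ) (ε : ℝ) (x : ℝ) : ℝ := ε⁻¹ * V (ε⁻¹ * x)

/-- The sesquilinear form `⟨Ψ, H Φ⟩` on `H¹(ℝᴺ)` of the regularized Hamiltonian
`H = ∑ᵢ -Δᵢ + (κ/N) ∑_{i<j} V_ε(xᵢ - xⱼ)`. -/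
def hamForm {N : ℕ} (κ : ℝ) (V : ℝ → ℝ) (ε : ℝ) (Ψ Φ : (Fin N → ℝ) → ℂ) : ℂ :=
  ∑ i, l2Inner (partialGrad i Ψ) (partialGrad i Φ) +
    ((κ / N : ℝ) : ℂ) * ∑ i, ∑ j ∈ Finset.Ioi i,
      l2Inner Ψ (fun x => ((scaled V ε (x i - x j) : ℝ) : ℂ) * Φ x)

/-- The regularized microscopic energy per particle `N⁻¹ ⟨Φ, H Φ⟩`. -/
def regEnergy {N : ℕ} (κ : ℝ) (V : ℝ → ℝ) (ε : ℝ) (Φ : (Fin N → ℝ) → ℂ) : ℝ :=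
  (1 / N : ℝ) * (hamForm κ V ε Φ Φ).re

/-- `Φ` is a global finite-energy solution, in the bosonic space, of `i ∂ₜ Φ = H Φ` for the
regularized Hamiltonian `H`: a continuous curve in the form domain `H¹(ℝᴺ)`, with values in the
bosonic functions, for which the equation holds in the dual of the form domain. -/
structure IsRegSchrodingerSolution {N : ℕ} (κ : ℝ) (V : ℝ → ℝ) (ε : ℝ)
    (Φ : ℝ → (Fin N → ℝ) → ℂ) : Prop where
  memH1 : ∀ t, MemH1 (Φ t)
  bosonic : ∀ t, IsBosonic (Φ t)
  continuous : ∀ t, Tendsto (fun s => h1Norm (Φ s - Φ t)) (𝓝 t) (𝓝 0)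
  equation : ∀ Ψ : (Fin N → ℝ) → ℂ, MemH1 Ψ → ∀ t,
    HasDerivAt (fun s => l2Inner Ψ (Φ s)) (-Complex.I * hamForm κ V ε Ψ (Φ t)) t

/-! ### Projectors and the counting functional -/

/-- `pⱼ = |φ⟩⟨φ|` acting in the variable of the `j`-th particle. -/
def pOp {N : ℕ} (φ : ℝ → ℂ) (j : Fin N) (Φ : (Fin N → ℝ) → ℂ) : (Fin N → ℝ) → ℂ :=
  fun x => φ (x j) * ∫ y, conj (φ y) * Φ (Function.update x j y)

/-- `qⱼ = 1 - pⱼ`. -/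
def qOp {N : ℕ} (φ : ℝ → ℂ) (j : Fin N) (Φ : (Fin N → ℝ) → ℂ) : (Fin N → ℝ) → ℂ :=
  Φ - pOp φ j Φ

/-- The product over all particles `j` of `qⱼ` for `j ∈ S` and `pⱼ` for `j ∉ S`. -/
def prodOp {N : ℕ} (φ : ℝ → ℂ) (S : Finset (Fin N)) (Φ : (Fin N → ℝ) → ℂ) :
    (Fin N → ℝ) → ℂ :=
  (List.finRange N).foldr (fun j Ψ => if j ∈ S then qOp φ j Ψ else pOp φ j Ψ) Φ

/-- `P_k`, the projector onto the states with exactly `k` particles not in the state `φ`. -/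
def kOp {N : ℕ} (φ : ℝ → ℂ) (k : ℕ) (Φ : (Fin N → ℝ) → ℂ) : (Fin N → ℝ) → ℂ :=
  ∑ S ∈ Finset.powersetCard k (Finset.univ : Finset (Fin N)), prodOp φ S Φ

/-- The operator `∑ₖ f(k) P_k`. -/
def hatOp {N : ℕ} (φ : ℝ → ℂ) (f : ℕ → ℂ) (Φ : (Fin N → ℝ) → ℂ) : (Fin N → ℝ) → ℂ :=
  ∑ k ∈ Finset.range (N + 1), f k • kOp φ k Φ

/-- The counting functional `β_N(Φ, φ) = ⟨Φ, ∑ₖ √(k/N) P_k Φ⟩`. -/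
def beta {N : ℕ} (Φ : (Fin N → ℝ) → ℂ) (φ : ℝ → ℂ) : ℝ :=
  (l2Inner Φ (hatOp φ (fun k => ((Real.sqrt ((k : ℝ) / N) : ℝ) : ℂ)) Φ)).re

end LiebLiniger

end

open LiebLiniger

/-!
Both evolutions conserve the `L²` norm, so the estimate is one about a normalized `φ ∈ H²(ℝ)` and
a normalized bosonic `Φ ∈ H¹(ℝᴺ)` at a fixed time. All functions are moved to `L²`, where a weak
derivative is the derivative of the group of translations (`hasWeakDeriv_iff`), multiplication by a
potential and `pⱼ` are bounded operators, and integration by parts is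
`HasDirDeriv.inner_add_inner`.

The projections `pⱼ` commute, so they split `Φ` into orthogonal sectors `Φ_S`, one for each set `S`
of excited particles, and `β = ∑ √(|S|/N) ‖Φ_S‖²` (`beta_eq_excitation`). Since `Φ` is symmetric,
the sectors with equal `|S|` are equally populated. If an operator commutes with the `pₖ` of all
other particles, its matrix element between the condensed and the excited part of one particle
couples `Φ_S` only with `Φ_{S ∪ {i}}`; a weighted Cauchy–Schwarz inequality bounds it by `β + 1/√N`
times the norm of the operator (`CommutingProjections.norm_inner_transfer_le`, and
`CommutingProjections.norm_inner_pair_transfer_le` for two particles).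

Write `X = ‖∇₁ q₁ Φ‖²`. By symmetry the energy per particle is `‖∇₁ Φ‖²` plus `κ (N - 1) / (2 N)`
times the energy of the pair potential (`IsShortRange.regEnergy_eq`).

* Kinetic energy: `‖∇₁ Φ‖²` is `X` plus the contribution of `p₁ Φ`, which is `‖∇φ‖² ‖p₁ Φ‖²`, plus a
  cross term, in which one derivative is moved to `φ`; `kinetic_lower_bound` loses only
  `‖φ‖_{H²} (β + 1/√N)`.
* Potential energy: a primitive of `V_ε` is bounded by one, uniformly in `ε`, so that integration by
  parts gives `⟨f, V_ε(xᵢ - xⱼ) f⟩ ≤ 2 ‖∇ᵢ f‖ ‖f‖` (`IsUnitPotential.integral_mul_norm_sq_le`). The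
  square root of the pair potential is applied to `p₁ p₂ Φ`, `p₁ q₂ Φ`, `q₁ p₂ Φ`, `q₁ q₂ Φ`. The
  first part yields the self-energy of the condensate, the next two are controlled through
  derivatives of `φ`, and the last one costs a fraction of `X` and a multiple of `β`
  (`abs_pair_energy_sub_selfEnergy_le`). As only absolute values enter, the sign of `κ` is
  irrelevant.
* The self-energy differs from `‖φ‖⁴_{L⁴}` by the `C^{1/2}` modulus of `|φ|²` averaged
  against `V_ε`, which is `ε^{1/2}` times the moment of `V` (`IsShortRange.abs_selfEnergy_sub_le`).

The fraction of `X` lost in the potential energy is `1/4`, which is absorbed on the left.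
-/

open scoped BoundedContinuousFunction

noncomputable section

namespace LiebLiniger

/-! ### Weak derivatives as generators of translations -/

section L2Space

/-- The Hilbert space of square-integrable complex functions, up to almost everywhere equality. -/
abbrev L2 (E : Type*) [MeasureSpace E] := Lp ℂ 2 (volume : Measure E)

variable {α : Type*} [MeasureSpace α]

theorem integral_smul_eq_inner {ψ : α → ℝ} (hψ : MemLp (fun x => (ψ x : ℂ)) 2 volume)
    {f : α → ℂ} (hf : MemLp f 2 volume) :
    ∫ x, ψ x • f x = inner ℂ (hψ.toLp _) (hf.toLp f) := by
  rw [L2.inner_def]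
  refine integral_congr_ae ?_
  filter_upwards [hψ.coeFn_toLp, hf.coeFn_toLp] with x h1 h2
  simp [h1, h2, mul_comm]

theorem l2Norm_eq_norm {f : α → ℂ} (hf : MemLp f 2 volume) : l2Norm f = ‖hf.toLp f‖ := by
  rw [Lp.norm_toLp]; rfl

theorem l2Inner_eq_inner {f g : α → ℂ} (hf : MemLp f 2 volume) (hg : MemLp g 2 volume) :
    l2Inner f g = inner ℂ (hf.toLp f) (hg.toLp g) := by
  rw [L2.inner_def]
  refine integral_congr_ae ?_
  filter_upwards [hf.coeFn_toLp, hg.coeFn_toLp] with x h1 h2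
  simp [h1, h2, mul_comm]

end L2Space

section Translations

variable {E : Type*} [NormedAddCommGroup E] [NormedSpace ℝ E] [MeasureSpace E]

theorem weakDeriv_memLp {v : E} {f : E → ℂ} (h : HasL2Deriv v f) :
    MemLp (weakDeriv v f) 2 volume := (weakDeriv_spec h).1

section NoDimension

variable [BorelSpace E] [(volume : Measure E).IsAddRightInvariant]

/-- Translation `f ↦ f (· + s v)` as an isometry of `L²`. -/
def shift (v : E) (s : ℝ) : L2 E →ₗᵢ[ℂ] L2 E :=
  Lp.compMeasurePreservingₗᵢ ℂ (fun x => x + s • v)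
    (measurePreserving_add_right (volume : Measure E) (s • v))

theorem coeFn_shift (v : E) (s : ℝ) (f : L2 E) :
    shift v s f =ᵐ[volume] fun x => f (x + s • v) :=
  Lp.coeFn_compMeasurePreserving f (measurePreserving_add_right (volume : Measure E) (s • v))

theorem shift_zero (v : E) (f : L2 E) : shift v 0 f = f := by
  refine Lp.ext ?_
  filter_upwards [coeFn_shift v 0 f] with x hx
  simpa using hx

/-- `g` is the derivative of `f` in the direction `v`, in the sense that the orbit of `f` under
translations along `v` is differentiable in `L²` with derivative `g`. -/
def HasDirDeriv (v : E) (f g : L2 E) : Prop :=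
  HasDerivAt (fun s => shift v s f) g 0

theorem HasDirDeriv.unique {v : E} {f g g' : L2 E} (h : HasDirDeriv v f g)
    (h' : HasDirDeriv v f g') : g = g' :=
  HasDerivAt.unique h h'

theorem HasDirDeriv.sub {v : E} {f f' g g' : L2 E} (h : HasDirDeriv v f g)
    (h' : HasDirDeriv v f' g') : HasDirDeriv v (f - f') (g - g') := by
  refine (HasDerivAt.sub h h').congr_of_eventuallyEq (Eventually.of_forall fun s => ?_)
  simp

theorem HasDirDeriv.sum {v : E} {ι : Type*} (s : Finset ι) {f g : ι → L2 E}
    (h : ∀ i ∈ s, HasDirDeriv v (f i) (g i)) :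
    HasDirDeriv v (∑ i ∈ s, f i) (∑ i ∈ s, g i) := by
  refine (HasDerivAt.fun_sum h).congr_of_eventuallyEq (Eventually.of_forall fun s => ?_)
  simp

theorem HasDirDeriv.map {F : Type*} [NormedAddCommGroup F] [NormedSpace ℝ F] [MeasureSpace F]
    [BorelSpace F] [(volume : Measure F).IsAddRightInvariant] {v : E} {w : F} {f g : L2 E}
    (h : HasDirDeriv v f g) (T : L2 E →L[ℂ] L2 F)
    (hT : ∀ s, shift w s (T f) = T (shift v s f)) : HasDirDeriv w (T f) (T g) := by
  have h2 := (T.restrictScalars ℝ).hasFDerivAt.comp_hasDerivAt (0 : ℝ) h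
  refine h2.congr_of_eventuallyEq (Eventually.of_forall fun s => ?_)
  simp [hT s]

/-- Translations are unitary, so their generator is antisymmetric: integration by parts. -/
theorem HasDirDeriv.inner_add_inner {v : E} {f f' g g' : L2 E} (h : HasDirDeriv v f f')
    (h' : HasDirDeriv v g g') : inner ℂ f' g + inner ℂ f g' = 0 := by
  have h1 := HasDerivAt.inner ℂ h h'
  simp only [LinearIsometry.inner_map_map, shift_zero] at h1
  have := h1.unique (hasDerivAt_const (0 : ℝ) (inner ℂ f g))
  rw [add_comm]
  exact this

end NoDimension

variable [BorelSpace E] [FiniteDimensional ℝ E] [(volume : Measure E).IsAddHaarMeasure]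

theorem continuous_shift (v : E) (f : L2 E) : Continuous fun s => shift v s f := by
  let g : ℝ → C(E, E) := fun s => ⟨fun x => x + s • v, by fun_prop⟩
  have hg : Continuous g :=
    ContinuousMap.continuous_of_continuous_uncurry _
      (show Continuous fun p : ℝ × E => p.2 + p.1 • v by fun_prop)
  exact (continuous_const (y := f)).compMeasurePreservingLp hg
    (fun s => measurePreserving_add_right (volume : Measure E) (s • v)) (by simp)

theorem memLp_testFunction {X : Type*} [TopologicalSpace X] [MeasureSpace X]
    [OpensMeasurableSpace X] [IsFiniteMeasureOnCompacts (volume : Measure X)] {ψ : X → ℝ}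
    (hψ : Continuous ψ) (hc : HasCompactSupport ψ) : MemLp (fun x => (ψ x : ℂ)) 2 volume :=
  Continuous.memLp_of_hasCompactSupport (by fun_prop) (hc.comp_left (g := ((↑) : ℝ → ℂ)) (by simp))

/-- Along translates of `f`, the pairing with a test function is differentiable, for every
`f ∈ L²`: the derivative falls on the test function. -/
theorem hasDerivAt_inner_shift {ψ : E → ℝ} (hψ : ContDiff ℝ ∞ ψ) (hc : HasCompactSupport ψ)
    (v : E) {f : E → ℂ} (hf : MemLp f 2 volume) (s : ℝ) :
    HasDerivAt (fun s => inner ℂ ((memLp_testFunction hψ.continuous hc).toLp _)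
      (shift v s (hf.toLp f)))
      (-∫ x, (fderiv ℝ ψ (x - s • v) v) • f x) s := by
  let L : ℂ →L[ℝ] ℝ →L[ℝ] ℂ := (ContinuousLinearMap.lsmul ℝ ℝ).flip
  have hc' : HasCompactSupport (fun z => ψ (-z)) := hc.comp_homeomorph (Homeomorph.neg E)
  have hd' : ContDiff ℝ 1 (fun z => ψ (-z)) := (hψ.comp contDiff_neg).of_le (by simp)
  have hloc := (hf.locallyIntegrable (by norm_num))
  have key := hc'.hasFDerivAt_convolution_right L hloc hd' (s • v)
  have hline : HasDerivAt (fun s : ℝ => s • v) v s := by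
    simpa using (hasDerivAt_id s).smul_const v
  have key2 := key.comp_hasDerivAt s hline
  rw [convolution_precompR_apply L hloc (hc'.fderiv ℝ) (hd'.continuous_fderiv one_ne_zero)] at key2
  have e1 : (-∫ x, (fderiv ℝ ψ (x - s • v) v) • f x) =
      convolution f (fun a => (fderiv ℝ (fun z => ψ (-z)) a) v) L volume (s • v) := by
    rw [convolution_def, ← integral_neg]
    refine integral_congr_ae (Eventually.of_forall fun x => ?_)
    have : fderiv ℝ (fun z => ψ (-z)) (s • v - x) v = - fderiv ℝ ψ (x - s • v) v := by
      have h1 : HasFDerivAt (fun z : E => -z) (-ContinuousLinearMap.id ℝ E) (s • v - x) :=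
        (hasFDerivAt_id _).neg
      have h2 : HasFDerivAt ψ (fderiv ℝ ψ (-(s • v - x))) (-(s • v - x)) :=
        (hψ.differentiable (by simp) _).hasFDerivAt
      have h3 : HasFDerivAt (fun z => ψ (-z)) _ (s • v - x) := h2.comp _ h1
      rw [h3.fderiv]
      simp
    simp [L, this]
  rw [e1]
  refine key2.congr_of_eventuallyEq (Eventually.of_forall fun r => ?_)
  simp only [Function.comp, convolution_def]
  have hs : MemLp (fun x => f (x + r • v)) 2 volume :=
    hf.comp_measurePreserving (measurePreserving_add_right (volume : Measure E) (r • v))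
  have e2 : shift v r (hf.toLp f) = hs.toLp _ := rfl
  rw [e2, ← integral_smul_eq_inner]
  rw [← integral_add_right_eq_self (fun t => L (f t) (ψ (-(r • v - t)))) (r • v)]
  simp [L]

/-- An `L²` function is determined by its pairings with test functions. -/
theorem L2.ext_testFunction {f g : L2 E}
    (h : ∀ (ψ : E → ℝ) (hψ : ContDiff ℝ ∞ ψ) (hc : HasCompactSupport ψ),
      inner ℂ ((memLp_testFunction hψ.continuous hc).toLp _) f =
      inner ℂ ((memLp_testFunction hψ.continuous hc).toLp _) g) : f = g := by
  refine Lp.ext (ae_eq_of_integral_contDiff_smul_eq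
    ((Lp.memLp f).locallyIntegrable (by norm_num)) ((Lp.memLp g).locallyIntegrable (by norm_num))
    fun ψ hψ hc => ?_)
  have := h ψ hψ hc
  rw [← Lp.toLp_coeFn f (Lp.memLp f), ← Lp.toLp_coeFn g (Lp.memLp g)] at this
  rw [← integral_smul_eq_inner, ← integral_smul_eq_inner] at this
  exact this

/-- Weak derivatives in `L²` are exactly the `L²` derivatives along translations. -/
theorem hasWeakDeriv_iff {v : E} {f g : E → ℂ} (hf : MemLp f 2 volume) (hg : MemLp g 2 volume) :
    HasWeakDeriv v f g ↔ HasDirDeriv v (hf.toLp f) (hg.toLp g) := by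
  constructor
  · intro h
    have hcont : Continuous fun s => shift v s (hg.toLp g) := continuous_shift v _
    have key : ∀ t, shift v t (hf.toLp f) =
        hf.toLp f + ∫ s in (0 : ℝ)..t, shift v s (hg.toLp g) := by
      intro t
      refine L2.ext_testFunction fun ψ hψ hc => ?_
      set Ψ := (memLp_testFunction hψ.continuous hc).toLp _
      have hd : ∀ s, HasDerivAt (fun s => inner ℂ Ψ (shift v s (hf.toLp f)))
          (inner ℂ Ψ (shift v s (hg.toLp g))) s := by
        intro s
        have h1 := hasDerivAt_inner_shift hψ hc v hf s
        convert h1 using 1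
        have hψ' : ContDiff ℝ ∞ (fun x => ψ (x - s • v)) := hψ.comp (contDiff_id.sub contDiff_const)
        have hc' : HasCompactSupport (fun x => ψ (x - s • v)) :=
          hc.comp_homeomorph (Homeomorph.subRight (s • v))
        have h2 := h _ hψ' hc'
        have h3 : ∀ x, fderiv ℝ (fun x => ψ (x - s • v)) x = fderiv ℝ ψ (x - s • v) := by
          intro x
          exact fderiv_comp_sub (s • v)
        simp only [h3] at h2
        rw [h2, neg_neg]
        have hs : MemLp (fun x => g (x + s • v)) 2 volume :=
          hg.comp_measurePreserving (measurePreserving_add_right (volume : Measure E) (s • v))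
        have e2 : shift v s (hg.toLp g) = hs.toLp _ := rfl
        rw [e2, ← integral_smul_eq_inner]
        rw [← integral_add_right_eq_self (fun x => ψ (x - s • v) • g x) (s • v)]
        simp
      have h4 := intervalIntegral.integral_eq_sub_of_hasDerivAt (a := 0) (b := t)
        (fun s _ => hd s) ((continuous_const.inner hcont).intervalIntegrable _ _)
      have h5 : ∫ s in (0 : ℝ)..t, inner ℂ Ψ (shift v s (hg.toLp g)) =
          inner ℂ Ψ (∫ s in (0 : ℝ)..t, shift v s (hg.toLp g)) :=
        (innerSL ℂ Ψ).intervalIntegral_comp_comm (hcont.intervalIntegrable 0 t)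
      rw [inner_add_right, ← h5, h4, shift_zero]
      ring
    have h6 : HasDerivAt (fun t => hf.toLp f + ∫ s in (0 : ℝ)..t, shift v s (hg.toLp g))
        (shift v 0 (hg.toLp g)) 0 :=
      (intervalIntegral.integral_hasDerivAt_right (hcont.intervalIntegrable 0 0)
        (hcont.stronglyMeasurableAtFilter _ _) hcont.continuousAt).const_add _
    rw [shift_zero] at h6
    exact h6.congr_of_eventuallyEq (Eventually.of_forall key)
  · intro h ψ hψ hc
    have h1 := hasDerivAt_inner_shift hψ hc v hf 0
    set Ψ := (memLp_testFunction hψ.continuous hc).toLp _ with hΨ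
    have h2 := (hasDerivAt_const (0 : ℝ) Ψ).inner ℂ h
    simp only [shift_zero, inner_zero_left, add_zero] at h2
    have h3 := h1.unique h2
    rw [integral_smul_eq_inner (memLp_testFunction hψ.continuous hc) hg, ← hΨ, ← h3]
    simp

theorem HasL2Deriv.hasDirDeriv {v : E} {f : E → ℂ} (h : HasL2Deriv v f) (hf : MemLp f 2 volume) :
    HasDirDeriv v (hf.toLp f) ((weakDeriv_memLp h).toLp _) :=
  (hasWeakDeriv_iff hf _).1 (weakDeriv_spec h).2

theorem HasDirDeriv.hasL2Deriv {v : E} {f : E → ℂ} (hf : MemLp f 2 volume) {g : L2 E}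
    (h : HasDirDeriv v (hf.toLp f) g) : HasL2Deriv v f := by
  refine ⟨g, Lp.memLp g, (hasWeakDeriv_iff hf (Lp.memLp g)).2 ?_⟩
  rwa [Lp.toLp_coeFn]

theorem HasDirDeriv.toLp_weakDeriv {v : E} {f : E → ℂ} (hf : MemLp f 2 volume) {g : L2 E}
    (h : HasDirDeriv v (hf.toLp f) g) :
    (weakDeriv_memLp (h.hasL2Deriv hf)).toLp _ = g :=
  ((h.hasL2Deriv hf).hasDirDeriv hf).unique h

end Translations

/-! ### One-particle rank-one operators -/

section RankOne

variable {N : ℕ}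

/-- Exchanging the `j`-th coordinate with an extra one. -/
def exchange (j : Fin N) (z : (Fin N → ℝ) × ℝ) : (Fin N → ℝ) × ℝ :=
  (Function.update z.1 j z.2, z.1 j)

theorem measurePreserving_exchange (j : Fin N) :
    MeasurePreserving (exchange j)
      ((volume : Measure (Fin N → ℝ)).prod (volume : Measure ℝ))
      ((volume : Measure (Fin N → ℝ)).prod (volume : Measure ℝ)) := by
  obtain ⟨n, rfl⟩ : ∃ n, N = n + 1 := ⟨N - 1, by have := j.pos; omega⟩
  let e := MeasurableEquiv.piFinSuccAbove (fun _ : Fin (n + 1) => ℝ) j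
  have he : MeasurePreserving e := volume_preserving_piFinSuccAbove (fun _ => ℝ) j
  have h1 := he.prod (MeasurePreserving.id (volume : Measure ℝ))
  have h2 := MeasureTheory.measurePreserving_prodAssoc (volume : Measure ℝ)
    (volume : Measure (Fin n → ℝ)) (volume : Measure ℝ)
  have h3 := Measure.measurePreserving_swap (μ := (volume : Measure ℝ))
    (ν := ((volume : Measure (Fin n → ℝ)).prod (volume : Measure ℝ)))
  have h4 := (Measure.measurePreserving_swap (μ := (volume : Measure (Fin n → ℝ)))
    (ν := (volume : Measure ℝ))).prod (MeasurePreserving.id (volume : Measure ℝ))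
  have h5 := (he.symm e).prod (MeasurePreserving.id (volume : Measure ℝ))
  have h6 := h5.comp (h4.comp (h3.comp (h2.comp h1)))
  convert h6 using 1
  funext z
  obtain ⟨x, y⟩ := z
  have : e.symm (y, j.removeNth x) = Function.update x j y := by
    change j.insertNth y (j.removeNth x) = _
    simp
  simp only [exchange, Function.comp, Prod.map, id]
  refine Prod.ext ?_ ?_
  · exact this.symm
  · rfl

/-- The operator `|u⟩⟨w|` acting in the variable of the `j`-th particle. -/
def rankOne (u w : ℝ → ℂ) (j : Fin N) (f : (Fin N → ℝ) → ℂ) : (Fin N → ℝ) → ℂ :=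
  fun x => u (x j) * ∫ y, conj (w y) * f (Function.update x j y)

theorem ae_update_of_ae {p : (Fin N → ℝ) → Prop} (j : Fin N) (h : ∀ᵐ x, p x) :
    ∀ᵐ x : Fin N → ℝ, ∀ᵐ y : ℝ, p (Function.update x j y) := by
  have h1 : ∀ᵐ z : (Fin N → ℝ) × ℝ ∂(volume.prod volume), p z.1 :=
    Measure.quasiMeasurePreserving_fst.ae h
  exact Measure.ae_ae_of_ae_prod ((measurePreserving_exchange j).quasiMeasurePreserving.ae h1)

theorem ae_eval_of_ae {p : ℝ → Prop} (j : Fin N) (h : ∀ᵐ x, p x) :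
    ∀ᵐ x : Fin N → ℝ, p (x j) :=
  (Measure.quasiMeasurePreserving_eval (fun _ : Fin N => (volume : Measure ℝ)) j).ae h

theorem rankOne_congr {u u' w w' : ℝ → ℂ} {f f' : (Fin N → ℝ) → ℂ} (j : Fin N)
    (hu : u =ᵐ[volume] u') (hw : w =ᵐ[volume] w') (hf : f =ᵐ[volume] f') :
    rankOne u w j f =ᵐ[volume] rankOne u' w' j f' := by
  filter_upwards [ae_eval_of_ae j hu, ae_update_of_ae j hf] with x h1 h2
  simp only [rankOne, h1]
  congr 1
  refine integral_congr_ae ?_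
  filter_upwards [hw, h2] with y h3 h4
  rw [h3, h4]

theorem stronglyMeasurable_rankOne {u w : ℝ → ℂ} {f : (Fin N → ℝ) → ℂ} (j : Fin N)
    (hu : StronglyMeasurable u) (hw : StronglyMeasurable w) (hf : StronglyMeasurable f) :
    StronglyMeasurable (rankOne u w j f) := by
  refine (hu.comp_measurable (measurable_pi_apply j)).mul ?_
  refine StronglyMeasurable.integral_prod_right'
    (f := fun z : (Fin N → ℝ) × ℝ => conj (w z.2) * f (Function.update z.1 j z.2)) ?_
  refine StronglyMeasurable.mul ?_ ?_
  · exact (Complex.continuous_conj.comp_stronglyMeasurable hw).comp_measurable measurable_snd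
  · exact hf.comp_measurable (measurable_fst.comp (measurePreserving_exchange j).measurable)

theorem lintegral_enorm_sq {α : Type*} {m : MeasurableSpace α} (μ : Measure α) (f : α → ℂ) :
    ∫⁻ x, ‖f x‖ₑ ^ 2 ∂μ = eLpNorm f 2 μ ^ 2 := by
  have := eLpNorm_nnreal_pow_eq_lintegral (f := f) (μ := μ) (p := 2) (by norm_num)
  simpa using this.symm

/-- The Cauchy-Schwarz inequality with extended nonnegative values. -/
theorem enorm_integral_conj_mul_sq_le {w g : ℝ → ℂ} (hw : StronglyMeasurable w)
    (hg : StronglyMeasurable g) :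
    ‖∫ y, conj (w y) * g y‖ₑ ^ 2 ≤ (∫⁻ y, ‖w y‖ₑ ^ 2) * ∫⁻ y, ‖g y‖ₑ ^ 2 := by
  have h1 : ‖∫ y, conj (w y) * g y‖ₑ ≤ ∫⁻ y, ‖w y‖ₑ * ‖g y‖ₑ := by
    refine (enorm_integral_le_lintegral_enorm _).trans (le_of_eq ?_)
    refine lintegral_congr fun y => ?_
    rw [enorm_mul]
    congr 1
    simp [enorm_eq_nnnorm]
  have h2 := ENNReal.lintegral_mul_le_Lp_mul_Lq (volume : Measure ℝ)
    (Real.HolderConjugate.two_two) hw.enorm.aemeasurable hg.enorm.aemeasurable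
  have h3 := pow_le_pow_left' (h1.trans h2) 2
  refine h3.trans (le_of_eq ?_)
  rw [mul_pow]
  simp only [← ENNReal.rpow_natCast, ← ENNReal.rpow_mul]
  norm_num

/-- Exchanging the `j`-th coordinate with the variable of integration. -/
theorem lintegral_exchange (j : Fin N) {F : (Fin N → ℝ) → ENNReal} {ρ : ℝ → ENNReal}
    (hF : Measurable F) (hρ : Measurable ρ) :
    ∫⁻ x, ρ (x j) * ∫⁻ y, F (Function.update x j y) = (∫⁻ y, ρ y) * ∫⁻ x, F x := by
  have hm : Measurable (fun z : (Fin N → ℝ) × ℝ => F z.1 * ρ z.2) := by fun_prop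
  have h1 := (measurePreserving_exchange j).lintegral_comp hm
  have h2 : Measurable (fun z : (Fin N → ℝ) × ℝ => F (Function.update z.1 j z.2)) :=
    hF.comp (measurable_fst.comp (measurePreserving_exchange j).measurable)
  rw [mul_comm, ← lintegral_prod_mul hF.aemeasurable hρ.aemeasurable, ← h1]
  rw [lintegral_prod]
  · refine lintegral_congr fun x => ?_
    rw [← lintegral_const_mul]
    · exact lintegral_congr fun y => mul_comm _ _
    · exact h2.comp measurable_prodMk_left
  · exact (hm.comp (measurePreserving_exchange j).measurable).aemeasurable

theorem lintegral_enorm_rankOne_le {u w : ℝ → ℂ} {f : (Fin N → ℝ) → ℂ} (j : Fin N)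
    (hu : StronglyMeasurable u) (hw : StronglyMeasurable w) (hf : StronglyMeasurable f) :
    ∫⁻ x, ‖rankOne u w j f x‖ₑ ^ 2 ≤
      (∫⁻ y, ‖w y‖ₑ ^ 2) * ((∫⁻ y, ‖u y‖ₑ ^ 2) * ∫⁻ x, ‖f x‖ₑ ^ 2) := by
  have hF : Measurable (fun x => ‖f x‖ₑ ^ 2) := hf.enorm.pow_const 2
  have hρ : Measurable (fun x => ‖u x‖ₑ ^ 2) := hu.enorm.pow_const 2
  have hU : Measurable (fun z : (Fin N → ℝ) × ℝ => Function.update z.1 j z.2) :=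
    measurable_fst.comp (measurePreserving_exchange j).measurable
  rw [← lintegral_exchange j hF hρ, ← lintegral_const_mul]
  · refine lintegral_mono fun x => ?_
    rw [rankOne, enorm_mul, mul_pow, mul_left_comm]
    gcongr
    refine enorm_integral_conj_mul_sq_le hw ?_
    exact hf.comp_measurable (hU.comp measurable_prodMk_left)
  · refine (hρ.comp (measurable_pi_apply j)).mul ?_
    exact Measurable.lintegral_prod_right' (f := fun z : (Fin N → ℝ) × ℝ =>
      ‖f (Function.update z.1 j z.2)‖ₑ ^ 2) (hF.comp hU)

theorem eLpNorm_rankOne_le {u w : ℝ → ℂ} {f : (Fin N → ℝ) → ℂ} (j : Fin N)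
    (hu : AEStronglyMeasurable u) (hw : AEStronglyMeasurable w) (hf : AEStronglyMeasurable f) :
    eLpNorm (rankOne u w j f) 2 volume ≤
      eLpNorm u 2 volume * eLpNorm w 2 volume * eLpNorm f 2 volume := by
  rw [eLpNorm_congr_ae (rankOne_congr j hu.ae_eq_mk hw.ae_eq_mk hf.ae_eq_mk),
    eLpNorm_congr_ae hu.ae_eq_mk, eLpNorm_congr_ae hw.ae_eq_mk, eLpNorm_congr_ae hf.ae_eq_mk]
  have h := lintegral_enorm_rankOne_le j hu.stronglyMeasurable_mk hw.stronglyMeasurable_mk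
    hf.stronglyMeasurable_mk
  simp only [lintegral_enorm_sq] at h
  rw [← ENNReal.pow_le_pow_left_iff two_ne_zero]
  refine h.trans (le_of_eq ?_)
  ring

theorem memLp_rankOne {u w : ℝ → ℂ} {f : (Fin N → ℝ) → ℂ} (j : Fin N)
    (hu : MemLp u 2 volume) (hw : MemLp w 2 volume) (hf : MemLp f 2 volume) :
    MemLp (rankOne u w j f) 2 volume := by
  refine ⟨⟨_, stronglyMeasurable_rankOne j hu.1.stronglyMeasurable_mk hw.1.stronglyMeasurable_mk
    hf.1.stronglyMeasurable_mk, rankOne_congr j hu.1.ae_eq_mk hw.1.ae_eq_mk hf.1.ae_eq_mk⟩, ?_⟩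
  exact (eLpNorm_rankOne_le j hu.1 hw.1 hf.1).trans_lt
    (ENNReal.mul_lt_top (ENNReal.mul_lt_top hu.2 hw.2) hf.2)

theorem measurable_update_fst (j : Fin N) :
    Measurable (fun z : (Fin N → ℝ) × ℝ => Function.update z.1 j z.2) :=
  measurable_fst.comp (measurePreserving_exchange j).measurable

/-- Integrating out a variable that remains as a parameter: the total mass is infinite, but
the fibre integrals are finite, as one sees by inserting a positive integrable weight. -/
theorem ae_lintegral_update_lt_top (j : Fin N) {F : (Fin N → ℝ) → ENNReal} (hF : Measurable F)
    (h : ∫⁻ x, F x ≠ ⊤) : ∀ᵐ x : Fin N → ℝ, ∫⁻ y, F (Function.update x j y) < ⊤ := by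
  obtain ⟨ρ, hρ0, hρm, hρ⟩ := exists_pos_lintegral_lt_of_sigmaFinite (volume : Measure ℝ)
    (one_ne_zero : (1 : ENNReal) ≠ 0)
  have hρm' : Measurable (fun x => (ρ x : ENNReal)) := hρm.coe_nnreal_ennreal
  have h1 := lintegral_exchange j hF hρm'
  have h2 : ∫⁻ x, (ρ (x j) : ENNReal) * ∫⁻ y, F (Function.update x j y) ≠ ⊤ := by
    rw [h1]
    exact ENNReal.mul_ne_top (hρ.trans ENNReal.one_lt_top).ne h
  have hG : Measurable fun x : Fin N → ℝ => ∫⁻ y, F (Function.update x j y) :=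
    Measurable.lintegral_prod_right' (f := fun z : (Fin N → ℝ) × ℝ =>
      F (Function.update z.1 j z.2)) (hF.comp (measurable_update_fst j))
  filter_upwards [ae_lt_top ((hρm'.comp (measurable_pi_apply j)).mul hG) h2] with x hx
  by_contra hcon
  rw [not_lt, top_le_iff] at hcon
  simp only [Pi.mul_apply, Function.comp, hcon] at hx
  rw [ENNReal.mul_top (by simpa using (hρ0 (x j)).ne')] at hx
  exact lt_irrefl _ hx

theorem memLp_two_of_lintegral_lt_top {α : Type*} {m : MeasurableSpace α} {μ : Measure α}
    {f : α → ℂ} (hf : AEStronglyMeasurable f μ) (h : ∫⁻ x, ‖f x‖ₑ ^ 2 ∂μ < ⊤) : MemLp f 2 μ := by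
  refine ⟨hf, ?_⟩
  rw [lintegral_enorm_sq] at h
  by_contra hcon
  rw [not_lt, top_le_iff] at hcon
  simp [hcon] at h

theorem lintegral_enorm_sq_lt_top {α : Type*} {m : MeasurableSpace α} {μ : Measure α}
    {f : α → ℂ} (hf : MemLp f 2 μ) : ∫⁻ x, ‖f x‖ₑ ^ 2 ∂μ < ⊤ := by
  rw [lintegral_enorm_sq]
  exact ENNReal.pow_lt_top hf.2

theorem ae_memLp_update (j : Fin N) {f : (Fin N → ℝ) → ℂ} (hf : MemLp f 2 volume) :
    ∀ᵐ x : Fin N → ℝ, MemLp (fun y => f (Function.update x j y)) 2 volume := by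
  set g := hf.1.mk f
  have hg : StronglyMeasurable g := hf.1.stronglyMeasurable_mk
  have hg2 : MemLp g 2 volume := hf.ae_eq hf.1.ae_eq_mk
  filter_upwards [ae_update_of_ae j hf.1.ae_eq_mk, ae_lintegral_update_lt_top j
    (hg.enorm.pow_const 2) (lintegral_enorm_sq_lt_top hg2).ne] with x h1 h2
  have h3 : MemLp (fun y => g (Function.update x j y)) 2 volume :=
    memLp_two_of_lintegral_lt_top (hg.comp_measurable
      ((measurable_update_fst j).comp measurable_prodMk_left)).aestronglyMeasurable h2
  exact h3.ae_eq (EventuallyEq.symm h1)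

theorem memLp_mul_prod {α β : Type*} {mα : MeasurableSpace α} {mβ : MeasurableSpace β}
    {μ : Measure α} {ν : Measure β} [SFinite μ] [SFinite ν] {f : α → ℂ} {g : β → ℂ}
    (hf : MemLp f 2 μ) (hg : MemLp g 2 ν) :
    MemLp (fun z : α × β => f z.1 * g z.2) 2 (μ.prod ν) := by
  have hm : AEStronglyMeasurable (fun z : α × β => f z.1 * g z.2) (μ.prod ν) :=
    hf.1.comp_fst.mul hg.1.comp_snd
  refine memLp_two_of_lintegral_lt_top hm ?_
  have h1 : ∀ z : α × β, ‖f z.1 * g z.2‖ₑ ^ 2 = ‖f z.1‖ₑ ^ 2 * ‖g z.2‖ₑ ^ 2 := fun z => by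
    rw [enorm_mul, mul_pow]
  simp only [h1]
  rw [lintegral_prod_mul (f := fun x => ‖f x‖ₑ ^ 2) (g := fun x => ‖g x‖ₑ ^ 2)
    (hf.1.enorm.pow_const 2) (hg.1.enorm.pow_const 2)]
  exact ENNReal.mul_lt_top (lintegral_enorm_sq_lt_top hf) (lintegral_enorm_sq_lt_top hg)

/-- Almost every slice in two variables of a square-integrable function is square-integrable. -/
theorem ae_memLp_update_update {i j : Fin N} (hij : i ≠ j) {f : (Fin N → ℝ) → ℂ}
    (hm : StronglyMeasurable f) (hf : MemLp f 2 volume) :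
    ∀ᵐ x : Fin N → ℝ, MemLp (fun z : ℝ × ℝ =>
      f (Function.update (Function.update x i z.1) j z.2)) 2 (volume.prod volume) := by
  obtain ⟨ρ, hρ0, hρm, hρ⟩ := exists_pos_lintegral_lt_of_sigmaFinite (volume : Measure ℝ)
    (one_ne_zero : (1 : ENNReal) ≠ 0)
  have hρm' : Measurable (fun x => (ρ x : ENNReal)) := hρm.coe_nnreal_ennreal
  have hF : Measurable (fun x => ‖f x‖ₑ ^ 2) := hm.enorm.pow_const 2
  have hG : Measurable fun x : Fin N → ℝ => ∫⁻ y, ‖f (Function.update x j y)‖ₑ ^ 2 :=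
    Measurable.lintegral_prod_right' (f := fun z : (Fin N → ℝ) × ℝ =>
      ‖f (Function.update z.1 j z.2)‖ₑ ^ 2) (hF.comp (measurable_update_fst j))
  have hρG : Measurable fun x : Fin N → ℝ =>
      (ρ (x j) : ENNReal) * ∫⁻ y, ‖f (Function.update x j y)‖ₑ ^ 2 :=
    (hρm'.comp (measurable_pi_apply j)).mul hG
  have h1 := lintegral_exchange j hF hρm'
  have h2 : ∫⁻ x, (ρ (x j) : ENNReal) * ∫⁻ y, ‖f (Function.update x j y)‖ₑ ^ 2 ≠ ⊤ := by
    rw [h1]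
    exact ENNReal.mul_ne_top (hρ.trans ENNReal.one_lt_top).ne (lintegral_enorm_sq_lt_top hf).ne
  have hU : ∀ x : Fin N → ℝ, Measurable fun z : ℝ × ℝ =>
      Function.update (Function.update x i z.1) j z.2 := fun x =>
    (measurable_update_fst j).comp ((((measurable_update_fst i).comp
      measurable_prodMk_left).comp measurable_fst).prodMk measurable_snd)
  filter_upwards [ae_lintegral_update_lt_top i hρG h2] with x hx
  refine memLp_two_of_lintegral_lt_top (hm.comp_measurable (hU x)).aestronglyMeasurable ?_
  rw [lintegral_prod (fun z : ℝ × ℝ => ‖f (Function.update (Function.update x i z.1) j z.2)‖ₑ ^ 2)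
    (hF.comp (hU x)).aemeasurable]
  simp only [Function.update_of_ne hij.symm] at hx
  rw [lintegral_const_mul] at hx
  · by_contra hcon
    rw [not_lt, top_le_iff] at hcon
    simp only [hcon] at hx
    rw [ENNReal.mul_top (by simpa using (hρ0 (x j)).ne')] at hx
    exact lt_irrefl _ hx
  · exact hG.comp ((measurable_update_fst i).comp measurable_prodMk_left)

theorem rankOne_comm_of_stronglyMeasurable {u u' w w' : ℝ → ℂ} {f : (Fin N → ℝ) → ℂ} {i j : Fin N}
    (hij : i ≠ j) (hw : MemLp w 2 volume) (hw' : MemLp w' 2 volume)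
    (hm : StronglyMeasurable f) (hf : MemLp f 2 volume) :
    rankOne u w i (rankOne u' w' j f) =ᵐ[volume] rankOne u' w' j (rankOne u w i f) := by
  filter_upwards [ae_memLp_update_update hij hm hf] with x hx
  have h1 := memLp_mul_prod hw.star hw'.star
  have h2 : Integrable (Function.uncurry fun y z => conj (w y) * conj (w' z) *
      f (Function.update (Function.update x i y) j z)) (volume.prod volume) :=
    h1.integrable_mul hx
  have h3 := integral_integral_swap h2
  have e1 : rankOne u w i (rankOne u' w' j f) x = u (x i) * (u' (x j) * ∫ y, ∫ z,
      conj (w y) * conj (w' z) * f (Function.update (Function.update x i y) j z)) := by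
    simp only [rankOne, Function.update_of_ne hij.symm]
    rw [← integral_const_mul (u' (x j))]
    congr 2
    funext y
    rw [mul_left_comm, ← integral_const_mul]
    simp only [mul_assoc]
  have e2 : rankOne u' w' j (rankOne u w i f) x = u' (x j) * (u (x i) * ∫ z, ∫ y,
      conj (w y) * conj (w' z) * f (Function.update (Function.update x i y) j z)) := by
    simp only [rankOne, Function.update_of_ne hij]
    rw [← integral_const_mul (u (x i))]
    congr 2
    funext z
    rw [mul_left_comm, ← integral_const_mul]
    congr 2
    funext y
    rw [Function.update_comm hij]
    ring
  rw [e1, e2, h3]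
  ring

theorem rankOne_comm {u u' w w' : ℝ → ℂ} {f : (Fin N → ℝ) → ℂ} {i j : Fin N} (hij : i ≠ j)
    (hw : MemLp w 2 volume) (hw' : MemLp w' 2 volume) (hf : MemLp f 2 volume) :
    rankOne u w i (rankOne u' w' j f) =ᵐ[volume] rankOne u' w' j (rankOne u w i f) := by
  have h := hf.1.ae_eq_mk
  have h1 := rankOne_comm_of_stronglyMeasurable (u := u) (u' := u') hij hw hw'
    hf.1.stronglyMeasurable_mk (hf.ae_eq h)
  have e (v z : ℝ → ℂ) (k : Fin N) := rankOne_congr k (.refl _ v) (.refl _ z) h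
  exact (rankOne_congr i (.refl _ u) (.refl _ w) (e u' w' j)).trans
    (h1.trans (rankOne_congr j (.refl _ u') (.refl _ w') (e u w i)).symm)

theorem rankOne_rankOne_same (u u' w w' : ℝ → ℂ) (j : Fin N) (f : (Fin N → ℝ) → ℂ) :
    rankOne u w j (rankOne u' w' j f) = (∫ y, conj (w y) * u' y) • rankOne u w' j f := by
  funext x
  simp only [rankOne, Function.update_self, Function.update_idem, Pi.smul_apply, smul_eq_mul,
    ← mul_assoc, integral_mul_const]
  ring

theorem rankOne_mul {u w : ℝ → ℂ} {j : Fin N} {f m : (Fin N → ℝ) → ℂ}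
    (hm : ∀ x y, m (Function.update x j y) = m x) :
    rankOne u w j (fun x => m x * f x) = fun x => m x * rankOne u w j f x := by
  funext x
  simp only [rankOne, hm, mul_left_comm _ (m x), integral_const_mul]

theorem rankOne_comp_perm (u w : ℝ → ℂ) (j : Fin N) (σ : Equiv.Perm (Fin N))
    (f : (Fin N → ℝ) → ℂ) :
    rankOne u w (σ j) (fun x => f (x ∘ σ)) = fun x => rankOne u w j f (x ∘ σ) := by
  funext x
  simp only [rankOne, Function.comp]
  congr 3
  funext y
  congr 2
  funext k
  by_cases h : k = j
  · subst h; simp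
  · simp [Function.update_of_ne h, Function.update_of_ne (σ.injective.ne h)]

theorem rankOne_shift_of_ne (u w : ℝ → ℂ) {i j : Fin N} (hij : i ≠ j) (s : ℝ)
    (f : (Fin N → ℝ) → ℂ) :
    rankOne u w j (fun x => f (x + s • Pi.single i (1 : ℝ))) =
      fun x => rankOne u w j f (x + s • Pi.single i (1 : ℝ)) := by
  funext x
  simp only [rankOne]
  congr 2
  · simp [hij.symm]
  · funext y
    congr 2
    funext k
    by_cases h : k = j
    · subst h; simp [hij.symm]
    · simp [Function.update_of_ne h]

theorem rankOne_shift_self (u w : ℝ → ℂ) (j : Fin N) (s : ℝ) (f : (Fin N → ℝ) → ℂ) :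
    rankOne (fun y => u (y + s • (1 : ℝ))) w j f =
      fun x => rankOne u w j f (x + s • Pi.single j (1 : ℝ)) := by
  funext x
  simp only [rankOne]
  congr 2
  · simp
  · funext y
    congr 2
    funext k
    by_cases h : k = j
    · subst h; simp
    · simp [Function.update_of_ne h, Pi.single_eq_of_ne h]

/-- The adjoint of `|u⟩⟨w|` is `|w⟩⟨u|`, by exchanging the `j`-th coordinate with the
variable of integration. -/
theorem integral_conj_mul_rankOne {u w : ℝ → ℂ} {f g : (Fin N → ℝ) → ℂ} (j : Fin N)
    (hu : MemLp u 2 volume) (hw : MemLp w 2 volume) (hf : MemLp f 2 volume)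
    (hg : MemLp g 2 volume) :
    ∫ x, conj (f x) * rankOne u w j g x = ∫ x, conj (rankOne w u j f x) * g x := by
  let F : (Fin N → ℝ) × ℝ → ℂ := fun z =>
    conj (f (Function.update z.1 j z.2)) * conj (w (z.1 j)) * (g z.1 * u z.2)
  have h1 : MemLp (fun z : (Fin N → ℝ) × ℝ => conj (f z.1) * conj (w z.2)) 2
    (volume.prod volume) := memLp_mul_prod hf.star hw.star
  have h2 := memLp_mul_prod hg hu
  have hF : Integrable F (volume.prod volume) :=
    (h1.comp_measurePreserving (measurePreserving_exchange j)).integrable_mul h2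
  have hFe : Integrable (F ∘ exchange j) (volume.prod volume) :=
    (measurePreserving_exchange j).integrable_comp_of_integrable hF
  have h3 : ∫ z, F (exchange j z) ∂(volume.prod volume) = ∫ z, F z ∂(volume.prod volume) := by
    have hmap := (measurePreserving_exchange j).map_eq
    conv_rhs => rw [← hmap]
    rw [integral_map (measurePreserving_exchange j).measurable.aemeasurable]
    rw [hmap]
    exact hF.1
  rw [integral_prod _ hF, integral_prod (fun z => F (exchange j z)) hFe] at h3
  refine Eq.trans ?_ (h3.trans ?_)
  · congr 1
    funext x
    simp only [F, exchange, rankOne, Function.update_idem, Function.update_self,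
      Function.update_eq_self, ← integral_const_mul]
    congr 1
    funext y
    ring
  · congr 1
    funext x
    simp only [F, rankOne, map_mul, ← integral_conj, Complex.conj_conj]
    rw [mul_right_comm, ← integral_const_mul]
    congr 1
    funext y
    ring

theorem rankOne_add_right {u w : ℝ → ℂ} {f g : (Fin N → ℝ) → ℂ} (j : Fin N)
    (hw : MemLp w 2 volume) (hf : MemLp f 2 volume) (hg : MemLp g 2 volume) :
    rankOne u w j (f + g) =ᵐ[volume] rankOne u w j f + rankOne u w j g := by
  filter_upwards [ae_memLp_update j hf, ae_memLp_update j hg] with x h1 h2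
  simp only [rankOne, Pi.add_apply, mul_add]
  have hc : MemLp (fun y => conj (w y)) 2 volume := hw.star
  rw [integral_add, mul_add]
  · exact hc.integrable_mul h1
  · exact hc.integrable_mul h2

theorem rankOne_add_left (u u' w : ℝ → ℂ) (j : Fin N) (f : (Fin N → ℝ) → ℂ) :
    rankOne (u + u') w j f = rankOne u w j f + rankOne u' w j f := by
  funext x
  simp [rankOne, add_mul]

theorem rankOne_smul_left (c : ℂ) (u w : ℝ → ℂ) (j : Fin N) (f : (Fin N → ℝ) → ℂ) :
    rankOne (c • u) w j f = c • rankOne u w j f := by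
  funext x
  simp [rankOne, mul_assoc]

theorem rankOne_smul_right (c : ℂ) (u w : ℝ → ℂ) (j : Fin N) (f : (Fin N → ℝ) → ℂ) :
    rankOne u w j (c • f) = c • rankOne u w j f := by
  funext x
  simp only [rankOne, Pi.smul_apply, smul_eq_mul, mul_left_comm _ c, integral_const_mul]

/-- The `N`-particle space. -/
abbrev ManyBody (N : ℕ) := L2 (Fin N → ℝ)

/-- The map `f ↦ |u⟩⟨w|ⱼ f` on classes of functions. -/
def ketbraFun (u w : L2 ℝ) (j : Fin N) (f : ManyBody N) : ManyBody N :=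
  (memLp_rankOne j (Lp.memLp u) (Lp.memLp w) (Lp.memLp f)).toLp _

theorem ketbraFun_add (u w : L2 ℝ) (j : Fin N) (f g : ManyBody N) :
    ketbraFun u w j (f + g) = ketbraFun u w j f + ketbraFun u w j g := by
  unfold ketbraFun
  rw [← MemLp.toLp_add, MemLp.toLp_eq_toLp_iff]
  exact (rankOne_congr j (.refl _ _) (.refl _ _) (Lp.coeFn_add f g)).trans
    (rankOne_add_right j (Lp.memLp w) (Lp.memLp f) (Lp.memLp g))

theorem ketbraFun_smul (u w : L2 ℝ) (j : Fin N) (c : ℂ) (f : ManyBody N) :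
    ketbraFun u w j (c • f) = c • ketbraFun u w j f := by
  unfold ketbraFun
  rw [← MemLp.toLp_const_smul, MemLp.toLp_eq_toLp_iff]
  refine (rankOne_congr j (.refl _ _) (.refl _ _) (Lp.coeFn_smul c f)).trans ?_
  rw [rankOne_smul_right]

theorem ketbraFun_add_left (u u' w : L2 ℝ) (j : Fin N) (f : ManyBody N) :
    ketbraFun (u + u') w j f = ketbraFun u w j f + ketbraFun u' w j f := by
  unfold ketbraFun
  rw [← MemLp.toLp_add, MemLp.toLp_eq_toLp_iff]
  refine (rankOne_congr j (Lp.coeFn_add u u') (.refl _ _) (.refl _ _)).trans ?_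
  rw [rankOne_add_left]

theorem ketbraFun_smul_left (u w : L2 ℝ) (j : Fin N) (c : ℂ) (f : ManyBody N) :
    ketbraFun (c • u) w j f = c • ketbraFun u w j f := by
  unfold ketbraFun
  rw [← MemLp.toLp_const_smul, MemLp.toLp_eq_toLp_iff]
  refine (rankOne_congr j (Lp.coeFn_smul c u) (.refl _ _) (.refl _ _)).trans ?_
  rw [rankOne_smul_left]

theorem norm_ketbraFun_le (u w : L2 ℝ) (j : Fin N) (f : ManyBody N) :
    ‖ketbraFun u w j f‖ ≤ ‖u‖ * ‖w‖ * ‖f‖ := by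
  rw [ketbraFun, Lp.norm_toLp, Lp.norm_def, Lp.norm_def, Lp.norm_def, ← ENNReal.toReal_mul,
    ← ENNReal.toReal_mul]
  refine ENNReal.toReal_mono ?_ (eLpNorm_rankOne_le j (Lp.memLp u).1 (Lp.memLp w).1
    (Lp.memLp f).1)
  exact ENNReal.mul_ne_top (ENNReal.mul_ne_top (Lp.eLpNorm_ne_top _) (Lp.eLpNorm_ne_top _))
    (Lp.eLpNorm_ne_top _)

/-- The rank-one operator `|u⟩⟨w|` in the variable of the `j`-th particle, as a bounded operator
on `L²(ℝᴺ)`. -/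
def ketbra (u w : L2 ℝ) (j : Fin N) : ManyBody N →L[ℂ] ManyBody N :=
  LinearMap.mkContinuous
    { toFun := ketbraFun u w j
      map_add' := ketbraFun_add u w j
      map_smul' := ketbraFun_smul u w j }
    (‖u‖ * ‖w‖) (norm_ketbraFun_le u w j)

theorem norm_ketbra_apply_le (u w : L2 ℝ) (j : Fin N) (f : ManyBody N) :
    ‖ketbra u w j f‖ ≤ ‖u‖ * ‖w‖ * ‖f‖ :=
  norm_ketbraFun_le u w j f

theorem ketbra_toLp {u w : ℝ → ℂ} (j : Fin N) {f : (Fin N → ℝ) → ℂ}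
    (hu : MemLp u 2 volume) (hw : MemLp w 2 volume) (hf : MemLp f 2 volume) :
    ketbra (hu.toLp u) (hw.toLp w) j (hf.toLp f) = (memLp_rankOne j hu hw hf).toLp _ := by
  change ketbraFun _ _ _ _ = _
  rw [ketbraFun, MemLp.toLp_eq_toLp_iff]
  exact rankOne_congr j hu.coeFn_toLp hw.coeFn_toLp hf.coeFn_toLp

theorem L2.exists_toLp {α : Type*} [MeasureSpace α] (f : L2 α) :
    ∃ (g : α → ℂ) (hg : MemLp g 2 volume), f = hg.toLp g :=
  ⟨f, Lp.memLp f, (Lp.toLp_coeFn f _).symm⟩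

theorem inner_ketbra_right (u w : L2 ℝ) (j : Fin N) (f g : ManyBody N) :
    inner ℂ f (ketbra u w j g) = inner ℂ (ketbra w u j f) g := by
  obtain ⟨u, hu, rfl⟩ := L2.exists_toLp u
  obtain ⟨w, hw, rfl⟩ := L2.exists_toLp w
  obtain ⟨f, hf, rfl⟩ := L2.exists_toLp f
  obtain ⟨g, hg, rfl⟩ := L2.exists_toLp g
  rw [ketbra_toLp, ketbra_toLp, ← l2Inner_eq_inner, ← l2Inner_eq_inner]
  exact integral_conj_mul_rankOne j hu hw hf hg

theorem ketbra_ketbra_same (u u' w w' : L2 ℝ) (j : Fin N) (f : ManyBody N) :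
    ketbra u w j (ketbra u' w' j f) = (inner ℂ w u' : ℂ) • ketbra u w' j f := by
  obtain ⟨u, hu, rfl⟩ := L2.exists_toLp u
  obtain ⟨w, hw, rfl⟩ := L2.exists_toLp w
  obtain ⟨u', hu', rfl⟩ := L2.exists_toLp u'
  obtain ⟨w', hw', rfl⟩ := L2.exists_toLp w'
  obtain ⟨f, hf, rfl⟩ := L2.exists_toLp f
  rw [ketbra_toLp, ketbra_toLp, ketbra_toLp, ← l2Inner_eq_inner, ← MemLp.toLp_const_smul,
    MemLp.toLp_eq_toLp_iff, rankOne_rankOne_same]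
  rfl

theorem ketbra_comm (u u' w w' : L2 ℝ) {i j : Fin N} (hij : i ≠ j) (f : ManyBody N) :
    ketbra u w i (ketbra u' w' j f) = ketbra u' w' j (ketbra u w i f) := by
  obtain ⟨u, hu, rfl⟩ := L2.exists_toLp u
  obtain ⟨w, hw, rfl⟩ := L2.exists_toLp w
  obtain ⟨u', hu', rfl⟩ := L2.exists_toLp u'
  obtain ⟨w', hw', rfl⟩ := L2.exists_toLp w'
  obtain ⟨f, hf, rfl⟩ := L2.exists_toLp f
  rw [ketbra_toLp, ketbra_toLp, ketbra_toLp, ketbra_toLp, MemLp.toLp_eq_toLp_iff]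
  exact rankOne_comm hij hw hw' hf

/-- The map `u ↦ |u⟩⟨w|ⱼ f`, for fixed `w` and `f`. -/
def ketMap (w : L2 ℝ) (j : Fin N) (f : ManyBody N) : L2 ℝ →L[ℂ] ManyBody N :=
  LinearMap.mkContinuous
    { toFun := fun u => ketbraFun u w j f
      map_add' := fun u u' => ketbraFun_add_left u u' w j f
      map_smul' := fun c u => ketbraFun_smul_left u w j c f }
    (‖w‖ * ‖f‖) (fun u => (norm_ketbraFun_le u w j f).trans_eq (by ring))

theorem shift_toLp {E : Type*} [NormedAddCommGroup E] [NormedSpace ℝ E] [MeasureSpace E]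
    [BorelSpace E] [(volume : Measure E).IsAddRightInvariant] (v : E) (s : ℝ) {f : E → ℂ}
    (hf : MemLp f 2 volume) : shift v s (hf.toLp f) = (hf.comp_measurePreserving
      (measurePreserving_add_right (volume : Measure E) (s • v))).toLp _ := rfl

theorem shift_ketbra_of_ne (u w : L2 ℝ) {i j : Fin N} (hij : i ≠ j) (s : ℝ) (f : ManyBody N) :
    shift (Pi.single i (1 : ℝ)) s (ketbra u w j f) =
      ketbra u w j (shift (Pi.single i (1 : ℝ)) s f) := by
  obtain ⟨u, hu, rfl⟩ := L2.exists_toLp u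
  obtain ⟨w, hw, rfl⟩ := L2.exists_toLp w
  obtain ⟨f, hf, rfl⟩ := L2.exists_toLp f
  rw [shift_toLp, ketbra_toLp, ketbra_toLp, shift_toLp, MemLp.toLp_eq_toLp_iff]
  exact (rankOne_shift_of_ne u w hij s f).symm.eventuallyEq

theorem shift_ketbra_self (u w : L2 ℝ) (j : Fin N) (s : ℝ) (f : ManyBody N) :
    shift (Pi.single j (1 : ℝ)) s (ketbra u w j f) = ketbra (shift (1 : ℝ) s u) w j f := by
  obtain ⟨u, hu, rfl⟩ := L2.exists_toLp u
  obtain ⟨w, hw, rfl⟩ := L2.exists_toLp w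
  obtain ⟨f, hf, rfl⟩ := L2.exists_toLp f
  rw [shift_toLp, ketbra_toLp, ketbra_toLp, shift_toLp, MemLp.toLp_eq_toLp_iff]
  exact (rankOne_shift_self u w j s f).symm.eventuallyEq

theorem HasDirDeriv.ketbra_of_ne {u w : L2 ℝ} {i j : Fin N} (hij : i ≠ j) {f g : ManyBody N}
    (h : HasDirDeriv (Pi.single i (1 : ℝ)) f g) :
    HasDirDeriv (Pi.single i (1 : ℝ)) (ketbra u w j f) (ketbra u w j g) :=
  h.map _ fun s => shift_ketbra_of_ne u w hij s f

theorem HasDirDeriv.ketbra_self {u u' : L2 ℝ} (h : HasDirDeriv (1 : ℝ) u u') (w : L2 ℝ)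
    (j : Fin N) (f : ManyBody N) :
    HasDirDeriv (Pi.single j (1 : ℝ)) (ketbra u w j f) (ketbra u' w j f) :=
  h.map (ketMap w j f) fun s => shift_ketbra_self u w j s f

/-! ### Permutations of the particles -/

theorem measurePreserving_perm (σ : Equiv.Perm (Fin N)) :
    MeasurePreserving (fun x : Fin N → ℝ => x ∘ σ) :=
  volume_preserving_arrowCongr' σ.symm (MeasurableEquiv.refl ℝ) (MeasurePreserving.id _)

/-- The action `f ↦ f (· ∘ σ)` of a permutation of the particle labels on `L²(ℝᴺ)`. -/
def permute (σ : Equiv.Perm (Fin N)) : ManyBody N →ₗᵢ[ℂ] ManyBody N :=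
  Lp.compMeasurePreservingₗᵢ ℂ (fun x => x ∘ σ) (measurePreserving_perm σ)

theorem permute_toLp (σ : Equiv.Perm (Fin N)) {f : (Fin N → ℝ) → ℂ} (hf : MemLp f 2 volume) :
    permute σ (hf.toLp f) = (hf.comp_measurePreserving (measurePreserving_perm σ)).toLp _ := rfl

theorem permute_ketbra (u w : L2 ℝ) (σ : Equiv.Perm (Fin N)) (j : Fin N) (f : ManyBody N) :
    permute σ (ketbra u w j f) = ketbra u w (σ j) (permute σ f) := by
  obtain ⟨u, hu, rfl⟩ := L2.exists_toLp u
  obtain ⟨w, hw, rfl⟩ := L2.exists_toLp w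
  obtain ⟨f, hf, rfl⟩ := L2.exists_toLp f
  rw [permute_toLp, ketbra_toLp, ketbra_toLp, permute_toLp, MemLp.toLp_eq_toLp_iff]
  exact (rankOne_comp_perm u w j σ f).symm.eventuallyEq

theorem HasDirDeriv.permute (σ : Equiv.Perm (Fin N)) {i : Fin N} {f g : ManyBody N}
    (h : HasDirDeriv (Pi.single i (1 : ℝ)) f g) :
    HasDirDeriv (Pi.single (σ i) (1 : ℝ)) (permute σ f) (permute σ g) := by
  refine h.map (LiebLiniger.permute σ).toContinuousLinearMap fun s => ?_
  obtain ⟨f, hf, rfl⟩ := L2.exists_toLp f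
  change shift _ s (LiebLiniger.permute σ _) = LiebLiniger.permute σ _
  rw [shift_toLp, permute_toLp, shift_toLp, permute_toLp, MemLp.toLp_eq_toLp_iff]
  refine Eq.eventuallyEq ?_
  funext x
  simp only [Function.comp]
  congr 1
  funext k
  by_cases hk : k = i
  · subst hk; simp
  · simp [Pi.single_eq_of_ne hk, Pi.single_eq_of_ne (σ.injective.ne hk)]

end RankOne

/-! ### Joint decomposition by commuting projections -/

section Sectors

variable {H : Type*} [NormedAddCommGroup H] [InnerProductSpace ℂ H]

/-- A family of commuting orthogonal projections. -/
structure CommutingProjections {ι : Type*} (P : ι → H →L[ℂ] H) : Prop where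
  symm : ∀ i f g, inner ℂ f (P i g) = inner ℂ (P i f) g
  idem : ∀ i f, P i (P i f) = P i f
  comm : ∀ i j f, P i (P j f) = P j (P i f)

section List

variable {ι : Type*} [DecidableEq ι] (P : ι → H →L[ℂ] H)

/-- The product over the list of `1 - P j` for `j ∈ S` and of `P j` for `j ∉ S`. -/
def listSector (S : Finset ι) (L : List ι) : H →L[ℂ] H :=
  (L.map fun j => if j ∈ S then 1 - P j else P j).prod

variable {P}

theorem listSector_cons (S : Finset ι) (j : ι) (L : List ι) (f : H) :
    listSector P S (j :: L) f =
      if j ∈ S then listSector P S L f - P j (listSector P S L f)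
      else P j (listSector P S L f) := by
  by_cases h : j ∈ S <;> simp [listSector, h]

theorem listSector_congr {S T : Finset ι} {L : List ι} (h : ∀ j ∈ L, j ∈ S ↔ j ∈ T) :
    listSector P S L = listSector P T L := by
  unfold listSector
  congr 1
  refine List.map_congr_left fun j hj => ?_
  simp only [h j hj]

theorem CommutingProjections.apply_listSector (hP : CommutingProjections P) (S : Finset ι)
    (L : List ι) {i : ι} (hi : i ∈ L) (f : H) :
    P i (listSector P S L f) = if i ∈ S then 0 else listSector P S L f := by
  induction L with
  | nil => simp at hi
  | cons j L ih =>
    rw [listSector_cons]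
    by_cases hij : i = j
    · subst hij
      split_ifs
      · rw [map_sub, hP.idem, sub_self]
      · rw [hP.idem]
    · have := ih (by simpa [hij] using hi)
      split_ifs <;> simp_all [hP.comm i j]

theorem sum_listSector {L : List ι} (hL : L.Nodup) (f : H) :
    ∑ S ∈ L.toFinset.powerset, listSector P S L f = f := by
  induction L with
  | nil => simp [listSector]
  | cons j L ih =>
    rw [List.nodup_cons] at hL
    have hj : j ∉ L.toFinset := by simpa using hL.1
    rw [List.toFinset_cons, Finset.sum_powerset_insert hj, ← Finset.sum_add_distrib]
    refine Eq.trans (Finset.sum_congr rfl fun S hS => ?_) (ih hL.2)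
    have hjS : j ∉ S := fun h => hj (Finset.mem_powerset.1 hS h)
    have e : listSector P (insert j S) L = listSector P S L := by
      refine listSector_congr fun k hk => ?_
      have : k ≠ j := fun h => hL.1 (h ▸ hk)
      simp [this]
    rw [listSector_cons, listSector_cons, e, if_neg hjS, if_pos (Finset.mem_insert_self _ _)]
    abel

theorem listSector_of_forall {T : Finset ι} {g : H} (hg : ∀ j, P j g = if j ∈ T then 0 else g)
    (S : Finset ι) (L : List ι) :
    listSector P S L g = if ∀ j ∈ L, j ∈ S ↔ j ∈ T then g else 0 := by
  induction L with
  | nil => simp [listSector]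
  | cons j L ih =>
    rw [listSector_cons, ih]
    by_cases hL : ∀ j ∈ L, j ∈ S ↔ j ∈ T
    · rw [if_pos hL]
      have e : (∀ k ∈ j :: L, k ∈ S ↔ k ∈ T) ↔ (j ∈ S ↔ j ∈ T) := by
        rw [List.forall_mem_cons]
        exact and_iff_left hL
      simp only [e]
      by_cases h1 : j ∈ S <;> by_cases h2 : j ∈ T <;> simp [h1, h2, hg]
    · rw [if_neg hL, if_neg (fun h => hL (List.forall_mem_cons.1 h).2)]
      simp

end List

variable {N : ℕ} (P : Fin N → H →L[ℂ] H)

/-- The projection onto the sector in which exactly the particles in `S` are outside of the ranges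
of the given projections. -/
def sector (S : Finset (Fin N)) : H →L[ℂ] H := listSector P S (List.finRange N)

variable {P}

theorem CommutingProjections.apply_sector (hP : CommutingProjections P) (S : Finset (Fin N))
    (i : Fin N) (f : H) : P i (sector P S f) = if i ∈ S then 0 else sector P S f :=
  hP.apply_listSector S _ (List.mem_finRange i) f

theorem sum_sector (f : H) : ∑ S, sector P S f = f := by
  have := sum_listSector (P := P) (List.nodup_finRange N) f
  rwa [List.toFinset_finRange, Finset.powerset_univ] at this

theorem sector_of_forall {T : Finset (Fin N)} {g : H}
    (hg : ∀ j, P j g = if j ∈ T then 0 else g) (S : Finset (Fin N)) :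
    sector P S g = if S = T then g else 0 := by
  rw [sector, listSector_of_forall hg]
  simp [Finset.ext_iff]

theorem CommutingProjections.apply_eq_sum (hP : CommutingProjections P) (i : Fin N) (f : H) :
    P i f = ∑ S with i ∉ S, sector P S f := by
  conv_lhs => rw [← sum_sector (P := P) f, map_sum]
  simp only [hP.apply_sector]
  rw [Finset.sum_filter]
  refine Finset.sum_congr rfl fun S _ => ?_
  split_ifs <;> simp_all

theorem CommutingProjections.sub_apply_eq_sum (hP : CommutingProjections P) (i : Fin N) (f : H) :
    f - P i f = ∑ S with i ∈ S, sector P S f := by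
  rw [hP.apply_eq_sum, sub_eq_iff_eq_add, Finset.sum_filter_add_sum_filter_not, sum_sector]

theorem CommutingProjections.inner_eq_zero {ι : Type*} {P : ι → H →L[ℂ] H}
    (hP : CommutingProjections P) {i : ι} {f g : H} (hf : P i f = f) (hg : P i g = 0) :
    inner ℂ f g = 0 := by
  rw [← hf, ← hP.symm, hg, inner_zero_right]

theorem CommutingProjections.inner_eq_zero' {ι : Type*} {P : ι → H →L[ℂ] H}
    (hP : CommutingProjections P) {i : ι} {f g : H} (hf : P i f = 0) (hg : P i g = g) :
    inner ℂ f g = 0 := by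
  rw [← inner_conj_symm, hP.inner_eq_zero hg hf, map_zero]

/-- Vectors in distinct sectors are orthogonal, and it suffices that the sectors be distinguished
by a single projection. -/
theorem CommutingProjections.inner_eq_zero_of_mem_xor {ι : Type*} {P : ι → H →L[ℂ] H}
    [DecidableEq ι] (hP : CommutingProjections P) {i : ι} {S T : Finset ι} {f g : H}
    (hf : P i f = if i ∈ S then 0 else f) (hg : P i g = if i ∈ T then 0 else g)
    (h : ¬(i ∈ S ↔ i ∈ T)) : inner ℂ f g = 0 := by
  by_cases h1 : i ∈ S <;> by_cases h2 : i ∈ T <;> simp only [h1, h2, if_true, if_false] at hf hg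
  · simp [h1, h2] at h
  · exact hP.inner_eq_zero' hf hg
  · exact hP.inner_eq_zero hf hg
  · simp [h1, h2] at h

theorem CommutingProjections.inner_sector_sector (hP : CommutingProjections P)
    {S T : Finset (Fin N)} (h : S ≠ T) (f g : H) :
    inner ℂ (sector P S f) (sector P T g) = 0 := by
  obtain ⟨i, hi⟩ : ∃ i, ¬(i ∈ S ↔ i ∈ T) := by
    by_contra! hcon
    exact h (Finset.ext hcon)
  exact hP.inner_eq_zero_of_mem_xor (hP.apply_sector S i f) (hP.apply_sector T i g) hi

theorem norm_sum_sq_of_orthogonal {ι : Type*} (s : Finset ι) (f : ι → H)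
    (h : ∀ i ∈ s, ∀ j ∈ s, i ≠ j → inner ℂ (f i) (f j) = 0) :
    ‖∑ i ∈ s, f i‖ ^ 2 = ∑ i ∈ s, ‖f i‖ ^ 2 := by
  have h1 : inner ℂ (∑ i ∈ s, f i) (∑ i ∈ s, f i) = ∑ i ∈ s, ((‖f i‖ ^ 2 : ℝ) : ℂ) := by
    rw [sum_inner]
    refine Finset.sum_congr rfl fun i hi => ?_
    rw [inner_sum, Finset.sum_eq_single i (fun j hj hij => h i hi j hj hij.symm)
      (fun h => absurd hi h), inner_self_eq_norm_sq_to_K]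
    simp
  rw [inner_self_eq_norm_sq_to_K] at h1
  exact Complex.ofReal_injective ((by simp : _ = _).trans (h1.trans (by simp)))

theorem CommutingProjections.norm_sum_sector_sq (hP : CommutingProjections P)
    (A : Finset (Finset (Fin N))) (f : H) :
    ‖∑ S ∈ A, sector P S f‖ ^ 2 = ∑ S ∈ A, ‖sector P S f‖ ^ 2 :=
  norm_sum_sq_of_orthogonal _ _ fun _ _ _ _ h => hP.inner_sector_sector h f f

theorem CommutingProjections.inner_sector_self (hP : CommutingProjections P)
    (S : Finset (Fin N)) (f : H) : inner ℂ f (sector P S f) = ((‖sector P S f‖ ^ 2 : ℝ) : ℂ) := by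
  conv_lhs => rw [← sum_sector (P := P) f, sum_inner]
  rw [Finset.sum_eq_single S (fun T _ h => ?_) (by simp)]
  · rw [sum_sector, inner_self_eq_norm_sq_to_K]
    simp
  · rw [sum_sector]
    exact hP.inner_sector_sector h f f

theorem norm_apply_le_of_symm_idem {Q : H →L[ℂ] H} (hs : ∀ f g, inner ℂ f (Q g) = inner ℂ (Q f) g)
    (hi : ∀ f, Q (Q f) = Q f) (f : H) : ‖Q f‖ ≤ ‖f‖ ∧ ‖f - Q f‖ ≤ ‖f‖ := by
  have h0 : inner ℂ (Q f) (f - Q f) = 0 := by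
    rw [← hs, map_sub, hi, sub_self, inner_zero_right]
  have h1 := norm_add_sq_eq_norm_sq_add_norm_sq_of_inner_eq_zero (𝕜 := ℂ) _ _ h0
  rw [add_sub_cancel] at h1
  constructor <;> nlinarith [norm_nonneg f, norm_nonneg (Q f), norm_nonneg (f - Q f)]

theorem CommutingProjections.norm_apply_le {ι : Type*} {P : ι → H →L[ℂ] H}
    (hP : CommutingProjections P) (i : ι) (f : H) : ‖P i f‖ ≤ ‖f‖ :=
  (norm_apply_le_of_symm_idem (hP.symm i) (hP.idem i) f).1

theorem CommutingProjections.norm_sub_apply_le {ι : Type*} {P : ι → H →L[ℂ] H}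
    (hP : CommutingProjections P) (i : ι) (f : H) : ‖f - P i f‖ ≤ ‖f‖ :=
  (norm_apply_le_of_symm_idem (hP.symm i) (hP.idem i) f).2

/-- An operator that permutes the projections permutes the sectors. -/
theorem CommutingProjections.map_sector (hP : CommutingProjections P) (U : H →L[ℂ] H)
    (σ : Equiv.Perm (Fin N)) (hU : ∀ j f, U (P j f) = P (σ j) (U f)) (S : Finset (Fin N)) (f : H) :
    U (sector P S f) = sector P (S.map σ.toEmbedding) (U f) := by
  have h1 (T : Finset (Fin N)) (R : Finset (Fin N)) : sector P R (U (sector P T f)) =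
      if R = T.map σ.toEmbedding then U (sector P T f) else 0 := by
    refine sector_of_forall (fun j => ?_) R
    obtain ⟨k, rfl⟩ := σ.surjective j
    rw [← hU, hP.apply_sector]
    simp only [Finset.mem_map_equiv, Equiv.symm_apply_apply]
    split_ifs <;> simp
  conv_rhs => rw [← sum_sector (P := P) f, map_sum, map_sum]
  simp only [h1, Finset.map_inj]
  simp

end Sectors

/-! ### Sums over subsets that are invariant under permutations -/

section SymmetricSums

variable {N : ℕ}

theorem sum_filter_mem_eq_of_invariant {F : Finset (Fin N) → ℝ} (p q : Finset (Fin N) → Prop)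
    [DecidablePred p] [DecidablePred q] (σ : Equiv.Perm (Fin N))
    (hF : ∀ S, F (S.map σ.toEmbedding) = F S) (hpq : ∀ S, q (S.map σ.toEmbedding) ↔ p S) :
    ∑ S with p S, F S = ∑ S with q S, F S := by
  rw [Finset.sum_filter, Finset.sum_filter]
  refine Fintype.sum_equiv (Equiv.finsetCongr σ) _ _ fun S => ?_
  simp only [Equiv.finsetCongr_apply, hF, hpq]

theorem sum_card_mul (F : Finset (Fin N) → ℝ) :
    ∑ i, ∑ S with i ∈ S, F S = ∑ S, (S.card : ℝ) * F S := by
  simp only [Finset.sum_filter]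
  rw [Finset.sum_comm]
  refine Finset.sum_congr rfl fun S _ => ?_
  rw [← Finset.sum_filter, Finset.filter_mem_eq_inter, Finset.univ_inter, Finset.sum_const,
    nsmul_eq_mul]

theorem card_mul_sum_filter_mem {F : Finset (Fin N) → ℝ}
    (hF : ∀ (σ : Equiv.Perm (Fin N)) S, F (S.map σ.toEmbedding) = F S) (i : Fin N) :
    (N : ℝ) * ∑ S with i ∈ S, F S = ∑ S, (S.card : ℝ) * F S := by
  rw [← sum_card_mul]
  have : ∀ j, ∑ S with j ∈ S, F S = ∑ S with i ∈ S, F S := fun j => by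
    refine sum_filter_mem_eq_of_invariant _ _ (Equiv.swap j i) (hF _) fun S => ?_
    simp [Finset.mem_map_equiv]
  simp [this]

theorem card_mul_card_mul_sum_filter_mem_mem {F : Finset (Fin N) → ℝ}
    (hF : ∀ (σ : Equiv.Perm (Fin N)) S, F (S.map σ.toEmbedding) = F S) {i j : Fin N}
    (hij : i ≠ j) :
    (N : ℝ) * ((N - 1) * ∑ S with i ∈ S ∧ j ∈ S, F S) =
      ∑ S, (S.card : ℝ) * ((S.card - 1) * F S) := by
  rw [← card_mul_sum_filter_mem (fun σ S => by rw [Finset.card_map, hF]) i]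
  congr 1
  have h1 : ∀ k ∈ Finset.univ.erase i, ∑ S with i ∈ S ∧ k ∈ S, F S =
      ∑ S with i ∈ S ∧ j ∈ S, F S := fun k hk => by
    refine sum_filter_mem_eq_of_invariant _ _ (Equiv.swap k j) (hF _) fun S => ?_
    have hki : i ≠ k := (Finset.ne_of_mem_erase hk).symm
    simp [Finset.mem_map_equiv, Equiv.swap_apply_of_ne_of_ne hki hij]
  have h2 := sum_card_mul (fun S => if i ∈ S then F S else 0)
  have h3 : ∀ k, (∑ S with k ∈ S, if i ∈ S then F S else 0) = ∑ S with i ∈ S ∧ k ∈ S, F S := by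
    intro k
    rw [← Finset.sum_filter, Finset.filter_filter]
    simp only [and_comm]
  simp only [h3] at h2
  rw [← Finset.add_sum_erase _ _ (Finset.mem_univ i), Finset.sum_congr rfl h1] at h2
  simp only [and_self, Finset.sum_const, Finset.card_erase_of_mem (Finset.mem_univ i),
    Finset.card_univ, Fintype.card_fin, nsmul_eq_mul, mul_ite, mul_zero, ← Finset.sum_filter] at h2
  rw [Nat.cast_sub i.pos, Nat.cast_one] at h2
  simp only [sub_mul, one_mul, Finset.sum_sub_distrib] at h2 ⊢
  linarith

end SymmetricSums

/-! ### Transfer of one or two particles between sectors -/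

section Transfer

variable {N : ℕ}

theorem sum_filter_insert (i : Fin N) (F : Finset (Fin N) → ℝ) :
    ∑ S with i ∉ S, F (insert i S) = ∑ S with i ∈ S, F S := by
  refine Finset.sum_nbij' (insert i) (fun S => S.erase i) ?_ ?_ ?_ ?_ ?_ <;>
    simp +contextual [Finset.insert_erase]

theorem sum_filter_insert_insert {i j : Fin N} (hij : i ≠ j) (F : Finset (Fin N) → ℝ) :
    ∑ S with i ∉ S ∧ j ∉ S, F (insert i (insert j S)) = ∑ S with i ∈ S ∧ j ∈ S, F S := by
  refine Finset.sum_nbij' (fun S => insert i (insert j S)) (fun S => (S.erase i).erase j)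
    ?_ ?_ ?_ ?_ ?_
  · simp
  · simp
  · intro S hS
    simp only [Finset.mem_filter, Finset.mem_univ, true_and] at hS
    ext k
    simp only [Finset.mem_erase, Finset.mem_insert]
    by_cases h1 : k = i <;> by_cases h2 : k = j <;> simp_all
  · intro S hS
    simp only [Finset.mem_filter, Finset.mem_univ, true_and] at hS
    ext k
    simp only [Finset.mem_erase, Finset.mem_insert]
    by_cases h1 : k = i <;> by_cases h2 : k = j <;> simp_all
  · simp

/-- The weight `√(k/N)` of the sectors with `k` excited particles. -/
def weight (N k : ℕ) : ℝ := Real.sqrt ((k : ℝ) / N)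

theorem weight_nonneg (N k : ℕ) : 0 ≤ weight N k := Real.sqrt_nonneg _

theorem weight_pos (hN : 0 < N) {k : ℕ} (hk : 0 < k) : 0 < weight N k := by
  unfold weight
  positivity

theorem weight_sq (N k : ℕ) : weight N k ^ 2 = (k : ℝ) / N := Real.sq_sqrt (by positivity)

theorem div_le_weight {k : ℕ} (hk : k ≤ N) : (k : ℝ) / N ≤ weight N k := by
  refine Real.le_sqrt_of_sq_le ?_
  have h1 : (k : ℝ) / N ≤ 1 := div_le_one_of_le₀ (by exact_mod_cast hk) (by positivity)
  have h0 : (0 : ℝ) ≤ (k : ℝ) / N := by positivity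
  nlinarith

theorem weight_add_one_le (N k : ℕ) : weight N (k + 1) ≤ weight N k + 1 / Real.sqrt N := by
  have h : 1 / Real.sqrt N = Real.sqrt (1 / N) := by rw [Real.sqrt_div zero_le_one, Real.sqrt_one]
  rw [h, weight, weight]
  push_cast
  rw [add_div]
  rw [Real.sqrt_le_left (by positivity), add_sq, Real.sq_sqrt (by positivity),
    Real.sq_sqrt (by positivity)]
  have := mul_nonneg (mul_nonneg zero_le_two (Real.sqrt_nonneg ((k : ℝ) / N)))
    (Real.sqrt_nonneg (1 / (N : ℝ)))
  linarith

theorem weight_add_two_le (N k : ℕ) : weight N (k + 2) ≤ weight N k + 2 / Real.sqrt N := by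
  have h1 := weight_add_one_le N (k + 1)
  have h2 := weight_add_one_le N k
  have : 2 / Real.sqrt N = 1 / Real.sqrt N + 1 / Real.sqrt N := by ring
  rw [add_assoc] at h1
  rw [this]
  exact h1.trans (by linarith)

theorem card_eq_mul_weight_mul_weight (hN : 0 < N) (k : ℕ) :
    (k : ℝ) = N * (weight N k * weight N k) := by
  rw [← sq, weight_sq]
  field_simp

variable {H : Type*} [NormedAddCommGroup H] [InnerProductSpace ℂ H]

/-- The expectation of the weight `√(k/N)` in the sector decomposition of `Φ`. -/
def excitation (P : Fin N → H →L[ℂ] H) (Φ : H) : ℝ :=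
  ∑ S, weight N S.card * ‖sector P S Φ‖ ^ 2

/-- Sectors with equally many excited particles are equally populated. -/
def IsBalanced (P : Fin N → H →L[ℂ] H) (Φ : H) : Prop :=
  ∀ (σ : Equiv.Perm (Fin N)) S, ‖sector P (S.map σ.toEmbedding) Φ‖ = ‖sector P S Φ‖

variable {P : Fin N → H →L[ℂ] H} {Φ : H}

theorem excitation_nonneg : 0 ≤ excitation P Φ :=
  Finset.sum_nonneg fun S _ => mul_nonneg (weight_nonneg _ _) (by positivity)

theorem CommutingProjections.sum_norm_sector_sq (hP : CommutingProjections P) :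
    ∑ S, ‖sector P S Φ‖ ^ 2 = ‖Φ‖ ^ 2 := by
  rw [← hP.norm_sum_sector_sq, sum_sector]

/-- As `|S| = N w²` with `w = √(|S|/N)`, a weight `w⁻¹` summed over the sectors that contain a given
particle gives exactly the weight `w` summed over all sectors. -/
theorem sum_filter_mem_inv_weight (hN : 0 < N) (hb : IsBalanced P Φ) (i : Fin N) :
    ∑ S with i ∈ S, (weight N S.card)⁻¹ * ‖sector P S Φ‖ ^ 2 = excitation P Φ := by
  have h := card_mul_sum_filter_mem
    (F := fun S => (weight N S.card)⁻¹ * ‖sector P S Φ‖ ^ 2)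
    (fun σ S => by simp only [Finset.card_map, hb σ S]) i
  have hN' : (N : ℝ) ≠ 0 := by positivity
  refine mul_left_cancel₀ hN' (h.trans ?_)
  rw [excitation, Finset.mul_sum]
  refine Finset.sum_congr rfl fun S _ => ?_
  conv_lhs => rw [card_eq_mul_weight_mul_weight hN S.card]
  -- the empty sector has weight zero, and `0⁻¹ = 0` makes both sides vanish
  rcases eq_or_ne (weight N S.card) 0 with h0 | h0
  · simp [h0]
  · field_simp

theorem CommutingProjections.norm_sub_apply_sq_le (hP : CommutingProjections P) (hN : 0 < N)
    (hb : IsBalanced P Φ) (i : Fin N) : ‖Φ - P i Φ‖ ^ 2 ≤ excitation P Φ := by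
  rw [hP.sub_apply_eq_sum, hP.norm_sum_sector_sq]
  have h := card_mul_sum_filter_mem (F := fun S => ‖sector P S Φ‖ ^ 2)
    (fun σ S => by simp only [hb σ S]) i
  have hN' : (0 : ℝ) < N := by positivity
  refine le_of_mul_le_mul_left (h.trans_le ?_) hN'
  rw [excitation, Finset.mul_sum]
  refine Finset.sum_le_sum fun S _ => ?_
  have h1 := div_le_weight (N := N) ((Finset.card_le_univ S).trans_eq (Fintype.card_fin N))
  rw [div_le_iff₀ hN'] at h1
  nlinarith [sq_nonneg ‖sector P S Φ‖]

theorem sum_filter_mem_mem_inv_weight_sq_le (hN : 0 < N) (hb : IsBalanced P Φ) {i j : Fin N}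
    (hij : i ≠ j) :
    ∑ S with i ∈ S ∧ j ∈ S, (weight N S.card ^ 2)⁻¹ * ‖sector P S Φ‖ ^ 2 ≤ excitation P Φ := by
  have h := card_mul_card_mul_sum_filter_mem_mem
    (F := fun S => (weight N S.card ^ 2)⁻¹ * ‖sector P S Φ‖ ^ 2)
    (fun σ S => by simp only [Finset.card_map, hb σ S]) hij
  have hN2 : 2 ≤ N := by
    have := i.2; have := j.2
    have : (i : ℕ) ≠ j := fun h => hij (Fin.ext h)
    omega
  have hN1 : (0 : ℝ) < N - 1 := by
    have : (2 : ℝ) ≤ N := by exact_mod_cast hN2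
    linarith
  have hN0 : (0 : ℝ) < N := by positivity
  refine le_of_mul_le_mul_left (le_of_mul_le_mul_left (h.trans_le ?_) hN0) hN1
  rw [excitation, Finset.mul_sum, Finset.mul_sum]
  refine Finset.sum_le_sum fun S _ => ?_
  have hcard : S.card ≤ N := (Finset.card_le_univ S).trans_eq (Fintype.card_fin N)
  have h1 := div_le_weight (N := N) hcard
  rcases Nat.eq_zero_or_pos S.card with h0 | h0
  · simp [h0, weight]
  · have hk : (0 : ℝ) < S.card := by exact_mod_cast h0
    rw [weight_sq, inv_div]
    have e : (S.card : ℝ) * ((S.card - 1) * ((N : ℝ) / S.card * ‖sector P S Φ‖ ^ 2)) =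
        N * ((S.card - 1) * ‖sector P S Φ‖ ^ 2) := by
      field_simp
    rw [e, ← mul_assoc (N - 1 : ℝ)]
    refine mul_le_mul_of_nonneg_left ?_ hN0.le
    refine mul_le_mul_of_nonneg_right ?_ (by positivity)
    rw [div_le_iff₀ hN0] at h1
    have hcard' : (S.card : ℝ) ≤ N := by exact_mod_cast hcard
    have h2 : (S.card - 1 : ℝ) ≤ (N - 1) * ((S.card : ℝ) / N) := by
      rw [mul_div_assoc', le_div_iff₀ hN0]
      linarith
    refine h2.trans (mul_le_mul_of_nonneg_left (div_le_weight hcard) hN1.le)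

/-- Raising the number of excited particles by `m` in the weight costs only an additive constant. -/
theorem CommutingProjections.sum_filter_weight_le (hP : CommutingProjections P) (hΦ : ‖Φ‖ = 1)
    (p : Finset (Fin N) → Prop) [DecidablePred p] (m : ℕ) {c : ℝ}
    (hm : ∀ k, weight N (k + m) ≤ weight N k + c) :
    ∑ S with p S, weight N (S.card + m) * ‖sector P S Φ‖ ^ 2 ≤ excitation P Φ + c := by
  calc ∑ S with p S, weight N (S.card + m) * ‖sector P S Φ‖ ^ 2
      ≤ ∑ S, weight N (S.card + m) * ‖sector P S Φ‖ ^ 2 :=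
        Finset.sum_le_sum_of_subset_of_nonneg (Finset.filter_subset _ _)
          fun S _ _ => mul_nonneg (weight_nonneg _ _) (by positivity)
    _ ≤ ∑ S, (weight N S.card * ‖sector P S Φ‖ ^ 2 + c * ‖sector P S Φ‖ ^ 2) := by
        refine Finset.sum_le_sum fun S _ => ?_
        rw [← add_mul]
        exact mul_le_mul_of_nonneg_right (hm _) (by positivity)
    _ = excitation P Φ + c := by
        rw [Finset.sum_add_distrib, ← Finset.mul_sum, hP.sum_norm_sector_sq, hΦ, excitation]
        ring

/-- The weighted arithmetic-geometric mean inequality, with a weight that makes the transfer of a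
particle cost `β` instead of `√β`. -/
theorem CommutingProjections.sum_norm_mul_norm_insert_le (hP : CommutingProjections P)
    (hb : IsBalanced P Φ) (hΦ : ‖Φ‖ = 1) (i : Fin N) :
    ∑ S with i ∉ S, ‖sector P S Φ‖ * ‖sector P (insert i S) Φ‖ ≤
      excitation P Φ + 1 / Real.sqrt N := by
  have hN := i.pos
  have h1 := hP.sum_filter_weight_le hΦ (fun S => i ∉ S) 1 (weight_add_one_le N)
  have h2 := sum_filter_mem_inv_weight hN hb i
  rw [← sum_filter_insert] at h2
  have h3 : ∑ S with i ∉ S, ‖sector P S Φ‖ * ‖sector P (insert i S) Φ‖ ≤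
      ∑ S with i ∉ S, (1 / 2 * (weight N (S.card + 1) * ‖sector P S Φ‖ ^ 2) + 1 / 2 *
        ((weight N (insert i S).card)⁻¹ * ‖sector P (insert i S) Φ‖ ^ 2)) := by
    refine Finset.sum_le_sum fun S hS => ?_
    rw [Finset.card_insert_of_notMem (Finset.mem_filter.1 hS).2]
    have hw := weight_pos hN (Nat.succ_pos S.card)
    set w := weight N (S.card + 1)
    -- `2 a b ≤ w a² + w⁻¹ b²` with the weight `w` of the larger sector
    have h4 := two_mul_le_add_sq (w * ‖sector P S Φ‖) ‖sector P (insert i S) Φ‖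
    have h5 := mul_le_mul_of_nonneg_left h4 (inv_nonneg.2 hw.le)
    have e1 : w⁻¹ * (2 * (w * ‖sector P S Φ‖) * ‖sector P (insert i S) Φ‖) =
        2 * (‖sector P S Φ‖ * ‖sector P (insert i S) Φ‖) := by field_simp
    have e2 : w⁻¹ * ((w * ‖sector P S Φ‖) ^ 2 + ‖sector P (insert i S) Φ‖ ^ 2) =
        w * ‖sector P S Φ‖ ^ 2 + w⁻¹ * ‖sector P (insert i S) Φ‖ ^ 2 := by field_simp
    linarith
  rw [Finset.sum_add_distrib, ← Finset.mul_sum, ← Finset.mul_sum, h2] at h3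
  have : 0 ≤ 1 / Real.sqrt N := by positivity
  linarith

/-- An operator acting on the `i`-th particle only moves that particle out of the condensate, at
the cost of the expected number of excitations. -/
theorem CommutingProjections.norm_inner_transfer_le (hP : CommutingProjections P)
    (hb : IsBalanced P Φ) (hΦ : ‖Φ‖ = 1) (i : Fin N) (A : H →L[ℂ] H) {c : ℝ} (hc : 0 ≤ c)
    (hA : ∀ f, ‖A f‖ ≤ c * ‖f‖) (hcomm : ∀ k, k ≠ i → ∀ f, P k (A f) = A (P k f)) :
    ‖inner ℂ (A (P i Φ)) (Φ - P i Φ)‖ ≤ c * (excitation P Φ + 1 / Real.sqrt N) := by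
  have h1 : inner ℂ (A (P i Φ)) (Φ - P i Φ) =
      ∑ S with i ∉ S, inner ℂ (A (sector P S Φ)) (sector P (insert i S) Φ) := by
    rw [hP.sub_apply_eq_sum, hP.apply_eq_sum, map_sum, sum_inner]
    refine Finset.sum_congr rfl fun S hS => ?_
    have hiS := (Finset.mem_filter.1 hS).2
    rw [inner_sum, Finset.sum_eq_single (insert i S)]
    -- sectors that disagree about a particle `k ≠ i` remain orthogonal after applying `A`
    · intro T hT hne
      have hiT := (Finset.mem_filter.1 hT).2
      obtain ⟨k, hk⟩ : ∃ k, ¬(k ∈ S ↔ k ∈ T) ∧ k ≠ i := by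
        by_contra hcon
        refine hne (Finset.ext fun k => ?_)
        by_cases hki : k = i
        · simp [hki, hiT]
        · simp only [Finset.mem_insert, hki, false_or]
          by_contra h
          exact hcon ⟨k, fun h' => h h'.symm, hki⟩
      refine hP.inner_eq_zero_of_mem_xor (i := k) (S := S) (T := T) ?_ (hP.apply_sector T k Φ) hk.1
      rw [hcomm k hk.2, hP.apply_sector]
      split_ifs <;> simp
    · simp
  rw [h1]
  calc ‖∑ S with i ∉ S, inner ℂ (A (sector P S Φ)) (sector P (insert i S) Φ)‖
      ≤ ∑ S with i ∉ S, c * (‖sector P S Φ‖ * ‖sector P (insert i S) Φ‖) := by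
        refine norm_sum_le_of_le _ fun S _ => (norm_inner_le_norm _ _).trans ?_
        rw [← mul_assoc]
        exact mul_le_mul_of_nonneg_right (hA _) (norm_nonneg _)
    _ ≤ _ := by
        rw [← Finset.mul_sum]
        exact mul_le_mul_of_nonneg_left (hP.sum_norm_mul_norm_insert_le hb hΦ i) hc

/-- A pair interaction, written as `R²`, moves two particles out of the condensate. In the pair
sectors it is only bounded by the derivatives `G S` of the components, whose total square is
at most `X`. -/
theorem CommutingProjections.norm_inner_pair_transfer_le (hP : CommutingProjections P)
    (hb : IsBalanced P Φ) (hΦ : ‖Φ‖ = 1) {i j : Fin N} (hij : i ≠ j) (R : H →L[ℂ] H) {c X : ℝ}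
    (hc : 0 ≤ c) (G : Finset (Fin N) → ℝ)
    (hR : ∀ f, P i f = f → ‖R f‖ ^ 2 ≤ c * ‖f‖ ^ 2)
    (hG : ∀ S, i ∈ S → ‖R (sector P S Φ)‖ ^ 2 ≤ 2 * G S * ‖sector P S Φ‖)
    (hX : ∑ S with i ∈ S, G S ^ 2 ≤ X)
    (hcomm : ∀ k, k ≠ i → k ≠ j → ∀ f, P k (R f) = R (P k f)) :
    ‖inner ℂ (R (P i (P j Φ))) (R (Φ - P j Φ - P i (Φ - P j Φ)))‖ ≤
      c / 2 * (excitation P Φ + 2 / Real.sqrt N) + X / 8 + 2 * excitation P Φ := by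
  have hN := i.pos
  have hpp : P i (P j Φ) = ∑ S with i ∉ S ∧ j ∉ S, sector P S Φ := by
    rw [hP.apply_eq_sum j, map_sum, ← Finset.filter_filter,
      Finset.sum_filter (s := Finset.univ.filter fun S => i ∉ S)]
    rw [Finset.sum_filter, Finset.sum_filter]
    refine Finset.sum_congr rfl fun S _ => ?_
    rw [hP.apply_sector]
    by_cases h1 : i ∈ S <;> by_cases h2 : j ∈ S <;> simp [h1, h2]
  have hqq : Φ - P j Φ - P i (Φ - P j Φ) = ∑ S with i ∈ S ∧ j ∈ S, sector P S Φ := by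
    rw [hP.sub_apply_eq_sum j, map_sum, ← Finset.sum_sub_distrib, Finset.sum_filter,
      Finset.sum_filter]
    refine Finset.sum_congr rfl fun S _ => ?_
    rw [hP.apply_sector]
    by_cases h1 : i ∈ S <;> by_cases h2 : j ∈ S <;> simp [h1, h2]
  have h1 : inner ℂ (R (P i (P j Φ))) (R (Φ - P j Φ - P i (Φ - P j Φ))) =
      ∑ S with i ∉ S ∧ j ∉ S,
        inner ℂ (R (sector P S Φ)) (R (sector P (insert i (insert j S)) Φ)) := by
    rw [hpp, hqq, map_sum, map_sum, sum_inner]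
    refine Finset.sum_congr rfl fun S hS => ?_
    have hS := (Finset.mem_filter.1 hS).2
    rw [inner_sum, Finset.sum_eq_single (insert i (insert j S))]
    · intro T hT hne
      have hT := (Finset.mem_filter.1 hT).2
      obtain ⟨k, hk⟩ : ∃ k, ¬(k ∈ S ↔ k ∈ T) ∧ k ≠ i ∧ k ≠ j := by
        by_contra hcon
        refine hne (Finset.ext fun k => ?_)
        by_cases hki : k = i
        · simp [hki, hT]
        · by_cases hkj : k = j
          · simp [hkj, hT]
          · simp only [Finset.mem_insert, hki, hkj, false_or]
            by_contra h
            exact hcon ⟨k, fun h' => h h'.symm, hki, hkj⟩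
      refine hP.inner_eq_zero_of_mem_xor (i := k) (S := S) (T := T) ?_ ?_ hk.1
      · rw [hcomm k hk.2.1 hk.2.2, hP.apply_sector]
        split_ifs <;> simp
      · rw [hcomm k hk.2.1 hk.2.2, hP.apply_sector]
        split_ifs <;> simp
    · simp
  have h2 := hP.sum_filter_weight_le hΦ (fun S => i ∉ S ∧ j ∉ S) 2 (weight_add_two_le N)
  have h3 := sum_filter_mem_mem_inv_weight_sq_le hN hb hij
  rw [← sum_filter_insert_insert hij] at h3
  have h4 : ∑ S with i ∉ S ∧ j ∉ S, G (insert i (insert j S)) ^ 2 ≤ X := by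
    rw [sum_filter_insert_insert hij (fun S => G S ^ 2)]
    refine le_trans (Finset.sum_le_sum_of_subset_of_nonneg ?_ fun _ _ _ => sq_nonneg _) hX
    exact fun S hS => by simp_all
  have h5 : ‖inner ℂ (R (P i (P j Φ))) (R (Φ - P j Φ - P i (Φ - P j Φ)))‖ ≤
      ∑ S with i ∉ S ∧ j ∉ S, (c / 2 * (weight N (S.card + 2) * ‖sector P S Φ‖ ^ 2) +
        1 / 8 * G (insert i (insert j S)) ^ 2 + 2 * ((weight N (insert i (insert j S)).card ^ 2)⁻¹ *
          ‖sector P (insert i (insert j S)) Φ‖ ^ 2)) := by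
    rw [h1]
    refine norm_sum_le_of_le _ fun S hS => (norm_inner_le_norm _ _).trans ?_
    have hS := (Finset.mem_filter.1 hS).2
    have hcard : (insert i (insert j S)).card = S.card + 2 := by
      rw [Finset.card_insert_of_notMem (by simp [hij, hS]), Finset.card_insert_of_notMem hS.2]
    rw [hcard]
    have hx := hR (sector P S Φ) (by rw [hP.apply_sector, if_neg hS.1])
    have hy := hG (insert i (insert j S)) (by simp)
    have hw := weight_pos hN (Nat.succ_pos (S.card + 1))
    set w := weight N (S.card + 2)
    set x := ‖R (sector P S Φ)‖
    set y := ‖R (sector P (insert i (insert j S)) Φ)‖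
    set a := ‖sector P S Φ‖
    set b := ‖sector P (insert i (insert j S)) Φ‖
    set g := G (insert i (insert j S))
    have e0 : x * y ≤ 1 / 2 * (w * x ^ 2) + 1 / 2 * (w⁻¹ * y ^ 2) := by
      have h4 := mul_le_mul_of_nonneg_left (two_mul_le_add_sq (w * x) y) (inv_nonneg.2 hw.le)
      have e1 : w⁻¹ * (2 * (w * x) * y) = 2 * (x * y) := by field_simp
      have e2 : w⁻¹ * ((w * x) ^ 2 + y ^ 2) = w * x ^ 2 + w⁻¹ * y ^ 2 := by field_simp
      linarith
    have e1 : w * x ^ 2 ≤ w * (c * a ^ 2) := mul_le_mul_of_nonneg_left hx hw.le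
    have e2 : w⁻¹ * y ^ 2 ≤ w⁻¹ * (2 * g * b) := mul_le_mul_of_nonneg_left hy (inv_nonneg.2 hw.le)
    -- `w⁻¹ g b ≤ g² / 8 + 2 (w⁻¹ b)²`, where the square of `w⁻¹` is harmless in pair sectors
    have e3 : 0 ≤ (g - 4 * (w⁻¹ * b)) ^ 2 := sq_nonneg _
    have e4 : (w ^ 2)⁻¹ * b ^ 2 = (w⁻¹ * b) ^ 2 := by rw [mul_pow, inv_pow]
    rw [e4]
    nlinarith
  rw [Finset.sum_add_distrib, Finset.sum_add_distrib, ← Finset.mul_sum, ← Finset.mul_sum,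
    ← Finset.mul_sum] at h5
  have h6 := mul_le_mul_of_nonneg_left h2 (by positivity : 0 ≤ c / 2)
  linarith

end Transfer

/-! ### Multiplication operators -/

section SquareIntegrable

variable {α : Type*} [MeasureSpace α]

theorem integrable_norm_sq (f : L2 α) : Integrable fun x => ‖f x‖ ^ 2 :=
  (memLp_two_iff_integrable_sq_norm (Lp.memLp f).1).1 (Lp.memLp f)

theorem integral_norm_sq (f : L2 α) : ∫ x, ‖f x‖ ^ 2 = ‖f‖ ^ 2 := by
  have h := L2.inner_def (𝕜 := ℂ) f f
  rw [inner_self_eq_norm_sq_to_K] at h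
  refine Complex.ofReal_injective ?_
  rw [← integral_complex_ofReal]
  refine Eq.trans (integral_congr_ae (Eventually.of_forall fun x => ?_)) (h.symm.trans (by simp))
  simp only [RCLike.inner_apply]
  rw [Complex.mul_conj, Complex.normSq_eq_norm_sq]

end SquareIntegrable

section Multiplication

variable {α : Type*} [TopologicalSpace α] [MeasureSpace α] [OpensMeasurableSpace α]

theorem memLp_mul (m : α →ᵇ ℝ) {f : α → ℂ} (hf : MemLp f 2 volume) :
    MemLp (fun x => (m x : ℂ) * f x) 2 volume := by
  have h : AEStronglyMeasurable (fun x => (m x : ℂ)) (volume : Measure α) :=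
    (Complex.measurable_ofReal.comp m.continuous.measurable).aestronglyMeasurable
  refine MemLp.of_le_mul (c := ‖m‖) hf (h.mul hf.1) (Eventually.of_forall fun x => ?_)
  rw [norm_mul, Complex.norm_real]
  exact mul_le_mul_of_nonneg_right (m.norm_coe_le_norm x) (norm_nonneg _)

/-- Multiplication by a bounded continuous real function, on classes of functions. -/
def mulFun (m : α →ᵇ ℝ) (f : L2 α) : L2 α := (memLp_mul m (Lp.memLp f)).toLp _

theorem coeFn_mulFun (m : α →ᵇ ℝ) (f : L2 α) : mulFun m f =ᵐ[volume] fun x => (m x : ℂ) * f x :=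
  MemLp.coeFn_toLp _

/-- Multiplication by a bounded continuous real function, as a bounded operator on `L²`. -/
def mulOp (m : α →ᵇ ℝ) : L2 α →L[ℂ] L2 α :=
  LinearMap.mkContinuous
    { toFun := mulFun m
      map_add' := fun f g => by
        refine Lp.ext ?_
        filter_upwards [coeFn_mulFun m (f + g), coeFn_mulFun m f, coeFn_mulFun m g,
          Lp.coeFn_add f g, Lp.coeFn_add (mulFun m f) (mulFun m g)] with x h1 h2 h3 h4 h5
        rw [h1, h5, Pi.add_apply, h2, h3, h4, Pi.add_apply, mul_add]
      map_smul' := fun c f => by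
        refine Lp.ext ?_
        filter_upwards [coeFn_mulFun m (c • f), coeFn_mulFun m f,
          Lp.coeFn_smul c f, Lp.coeFn_smul c (mulFun m f)] with x h1 h2 h3 h4
        rw [h1, RingHom.id_apply, h4, Pi.smul_apply, h2, h3, Pi.smul_apply, smul_eq_mul,
          smul_eq_mul, mul_left_comm] }
    ‖m‖ (fun f => by
      refine Lp.norm_le_mul_norm_of_ae_le_mul ?_
      filter_upwards [coeFn_mulFun m f] with x h1
      change ‖mulFun m f x‖ ≤ _
      rw [h1, norm_mul, Complex.norm_real]
      exact mul_le_mul_of_nonneg_right (m.norm_coe_le_norm x) (norm_nonneg _))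

theorem coeFn_mulOp (m : α →ᵇ ℝ) (f : L2 α) : mulOp m f =ᵐ[volume] fun x => (m x : ℂ) * f x :=
  coeFn_mulFun m f

theorem mulOp_toLp (m : α →ᵇ ℝ) {f : α → ℂ} (hf : MemLp f 2 volume) :
    mulOp m (hf.toLp f) = (memLp_mul m hf).toLp _ := by
  refine Lp.ext ?_
  filter_upwards [coeFn_mulOp m (hf.toLp f), (memLp_mul m hf).coeFn_toLp, hf.coeFn_toLp]
    with x h1 h2 h3
  rw [h1, h2, h3]

theorem norm_mulOp_apply_le_of_le {m : α →ᵇ ℝ} {c : ℝ} (hm : ∀ x, |m x| ≤ c) (f : L2 α) :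
    ‖mulOp m f‖ ≤ c * ‖f‖ := by
  refine Lp.norm_le_mul_norm_of_ae_le_mul ?_
  filter_upwards [coeFn_mulOp m f] with x h1
  rw [h1, norm_mul, Complex.norm_real]
  exact mul_le_mul_of_nonneg_right (hm x) (norm_nonneg _)

theorem mulOp_mulOp {m m' M : α →ᵇ ℝ} (h : ∀ x, M x = m x * m' x) (f : L2 α) :
    mulOp m (mulOp m' f) = mulOp M f := by
  obtain ⟨f, hf, rfl⟩ := L2.exists_toLp f
  rw [mulOp_toLp, mulOp_toLp, mulOp_toLp, MemLp.toLp_eq_toLp_iff]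
  refine Eventually.of_forall fun x => ?_
  simp only [h x]
  push_cast
  ring

theorem inner_mulOp_right (m : α →ᵇ ℝ) (f g : L2 α) :
    inner ℂ f (mulOp m g) = inner ℂ (mulOp m f) g := by
  rw [L2.inner_def, L2.inner_def]
  refine integral_congr_ae ?_
  filter_upwards [coeFn_mulOp m f, coeFn_mulOp m g] with x h1 h2
  simp [h1, h2]
  ring

theorem inner_mulOp_self (m : α →ᵇ ℝ) (f : L2 α) :
    inner ℂ f (mulOp m f) = ((∫ x, m x * ‖f x‖ ^ 2 : ℝ) : ℂ) := by
  rw [L2.inner_def, ← integral_complex_ofReal]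
  refine integral_congr_ae ?_
  filter_upwards [coeFn_mulOp m f] with x h1
  simp only [h1, RCLike.inner_apply]
  rw [mul_assoc, Complex.mul_conj, Complex.normSq_eq_norm_sq]
  push_cast
  ring

theorem integrable_mul_norm_sq (m : α →ᵇ ℝ) (f : L2 α) :
    Integrable fun x => m x * ‖f x‖ ^ 2 :=
  (integrable_norm_sq f).bdd_mul m.continuous.measurable.aestronglyMeasurable
    (Eventually.of_forall m.norm_coe_le_norm)

/-- The square root of a bounded nonnegative continuous function. -/
def sqrtMul (m : α →ᵇ ℝ) : α →ᵇ ℝ :=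
  BoundedContinuousFunction.ofNormedAddCommGroup (fun x => Real.sqrt (m x))
    (Real.continuous_sqrt.comp m.continuous) (Real.sqrt ‖m‖) fun x => by
      rw [Real.norm_of_nonneg (Real.sqrt_nonneg _)]
      exact Real.sqrt_le_sqrt ((le_abs_self _).trans (m.norm_coe_le_norm x))

theorem inner_mulOp_sqrtMul {m : α →ᵇ ℝ} (hm : ∀ x, 0 ≤ m x) (f g : L2 α) :
    inner ℂ (mulOp (sqrtMul m) f) (mulOp (sqrtMul m) g) = inner ℂ f (mulOp m g) := by
  rw [← inner_mulOp_right, mulOp_mulOp (M := m) fun x => by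
    simp [sqrtMul, Real.mul_self_sqrt (hm x)]]

theorem norm_mulOp_sqrtMul_sq {m : α →ᵇ ℝ} (hm : ∀ x, 0 ≤ m x) (f : L2 α) :
    ‖mulOp (sqrtMul m) f‖ ^ 2 = ∫ x, m x * ‖f x‖ ^ 2 := by
  have h := inner_mulOp_sqrtMul hm f f
  rw [inner_mulOp_self, inner_self_eq_norm_sq_to_K] at h
  exact Complex.ofReal_injective (Eq.trans (by simp) h)

end Multiplication

/-! ### Short-range potentials are controlled by one derivative -/

section Potential

/-- A nonnegative potential of integral one. -/
structure IsUnitPotential (v : ℝ →ᵇ ℝ) : Prop where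
  nonneg : ∀ x, 0 ≤ v x
  integrable : Integrable v
  integral_eq_one : ∫ x, v x = 1

theorem IsUnitPotential.abs_intervalIntegral_le {v : ℝ →ᵇ ℝ} (hv : IsUnitPotential v) (z : ℝ) :
    |∫ x in (0 : ℝ)..z, v x| ≤ 1 := by
  rw [← Real.norm_eq_abs]
  refine (intervalIntegral.norm_integral_le_integral_norm_uIoc).trans ?_
  rw [← hv.integral_eq_one]
  have h : ∀ x, ‖v x‖ = v x := fun x => Real.norm_of_nonneg (hv.nonneg x)
  simp only [h]
  exact setIntegral_le_integral hv.integrable (Eventually.of_forall hv.nonneg)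

/-- The primitive of `v` that vanishes at the origin. -/
def IsUnitPotential.primitive {v : ℝ →ᵇ ℝ} (hv : IsUnitPotential v) : ℝ →ᵇ ℝ :=
  BoundedContinuousFunction.ofNormedAddCommGroup (fun z => ∫ x in (0 : ℝ)..z, v x)
    (intervalIntegral.continuous_primitive
      (fun a b => v.continuous.intervalIntegrable a b) 0) 1
    hv.abs_intervalIntegral_le

theorem IsUnitPotential.hasDerivAt_primitive {v : ℝ →ᵇ ℝ} (hv : IsUnitPotential v) (z : ℝ) :
    HasDerivAt hv.primitive (v z) z :=
  intervalIntegral.integral_hasDerivAt_right (v.continuous.intervalIntegrable 0 z)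
    (v.continuous.stronglyMeasurableAtFilter _ _) v.continuous.continuousAt

theorem IsUnitPotential.hasDerivAt_integral_primitive {v : ℝ →ᵇ ℝ} (hv : IsUnitPotential v)
    {E : Type*} [TopologicalSpace E]
    [MeasureSpace E] [OpensMeasurableSpace E] (l : C(E, ℝ)) (f : L2 E) :
    HasDerivAt (fun s => ∫ x, hv.primitive (l x - s) * ‖f x‖ ^ 2) (-∫ x, v (l x) * ‖f x‖ ^ 2)
      0 := by
  have hm : ∀ (w : ℝ →ᵇ ℝ) (s : ℝ),
      Integrable fun x => w (l x - s) * ‖f x‖ ^ 2 := fun w s =>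
    integrable_mul_norm_sq (w.compContinuous ⟨fun x => l x - s, by fun_prop⟩) f
  have h := hasDerivAt_integral_of_dominated_loc_of_deriv_le
    (F := fun s x => hv.primitive (l x - s) * ‖f x‖ ^ 2)
    (F' := fun s x => -v (l x - s) * ‖f x‖ ^ 2) (x₀ := (0 : ℝ)) (s := Set.univ)
    (bound := fun x => ‖v‖ * ‖f x‖ ^ 2) (μ := volume) Filter.univ_mem
    (Eventually.of_forall fun s => (hm hv.primitive s).1) (hm hv.primitive 0)
    (by simp only [neg_mul]; exact (hm v 0).1.neg) ?_ ((integrable_norm_sq f).const_mul _) ?_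
  · simpa [integral_neg] using h.2
  · refine Eventually.of_forall fun x s _ => ?_
    rw [norm_mul, norm_neg, Real.norm_of_nonneg (sq_nonneg ‖f x‖)]
    exact mul_le_mul_of_nonneg_right (v.norm_coe_le_norm _) (sq_nonneg _)
  · refine Eventually.of_forall fun x s _ => ?_
    have h1 : HasDerivAt (fun s => l x - s) (-1) s := by
      simpa using (hasDerivAt_id s).const_sub (l x)
    have h2 := ((hv.hasDerivAt_primitive (l x - s)).comp s h1).mul_const (‖f x‖ ^ 2)
    simpa using h2

variable {E : Type*} [NormedAddCommGroup E] [NormedSpace ℝ E] [MeasureSpace E]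
  [BorelSpace E] [(volume : Measure E).IsAddRightInvariant]

/-- The potential energy of `v` in the direction `e` is controlled by one derivative, uniformly
in the range of `v`: with a bounded primitive `W` of `v`, integrate by parts to get
`⟨f, v f⟩ = -2 Re ⟨∂ f, W f⟩`. -/
theorem IsUnitPotential.integral_mul_norm_sq_le {v : ℝ →ᵇ ℝ} (hv : IsUnitPotential v)
    {e : E} (l : C(E, ℝ)) (hl : ∀ x (s : ℝ), l (x + s • e) = l x + s) {f f' : L2 E}
    (hf : HasDirDeriv e f f') : ∫ x, v (l x) * ‖f x‖ ^ 2 ≤ 2 * ‖f'‖ * ‖f‖ := by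
  set W : E →ᵇ ℝ := hv.primitive.compContinuous l
  have h1 := hv.hasDerivAt_integral_primitive l f
  have hMd : HasDerivAt (fun s => mulOp W (shift e s f)) (mulOp W f') 0 :=
    ((mulOp W).restrictScalars ℝ).hasFDerivAt.comp_hasDerivAt (0 : ℝ) hf
  have h2 := HasDerivAt.inner ℂ hf hMd
  simp only [shift_zero] at h2
  have h3 : ∀ s, inner ℂ (shift e s f) (mulOp W (shift e s f)) =
      ((∫ x, hv.primitive (l x - s) * ‖f x‖ ^ 2 : ℝ) : ℂ) := by
    intro s
    rw [inner_mulOp_self]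
    congr 1
    rw [← integral_add_right_eq_self (fun x => hv.primitive (l x - s) * ‖f x‖ ^ 2) (s • e)]
    refine integral_congr_ae ?_
    filter_upwards [coeFn_shift e s f] with x hx
    rw [hx, hl]
    simp [W]
  simp only [h3] at h2
  have h4 := h1.ofReal_comp.unique h2
  have h5 : ∫ x, v (l x) * ‖f x‖ ^ 2 = -(inner ℂ f (mulOp W f') + inner ℂ f' (mulOp W f)).re := by
    rw [← h4, Complex.ofReal_re, neg_neg]
  have hW : ∀ g : L2 E, ‖mulOp W g‖ ≤ 1 * ‖g‖ := norm_mulOp_apply_le_of_le fun x =>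
    hv.abs_intervalIntegral_le (l x)
  rw [h5]
  refine (neg_le_abs _).trans ((Complex.abs_re_le_norm _).trans ((norm_add_le _ _).trans ?_))
  have h6 := (norm_inner_le_norm (𝕜 := ℂ) f (mulOp W f')).trans
    (mul_le_mul_of_nonneg_left (hW f') (norm_nonneg f))
  have h7 := (norm_inner_le_norm (𝕜 := ℂ) f' (mulOp W f)).trans
    (mul_le_mul_of_nonneg_left (hW f) (norm_nonneg f'))
  linarith

end Potential

/-! ### The pair potential on the many-body space -/

section PairPotential

/-- The potential `z ↦ ∫ v (y - z) |φ y|² dy` generated by the density of `φ`. -/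
def meanField (v : ℝ →ᵇ ℝ) (φ : L2 ℝ) : ℝ →ᵇ ℝ :=
  BoundedContinuousFunction.ofNormedAddCommGroup (fun z => ∫ y, v (y - z) * ‖φ y‖ ^ 2)
    (continuous_of_dominated (bound := fun y => ‖v‖ * ‖φ y‖ ^ 2)
      (fun z => (integrable_mul_norm_sq
        (v.compContinuous ⟨fun y => y - z, by fun_prop⟩) φ).1)
      (fun z => Eventually.of_forall fun y => by
        rw [norm_mul, Real.norm_of_nonneg (sq_nonneg ‖φ y‖)]
        exact mul_le_mul_of_nonneg_right (v.norm_coe_le_norm _) (sq_nonneg _))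
      ((integrable_norm_sq φ).const_mul _)
      (Eventually.of_forall fun y => by fun_prop))
    (‖v‖ * ‖φ‖ ^ 2) (fun z => by
      refine (norm_integral_le_of_norm_le (g := fun y => ‖v‖ * ‖φ y‖ ^ 2)
        ((integrable_norm_sq φ).const_mul _) (Eventually.of_forall fun y => ?_)).trans_eq ?_
      · rw [norm_mul, Real.norm_of_nonneg (sq_nonneg ‖φ y‖)]
        exact mul_le_mul_of_nonneg_right (v.norm_coe_le_norm _) (sq_nonneg _)
      · rw [integral_const_mul, integral_norm_sq])

theorem IsUnitPotential.meanField_nonneg {v : ℝ →ᵇ ℝ} (hv : IsUnitPotential v) (φ : L2 ℝ) (z : ℝ) :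
    0 ≤ meanField v φ z :=
  integral_nonneg fun _ => mul_nonneg (hv.nonneg _) (sq_nonneg _)

theorem IsUnitPotential.meanField_le {v : ℝ →ᵇ ℝ} (hv : IsUnitPotential v) {φ φ' : L2 ℝ}
    (hφ : HasDirDeriv (1 : ℝ) φ φ') (z : ℝ) : meanField v φ z ≤ 2 * ‖φ'‖ * ‖φ‖ :=
  hv.integral_mul_norm_sq_le ⟨fun y => y - z, by fun_prop⟩
    (fun y s => by simp; ring) hφ

/-- The self-interaction `∬ |φ x|² v (x - y) |φ y|² dx dy` of the density of `φ`. -/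
def selfEnergy (v : ℝ →ᵇ ℝ) (φ : L2 ℝ) : ℝ := ∫ z, meanField v φ z * ‖φ z‖ ^ 2

theorem IsUnitPotential.selfEnergy_nonneg {v : ℝ →ᵇ ℝ} (hv : IsUnitPotential v) (φ : L2 ℝ) :
    0 ≤ selfEnergy v φ :=
  integral_nonneg fun _ => mul_nonneg (hv.meanField_nonneg φ _) (sq_nonneg _)

theorem IsUnitPotential.selfEnergy_le {v : ℝ →ᵇ ℝ} (hv : IsUnitPotential v) {φ φ' : L2 ℝ}
    (hφ : HasDirDeriv (1 : ℝ) φ φ') (h1 : ‖φ‖ = 1) : selfEnergy v φ ≤ 2 * ‖φ'‖ := by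
  have h2 : selfEnergy v φ ≤ ∫ z, 2 * ‖φ'‖ * ‖φ z‖ ^ 2 := by
    refine integral_mono (integrable_mul_norm_sq _ φ) ((integrable_norm_sq φ).const_mul _)
      fun z => mul_le_mul_of_nonneg_right ?_ (sq_nonneg _)
    have := hv.meanField_le hφ z
    rwa [h1, mul_one] at this
  rwa [integral_const_mul, integral_norm_sq, h1, one_pow, mul_one] at h2

variable {N : ℕ}

/-- If `M` is the average of `m` over the `i`-th variable with respect to the density of `φ`, then
`pᵢ m pᵢ = M pᵢ`. -/
theorem ketbra_mulOp_ketbra (φ : L2 ℝ) (i : Fin N) {m M : (Fin N → ℝ) →ᵇ ℝ}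
    (hM : ∀ x, M x = ∫ y, m (Function.update x i y) * ‖φ y‖ ^ 2) (f : ManyBody N) :
    ketbra φ φ i (mulOp m (ketbra φ φ i f)) = mulOp M (ketbra φ φ i f) := by
  have hφ : φ = (Lp.memLp φ).toLp φ := (Lp.toLp_coeFn φ _).symm
  obtain ⟨f, hf, rfl⟩ := L2.exists_toLp f
  rw [hφ, ketbra_toLp, mulOp_toLp, ketbra_toLp, mulOp_toLp, MemLp.toLp_eq_toLp_iff]
  refine Eventually.of_forall fun x => ?_
  simp only [rankOne, Function.update_self, Function.update_idem]
  have h : ∫ y, conj (φ y) * ((m (Function.update x i y) : ℂ) *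
      (φ y * ∫ y, conj (φ y) * f (Function.update x i y))) =
      (M x : ℂ) * ∫ y, conj (φ y) * f (Function.update x i y) := by
    rw [hM, ← integral_complex_ofReal, ← integral_mul_const]
    congr 1
    funext y
    have : conj (φ y) * φ y = ((‖φ y‖ ^ 2 : ℝ) : ℂ) := by
      rw [mul_comm, Complex.mul_conj, Complex.normSq_eq_norm_sq]
    push_cast at this ⊢
    rw [← this]
    ring
  rw [h]
  ring

theorem ketbra_mulOp_comm (u w : L2 ℝ) (k : Fin N) {m : (Fin N → ℝ) →ᵇ ℝ}
    (hm : ∀ x y, m (Function.update x k y) = m x) (f : ManyBody N) :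
    ketbra u w k (mulOp m f) = mulOp m (ketbra u w k f) := by
  obtain ⟨u, hu, rfl⟩ := L2.exists_toLp u
  obtain ⟨w, hw, rfl⟩ := L2.exists_toLp w
  obtain ⟨f, hf, rfl⟩ := L2.exists_toLp f
  rw [mulOp_toLp, ketbra_toLp, ketbra_toLp, mulOp_toLp, MemLp.toLp_eq_toLp_iff,
    rankOne_mul fun x y => by rw [hm]]

theorem permute_mulOp (σ : Equiv.Perm (Fin N)) {m m' : (Fin N → ℝ) →ᵇ ℝ}
    (hm : ∀ x, m' x = m (x ∘ σ)) (f : ManyBody N) :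
    permute σ (mulOp m f) = mulOp m' (permute σ f) := by
  obtain ⟨f, hf, rfl⟩ := L2.exists_toLp f
  rw [mulOp_toLp, permute_toLp, permute_toLp, mulOp_toLp, MemLp.toLp_eq_toLp_iff]
  refine Eventually.of_forall fun x => ?_
  simp [hm]

/-- The potential `v (xᵢ - xⱼ)`. -/
def pairPot (v : ℝ →ᵇ ℝ) (i j : Fin N) : (Fin N → ℝ) →ᵇ ℝ :=
  v.compContinuous ⟨fun x => x i - x j, by fun_prop⟩

theorem pairPot_apply (v : ℝ →ᵇ ℝ) (i j : Fin N) (x : Fin N → ℝ) :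
    pairPot v i j x = v (x i - x j) := rfl

theorem IsUnitPotential.pairPot_nonneg {v : ℝ →ᵇ ℝ} (hv : IsUnitPotential v) (i j : Fin N)
    (x : Fin N → ℝ) : 0 ≤ pairPot v i j x := hv.nonneg _

/-- Multiplication by the square root of `v (xᵢ - xⱼ)`. The potential energy of a wave function
is the square of the norm of its image. -/
def pairRoot (v : ℝ →ᵇ ℝ) (i j : Fin N) : ManyBody N →L[ℂ] ManyBody N :=
  mulOp (sqrtMul (pairPot v i j))

/-- Multiplication by the mean field in the `j`-th variable. -/
def meanFieldOp (v : ℝ →ᵇ ℝ) (φ : L2 ℝ) (j : Fin N) : ManyBody N →L[ℂ] ManyBody N :=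
  mulOp ((meanField v φ).compContinuous ⟨fun x => x j, by fun_prop⟩)

variable {v : ℝ →ᵇ ℝ}

theorem inner_pairRoot (hv : IsUnitPotential v) (i j : Fin N) (f g : ManyBody N) :
    inner ℂ (pairRoot v i j f) (pairRoot v i j g) = inner ℂ f (mulOp (pairPot v i j) g) :=
  inner_mulOp_sqrtMul (hv.pairPot_nonneg i j) f g

theorem norm_pairRoot_sq_le (hv : IsUnitPotential v) {i j : Fin N} (hij : i ≠ j)
    {f f' : ManyBody N} (hf : HasDirDeriv (Pi.single i (1 : ℝ)) f f') :
    ‖pairRoot v i j f‖ ^ 2 ≤ 2 * ‖f'‖ * ‖f‖ := by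
  rw [pairRoot, norm_mulOp_sqrtMul_sq (hv.pairPot_nonneg i j)]
  exact hv.integral_mul_norm_sq_le ⟨fun x : Fin N → ℝ => x i - x j, by fun_prop⟩
    (fun x s => by simp [hij.symm]; ring) hf

theorem ketbra_pairRoot_comm (u w : L2 ℝ) {i j k : Fin N} (hi : k ≠ i) (hj : k ≠ j)
    (f : ManyBody N) : ketbra u w k (pairRoot v i j f) = pairRoot v i j (ketbra u w k f) :=
  ketbra_mulOp_comm u w k (fun x y => by
    simp [sqrtMul, pairPot_apply, Function.update_of_ne hi.symm, Function.update_of_ne hj.symm]) f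

theorem permute_pairRoot (σ : Equiv.Perm (Fin N)) (i j : Fin N) (f : ManyBody N) :
    permute σ (pairRoot v i j f) = pairRoot v (σ i) (σ j) (permute σ f) :=
  permute_mulOp σ (fun _ => rfl) f

theorem pairRoot_symm (hv : ∀ x, v (-x) = v x) (i j : Fin N) :
    pairRoot v i j = pairRoot v j i := by
  have : pairPot v i j = pairPot v j i := by
    ext x
    rw [pairPot_apply, pairPot_apply, ← hv, neg_sub]
  rw [pairRoot, this, pairRoot]

theorem ketbra_meanFieldOp_comm (u w φ : L2 ℝ) {j k : Fin N} (hj : k ≠ j) (f : ManyBody N) :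
    ketbra u w k (meanFieldOp v φ j f) = meanFieldOp v φ j (ketbra u w k f) :=
  ketbra_mulOp_comm u w k (fun x y => by simp [Function.update_of_ne hj.symm]) f

theorem norm_meanFieldOp_le (hv : IsUnitPotential v) {φ φ' : L2 ℝ}
    (hφ : HasDirDeriv (1 : ℝ) φ φ') (h1 : ‖φ‖ = 1) (j : Fin N) (f : ManyBody N) :
    ‖meanFieldOp v φ j f‖ ≤ 2 * ‖φ'‖ * ‖f‖ := by
  refine norm_mulOp_apply_le_of_le (fun x => ?_) f
  have h2 := hv.meanField_le hφ (x j)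
  rw [h1, mul_one] at h2
  rw [abs_of_nonneg]
  · exact h2
  · exact hv.meanField_nonneg φ (x j)

theorem ketbra_pairPot_ketbra (φ : L2 ℝ) {i j : Fin N} (hij : i ≠ j) (f : ManyBody N) :
    ketbra φ φ i (mulOp (pairPot v i j) (ketbra φ φ i f)) = meanFieldOp v φ j (ketbra φ φ i f) :=
  ketbra_mulOp_ketbra φ i (fun x => by
    simp [meanField, pairPot_apply, Function.update_of_ne hij.symm]) f

theorem ketbra_meanFieldOp_ketbra (φ : L2 ℝ) (j : Fin N) (f : ManyBody N) :
    ketbra φ φ j (meanFieldOp v φ j (ketbra φ φ j f)) =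
      ((selfEnergy v φ : ℝ) : ℂ) • ketbra φ φ j f := by
  rw [meanFieldOp, ketbra_mulOp_ketbra (M := BoundedContinuousFunction.const _ (selfEnergy v φ))]
  · refine Lp.ext ?_
    filter_upwards [coeFn_mulOp (BoundedContinuousFunction.const (Fin N → ℝ) (selfEnergy v φ))
      (ketbra φ φ j f), Lp.coeFn_smul ((selfEnergy v φ : ℝ) : ℂ) (ketbra φ φ j f)] with x h1 h2
    rw [h1, h2]
    simp
  · intro x
    simp [selfEnergy]

end PairPotential

/-! ### Kinetic and potential energy in terms of the excitations -/

section StaticEstimates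

variable {N : ℕ}

/-- The projections `pⱼ` onto the condensate wave function. -/
def condensate (φ : L2 ℝ) (j : Fin N) : ManyBody N →L[ℂ] ManyBody N := ketbra φ φ j

theorem commutingProjections_condensate {φ : L2 ℝ} (hφ : ‖φ‖ = 1) :
    CommutingProjections (condensate φ : Fin N → _) where
  symm i f g := inner_ketbra_right φ φ i f g
  idem i f := by
    rw [condensate, ketbra_ketbra_same, inner_self_eq_norm_sq_to_K, hφ]
    simp
  comm i j f := by
    by_cases h : i = j
    · rw [h]
    · exact ketbra_comm φ φ φ φ h f

theorem isBalanced_of_permute_eq {φ : L2 ℝ} (hφ : ‖φ‖ = 1) {Φ : ManyBody N}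
    (hs : ∀ σ, permute σ Φ = Φ) : IsBalanced (condensate φ) Φ := by
  intro σ S
  have h := (commutingProjections_condensate (N := N) hφ).map_sector
    (permute σ).toContinuousLinearMap σ (fun j f => permute_ketbra φ φ σ j f) S Φ
  change permute σ _ = sector _ _ (permute σ Φ) at h
  rw [hs] at h
  rw [← h, LinearIsometry.norm_map]

variable {φ φ' φ'' : L2 ℝ}

theorem HasDirDeriv.condensate_self (h1 : HasDirDeriv (1 : ℝ) φ φ') (i : Fin N)
    (f : ManyBody N) :
    HasDirDeriv (Pi.single i (1 : ℝ)) (condensate φ i f) (ketbra φ' φ i f) :=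
  h1.ketbra_self φ i f

/-- Interpolation: `‖φ'‖² = -⟨φ, φ''⟩`. -/
theorem norm_sq_deriv_le (h1 : HasDirDeriv (1 : ℝ) φ φ') (h2 : HasDirDeriv (1 : ℝ) φ' φ'')
    (hφ : ‖φ‖ = 1) : ‖φ'‖ ^ 2 ≤ ‖φ''‖ := by
  have h : inner ℂ φ φ'' = -inner ℂ φ' φ' := by
    linear_combination h1.inner_add_inner h2
  have h3 := norm_inner_le_norm (𝕜 := ℂ) φ φ''
  rw [h, norm_neg, hφ, one_mul, inner_self_eq_norm_sq_to_K] at h3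
  simpa using h3

/-- The lower bound on the kinetic energy: the excited part, plus the kinetic energy of the
condensate, up to the cost of the excitations. -/
theorem kinetic_lower_bound (h1 : HasDirDeriv (1 : ℝ) φ φ') (h2 : HasDirDeriv (1 : ℝ) φ' φ'')
    (hφ : ‖φ‖ = 1) {Φ Φ' : ManyBody N} (hΦ : ‖Φ‖ = 1) (hs : ∀ σ, permute σ Φ = Φ) {i : Fin N}
    (hd : HasDirDeriv (Pi.single i (1 : ℝ)) Φ Φ') :
    ‖Φ' - ketbra φ' φ i Φ‖ ^ 2 + ‖φ'‖ ^ 2 * (1 - excitation (condensate φ) Φ) -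
      2 * ‖φ''‖ * (excitation (condensate φ) Φ + 1 / Real.sqrt N) ≤ ‖Φ'‖ ^ 2 := by
  have hP := commutingProjections_condensate (N := N) hφ
  have hb := isBalanced_of_permute_eq hφ hs
  set β := excitation (condensate φ) Φ with hβ
  set D := Φ' - ketbra φ' φ i Φ with hD
  set B := ketbra φ' φ i Φ with hB
  have hpd := h1.condensate_self i Φ
  have hqd : HasDirDeriv (Pi.single i (1 : ℝ)) (Φ - condensate φ i Φ) D := hd.sub hpd
  have hBd : HasDirDeriv (Pi.single i (1 : ℝ)) B (ketbra φ'' φ i Φ) := h2.ketbra_self φ i Φ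
  -- in the cross term the derivative moves from the excited part to `φ'`
  have hin : inner ℂ B D = -inner ℂ (ketbra φ'' φ i Φ) (Φ - condensate φ i Φ) := by
    have := hBd.inner_add_inner hqd
    linear_combination this
  -- so that the remaining operator acts on the condensed part only
  have hpp : ketbra φ'' φ i (condensate φ i Φ) = ketbra φ'' φ i Φ := by
    rw [condensate, ketbra_ketbra_same, inner_self_eq_norm_sq_to_K, hφ]
    simp
  have hcross : ‖inner ℂ B D‖ ≤ ‖φ''‖ * (β + 1 / Real.sqrt N) := by
    rw [hin, norm_neg, ← hpp]
    refine hP.norm_inner_transfer_le hb hΦ i (ketbra φ'' φ i) (norm_nonneg _) (fun f => ?_)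
      fun k hk f => ketbra_comm _ _ _ _ hk f
    have := norm_ketbra_apply_le φ'' φ i f
    rwa [hφ, mul_one] at this
  have hBn : ‖B‖ ^ 2 = ‖φ'‖ ^ 2 * ‖condensate φ i Φ‖ ^ 2 := by
    have e : inner ℂ B B = ((‖φ'‖ ^ 2 * ‖condensate φ i Φ‖ ^ 2 : ℝ) : ℂ) := by
      rw [hB, inner_ketbra_right, ketbra_ketbra_same, inner_smul_left, inner_self_eq_norm_sq_to_K]
      have e2 : inner ℂ (ketbra φ φ i Φ) Φ = ((‖condensate φ i Φ‖ ^ 2 : ℝ) : ℂ) := by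
        rw [← inner_conj_symm]
        change conj (inner ℂ Φ (condensate φ i Φ)) = _
        rw [← hP.idem, hP.symm, inner_self_eq_norm_sq_to_K, hP.idem]
        simp
      rw [e2]
      simp
    rw [inner_self_eq_norm_sq_to_K] at e
    exact Complex.ofReal_injective ((by simp : _ = _).trans e)
  have hpq : ‖condensate φ i Φ‖ ^ 2 = 1 - ‖Φ - condensate φ i Φ‖ ^ 2 := by
    have h0 : inner ℂ (condensate φ i Φ) (Φ - condensate φ i Φ) = 0 :=
      hP.inner_eq_zero (i := i) (hP.idem i Φ) (by rw [map_sub, hP.idem, sub_self])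
    have h3 := norm_add_sq_eq_norm_sq_add_norm_sq_of_inner_eq_zero (𝕜 := ℂ) _ _ h0
    rw [add_sub_cancel, hΦ] at h3
    linarith
  have hq := hP.norm_sub_apply_sq_le i.pos hb i
  have hsum : ‖Φ'‖ ^ 2 = ‖B‖ ^ 2 + 2 * (inner ℂ B D).re + ‖D‖ ^ 2 := by
    have e : Φ' = B + D := by rw [hD]; abel
    rw [e, norm_add_sq (𝕜 := ℂ)]
    rfl
  have hre := (abs_le.1 ((Complex.abs_re_le_norm (inner ℂ B D)).trans hcross)).1
  rw [hsum, hBn, hpq]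
  have h4 : ‖φ'‖ ^ 2 * (1 - β) ≤ ‖φ'‖ ^ 2 * (1 - ‖Φ - condensate φ i Φ‖ ^ 2) :=
    mul_le_mul_of_nonneg_left (by linarith) (sq_nonneg _)
  linarith

/-- Every component of a differentiable wave function is differentiable: outside of its own
variable a projection commutes with the derivative, and in its own variable its range consists
of differentiable functions. -/
theorem exists_hasDirDeriv_listSector (h1 : HasDirDeriv (1 : ℝ) φ φ') {Φ Φ' : ManyBody N}
    {i : Fin N} (hd : HasDirDeriv (Pi.single i (1 : ℝ)) Φ Φ') (S : Finset (Fin N))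
    (L : List (Fin N)) :
    ∃ g, HasDirDeriv (Pi.single i (1 : ℝ)) (listSector (condensate φ) S L Φ) g := by
  induction L with
  | nil => exact ⟨Φ', by simpa [listSector] using hd⟩
  | cons j L ih =>
    obtain ⟨g, hg⟩ := ih
    have hp : ∃ g', HasDirDeriv (Pi.single i (1 : ℝ))
        (condensate φ j (listSector (condensate φ) S L Φ)) g' := by
      by_cases hij : i = j
      · subst hij
        exact ⟨_, h1.condensate_self i _⟩
      · exact ⟨_, hg.ketbra_of_ne hij⟩
    obtain ⟨g', hg'⟩ := hp
    rw [listSector_cons]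
    split_ifs
    · exact ⟨_, hg.sub hg'⟩
    · exact ⟨_, hg'⟩

/-- The derivatives of the components with an excited `i`-th particle are orthogonal and add up to
the derivative of `qᵢ Φ`. -/
theorem exists_sector_derivs (h1 : HasDirDeriv (1 : ℝ) φ φ') (hφ : ‖φ‖ = 1)
    {Φ Φ' : ManyBody N} {i : Fin N} (hd : HasDirDeriv (Pi.single i (1 : ℝ)) Φ Φ') :
    ∃ g : Finset (Fin N) → ManyBody N,
      (∀ S, HasDirDeriv (Pi.single i (1 : ℝ)) (sector (condensate φ) S Φ) (g S)) ∧
      ∑ S with i ∈ S, ‖g S‖ ^ 2 = ‖Φ' - ketbra φ' φ i Φ‖ ^ 2 := by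
  have hP := commutingProjections_condensate (N := N) hφ
  choose g hg using fun S => exists_hasDirDeriv_listSector h1 hd S (List.finRange N)
  refine ⟨g, hg, ?_⟩
  have hsum : ∑ S with i ∈ S, g S = Φ' - ketbra φ' φ i Φ := by
    have e1 := HasDirDeriv.sum (Finset.univ.filter fun S => i ∈ S) fun S _ => hg S
    have e2 := hd.sub (h1.condensate_self i Φ)
    rw [hP.sub_apply_eq_sum] at e2
    exact e1.unique e2
  -- the derivative in the `i`-th variable respects the sectors of the other particles
  have hmem : ∀ S k, k ≠ i → condensate φ k (g S) = if k ∈ S then 0 else g S := by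
    intro S k hk
    have e1 := (hg S).ketbra_of_ne (u := φ) (w := φ) hk.symm
    change HasDirDeriv _ (condensate φ k (sector (condensate φ) S Φ)) _ at e1
    rw [hP.apply_sector] at e1
    split_ifs at e1 with h
    · rw [if_pos h]
      have e3 := (hg S).sub (hg S)
      rw [sub_self, sub_self] at e3
      exact e1.unique e3
    · rw [if_neg h]
      exact e1.unique (hg S)
  rw [← hsum, norm_sum_sq_of_orthogonal]
  intro S hS T hT hST
  have hS := (Finset.mem_filter.1 hS).2
  have hT := (Finset.mem_filter.1 hT).2
  obtain ⟨k, hk⟩ : ∃ k, ¬(k ∈ S ↔ k ∈ T) := by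
    by_contra! hcon
    exact hST (Finset.ext hcon)
  have hki : k ≠ i := by
    rintro rfl
    exact hk (by simp [hS, hT])
  exact hP.inner_eq_zero_of_mem_xor (hmem S k hki) (hmem T k hki) hk

variable {v : ℝ →ᵇ ℝ}

theorem condensate_pairPot_condensate (φ : L2 ℝ) {i j : Fin N} (hij : i ≠ j) (f : ManyBody N) :
    condensate φ i (mulOp (pairPot v i j) (condensate φ i f)) =
      meanFieldOp v φ j (condensate φ i f) :=
  ketbra_pairPot_ketbra φ hij f

theorem condensate_meanFieldOp_comm (φ : L2 ℝ) {j k : Fin N} (hj : k ≠ j) (f : ManyBody N) :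
    condensate φ k (meanFieldOp v φ j f) = meanFieldOp v φ j (condensate φ k f) :=
  ketbra_meanFieldOp_comm φ φ φ hj f

theorem norm_pairRoot_sq_le_of_condensate (hv : IsUnitPotential v)
    (h1 : HasDirDeriv (1 : ℝ) φ φ') (hφ : ‖φ‖ = 1) {i j : Fin N} (hij : i ≠ j) (f : ManyBody N)
    (hf : condensate φ i f = f) : ‖pairRoot v i j f‖ ^ 2 ≤ 2 * ‖φ'‖ * ‖f‖ ^ 2 := by
  have hP := commutingProjections_condensate (N := N) hφ
  have e : inner ℂ (pairRoot v i j f) (pairRoot v i j f) = inner ℂ f (meanFieldOp v φ j f) := by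
    rw [inner_pairRoot hv]
    conv_lhs => rw [← hf, ← hP.symm]
    rw [condensate_pairPot_condensate φ hij, hf]
  rw [inner_self_eq_norm_sq_to_K] at e
  have e2 : ‖pairRoot v i j f‖ ^ 2 = ‖inner ℂ f (meanFieldOp v φ j f)‖ := by
    rw [← e]
    simp
  rw [e2]
  refine (norm_inner_le_norm _ _).trans ?_
  have := mul_le_mul_of_nonneg_left (norm_meanFieldOp_le hv h1 hφ j f) (norm_nonneg f)
  linarith

/-- The interaction of the doubly condensed part is the self-energy of the condensate. -/
theorem norm_pairRoot_condensate_sq (hv : IsUnitPotential v) (hφ : ‖φ‖ = 1) {i j : Fin N}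
    (hij : i ≠ j) (f : ManyBody N) :
    ‖pairRoot v i j (condensate φ i (condensate φ j f))‖ ^ 2 =
      selfEnergy v φ * ‖condensate φ i (condensate φ j f)‖ ^ 2 := by
  have hP := commutingProjections_condensate (N := N) hφ
  set a := condensate φ i (condensate φ j f) with ha
  have hai : condensate φ i a = a := hP.idem i _
  have haj : condensate φ j a = a := by rw [ha, hP.comm, hP.idem]
  have e : inner ℂ (pairRoot v i j a) (pairRoot v i j a) =
      ((selfEnergy v φ * ‖a‖ ^ 2 : ℝ) : ℂ) := by
    rw [inner_pairRoot hv]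
    conv_lhs => rw [← hai, ← hP.symm]
    rw [condensate_pairPot_condensate φ hij, hai]
    conv_lhs => rw [← haj, ← hP.symm]
    rw [condensate, ketbra_meanFieldOp_ketbra]
    change inner ℂ _ (_ • condensate φ j a) = _
    rw [haj, inner_smul_right, inner_self_eq_norm_sq_to_K]
    simp
  rw [inner_self_eq_norm_sq_to_K] at e
  exact Complex.ofReal_injective ((by simp : _ = _).trans e)

/-- One excited particle: the interaction acts through the mean field of the condensate. -/
theorem norm_inner_pairRoot_single_le (hv : IsUnitPotential v) (h1 : HasDirDeriv (1 : ℝ) φ φ')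
    (hφ : ‖φ‖ = 1) {Φ : ManyBody N} (hΦ : ‖Φ‖ = 1) (hs : ∀ σ, permute σ Φ = Φ) {i j : Fin N}
    (hij : i ≠ j) :
    ‖inner ℂ (pairRoot v i j (condensate φ i (condensate φ j Φ)))
      (pairRoot v i j (condensate φ i (Φ - condensate φ j Φ)))‖ ≤
      2 * ‖φ'‖ * (excitation (condensate φ) Φ + 1 / Real.sqrt N) := by
  have hP := commutingProjections_condensate (N := N) hφ
  have hb := isBalanced_of_permute_eq hφ hs
  have e : inner ℂ (pairRoot v i j (condensate φ i (condensate φ j Φ)))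
      (pairRoot v i j (condensate φ i (Φ - condensate φ j Φ))) =
      inner ℂ ((meanFieldOp v φ j ∘L condensate φ i) (condensate φ j Φ))
        (Φ - condensate φ j Φ) := by
    rw [inner_pairRoot hv, ← hP.symm, condensate_pairPot_condensate φ hij,
      ← condensate_meanFieldOp_comm φ hij, hP.symm, meanFieldOp, inner_mulOp_right]
    rfl
  rw [e]
  refine hP.norm_inner_transfer_le hb hΦ j _ (by positivity) (fun f => ?_) fun k hk f => ?_
  · refine (norm_meanFieldOp_le hv h1 hφ j _).trans ?_
    exact mul_le_mul_of_nonneg_left (hP.norm_apply_le i f) (by positivity)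
  · change condensate φ k (meanFieldOp v φ j (condensate φ i f)) =
      meanFieldOp v φ j (condensate φ i (condensate φ k f))
    rw [condensate_meanFieldOp_comm φ hk]
    congr 1
    exact hP.comm k i f

/-- A perturbation of a vector that is nearly orthogonal to it changes the square of its norm
little. -/
theorem abs_norm_add_sq_sub_norm_sq_le {H : Type*} [NormedAddCommGroup H] [InnerProductSpace ℂ H]
    (a b c d : H) :
    |‖a + (b + c + d)‖ ^ 2 - ‖a‖ ^ 2| ≤
      2 * (‖inner ℂ a b‖ + ‖inner ℂ a c‖ + ‖inner ℂ a d‖) +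
        3 * (‖b‖ ^ 2 + ‖c‖ ^ 2 + ‖d‖ ^ 2) := by
  have h3 : ‖b + c + d‖ ^ 2 ≤ 3 * (‖b‖ ^ 2 + ‖c‖ ^ 2 + ‖d‖ ^ 2) := by
    have e := norm_add₃_le (a := b) (b := c) (c := d)
    have e0 := norm_nonneg (b + c + d)
    nlinarith [sq_nonneg (‖b‖ - ‖c‖), sq_nonneg (‖b‖ - ‖d‖), sq_nonneg (‖c‖ - ‖d‖)]
  have e : ‖a + (b + c + d)‖ ^ 2 = ‖a‖ ^ 2 + 2 * ((inner ℂ a b).re + (inner ℂ a c).re +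
      (inner ℂ a d).re) + ‖b + c + d‖ ^ 2 := by
    rw [norm_add_sq (𝕜 := ℂ), inner_add_right, inner_add_right, RCLike.re_eq_complex_re,
      Complex.add_re, Complex.add_re]
  have r1 := abs_le.1 (Complex.abs_re_le_norm (inner ℂ a b))
  have r2 := abs_le.1 (Complex.abs_re_le_norm (inner ℂ a c))
  have r3 := abs_le.1 (Complex.abs_re_le_norm (inner ℂ a d))
  have r4 := sq_nonneg ‖b + c + d‖
  rw [e, abs_le]
  constructor <;> linarith

/-- Two of the projections retain almost all of the mass. -/
theorem CommutingProjections.norm_pair_sq_mem {N : ℕ} {H : Type*} [NormedAddCommGroup H]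
    [InnerProductSpace ℂ H] {P : Fin N → H →L[ℂ] H}
    (hP : CommutingProjections P) {Φ : H} (hb : IsBalanced P Φ) (hΦ : ‖Φ‖ = 1) (i j : Fin N) :
    1 - 2 * excitation P Φ ≤ ‖P i (P j Φ)‖ ^ 2 ∧ ‖P i (P j Φ)‖ ^ 2 ≤ 1 := by
  have hqi := hP.norm_sub_apply_sq_le i.pos hb i
  have hqj := hP.norm_sub_apply_sq_le i.pos hb j
  have o1 : inner ℂ (P j Φ) (Φ - P j Φ) = 0 :=
    hP.inner_eq_zero (i := j) (hP.idem j Φ) (by rw [map_sub, hP.idem, sub_self])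
  have e1 := norm_add_sq_eq_norm_sq_add_norm_sq_of_inner_eq_zero (𝕜 := ℂ) _ _ o1
  rw [add_sub_cancel, hΦ] at e1
  have o2 : inner ℂ (P i (P j Φ)) (P j Φ - P i (P j Φ)) = 0 :=
    hP.inner_eq_zero (i := i) (hP.idem i _) (by rw [map_sub, hP.idem, sub_self])
  have e2 := norm_add_sq_eq_norm_sq_add_norm_sq_of_inner_eq_zero (𝕜 := ℂ) _ _ o2
  rw [add_sub_cancel] at e2
  have e3 : P j Φ - P i (P j Φ) = P j (Φ - P i Φ) := by rw [map_sub, hP.comm]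
  have e4 := hP.norm_apply_le j (Φ - P i Φ)
  rw [← e3] at e4
  have e5 : ‖P j Φ - P i (P j Φ)‖ * ‖P j Φ - P i (P j Φ)‖ ≤ ‖Φ - P i Φ‖ * ‖Φ - P i Φ‖ :=
    mul_le_mul e4 e4 (norm_nonneg _) (norm_nonneg _)
  constructor <;> nlinarith [norm_nonneg (Φ - P j Φ), norm_nonneg (P j Φ - P i (P j Φ))]

/-- The interaction energy of two excited particles is absorbed by their kinetic energy. -/
theorem norm_pairRoot_excited_sq_le (hv : IsUnitPotential v) (h1 : HasDirDeriv (1 : ℝ) φ φ')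
    (hφ : ‖φ‖ = 1) {Φ Φ' : ManyBody N} (hs : ∀ σ, permute σ Φ = Φ) {i j : Fin N}
    (hij : i ≠ j) (hd : HasDirDeriv (Pi.single i (1 : ℝ)) Φ Φ') :
    ‖pairRoot v i j ((Φ - condensate φ i Φ) - condensate φ j (Φ - condensate φ i Φ))‖ ^ 2 ≤
      ‖Φ' - ketbra φ' φ i Φ‖ ^ 2 / 12 + 12 * excitation (condensate φ) Φ := by
  have hP := commutingProjections_condensate (N := N) hφ
  have hqi := hP.norm_sub_apply_sq_le i.pos (isBalanced_of_permute_eq hφ hs) i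
  have hqd : HasDirDeriv (Pi.single i (1 : ℝ)) (Φ - condensate φ i Φ) (Φ' - ketbra φ' φ i Φ) :=
    hd.sub (h1.condensate_self i Φ)
  generalize Φ' - ketbra φ' φ i Φ = D at hqd ⊢
  generalize excitation (condensate φ) Φ = β at hqi ⊢
  generalize Φ - condensate φ i Φ = q at hqi hqd ⊢
  have e1 := norm_pairRoot_sq_le hv hij (hqd.sub (hqd.ketbra_of_ne (u := φ) (w := φ) hij))
  have e2 : ‖D - condensate φ j D‖ ≤ ‖D‖ := hP.norm_sub_apply_le j D
  have e3 : ‖q - condensate φ j q‖ ≤ ‖q‖ := hP.norm_sub_apply_le j q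
  have e4 : ‖D - condensate φ j D‖ * ‖q - condensate φ j q‖ ≤ ‖D‖ * ‖q‖ :=
    mul_le_mul e2 e3 (norm_nonneg _) (norm_nonneg _)
  have e5 : ‖pairRoot v i j (q - condensate φ j q)‖ ^ 2 ≤
      2 * (‖D - condensate φ j D‖ * ‖q - condensate φ j q‖) := by
    refine e1.trans_eq ?_
    simp only [condensate]
    ring
  -- `2 x y ≤ x² / 12 + 12 y²`
  have e6 := sq_nonneg (‖D‖ - 12 * ‖q‖)
  linarith

/-- The pair interaction energy differs from the self-energy of the condensate by a small multiple
of the kinetic energy of the excited part and the cost of the excitations. -/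
theorem abs_pair_energy_sub_selfEnergy_le (hv : IsUnitPotential v) (heven : ∀ x, v (-x) = v x)
    (h1 : HasDirDeriv (1 : ℝ) φ φ')
    (hφ : ‖φ‖ = 1) {Φ Φ' : ManyBody N} (hΦ : ‖Φ‖ = 1) (hs : ∀ σ, permute σ Φ = Φ) {i j : Fin N}
    (hij : i ≠ j) (hd : HasDirDeriv (Pi.single i (1 : ℝ)) Φ Φ') :
    |‖pairRoot v i j Φ‖ ^ 2 - selfEnergy v φ| ≤
      ‖Φ' - ketbra φ' φ i Φ‖ ^ 2 / 2 + (26 * ‖φ'‖ + 40) * excitation (condensate φ) Φ +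
        12 * ‖φ'‖ * (1 / Real.sqrt N) := by
  have hP := commutingProjections_condensate (N := N) hφ
  have hb := isBalanced_of_permute_eq hφ hs
  have hmass := hP.norm_pair_sq_mem hb hΦ i j
  have hqj := hP.norm_sub_apply_sq_le i.pos hb j
  have hRd := norm_pairRoot_excited_sq_le hv h1 hφ hs hij hd
  have hab₁ := norm_inner_pairRoot_single_le hv h1 hφ hΦ hs hij
  have hRa := norm_pairRoot_condensate_sq hv hφ hij Φ
  have hA0 := hv.selfEnergy_nonneg φ
  have hA1 : selfEnergy v φ ≤ 2 * ‖φ'‖ := hv.selfEnergy_le h1 hφ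
  have hβ0 : 0 ≤ excitation (condensate φ) Φ := excitation_nonneg
  have hd2 : (Φ - condensate φ i Φ) - condensate φ j (Φ - condensate φ i Φ) =
      Φ - condensate φ j Φ - condensate φ i (Φ - condensate φ j Φ) := by
    rw [map_sub, map_sub, hP.comm i j]
    abel
  rw [hd2] at hRd
  have had : ‖inner ℂ (pairRoot v i j (condensate φ i (condensate φ j Φ)))
      (pairRoot v i j (Φ - condensate φ j Φ - condensate φ i (Φ - condensate φ j Φ)))‖ ≤
      ‖φ'‖ * (excitation (condensate φ) Φ + 2 * (1 / Real.sqrt N)) +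
        ‖Φ' - ketbra φ' φ i Φ‖ ^ 2 / 8 + 2 * excitation (condensate φ) Φ := by
    obtain ⟨G, hG, hGsum⟩ := exists_sector_derivs h1 hφ hd
    have e := hP.norm_inner_pair_transfer_le hb hΦ hij (pairRoot v i j) (c := 2 * ‖φ'‖)
      (X := ‖Φ' - ketbra φ' φ i Φ‖ ^ 2)
      (by positivity) (fun S => ‖G S‖)
      (fun f hf => norm_pairRoot_sq_le_of_condensate hv h1 hφ hij f hf)
      (fun S _ => norm_pairRoot_sq_le hv hij (hG S)) hGsum.le
      (fun k hki hkj f => ketbra_pairRoot_comm φ φ hki hkj f)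
    refine e.trans_eq ?_
    ring
  -- the exchange of the two particles maps one singly excited part to the other
  have hswap : ∀ f, permute (Equiv.swap i j) (pairRoot v i j f) =
      pairRoot v i j (permute (Equiv.swap i j) f) := by
    intro f
    rw [permute_pairRoot, Equiv.swap_apply_left, Equiv.swap_apply_right, pairRoot_symm heven]
  have hswapP : ∀ k f, permute (Equiv.swap i j) (condensate φ k f) =
      condensate φ (Equiv.swap i j k) (permute (Equiv.swap i j) f) := fun k f =>
    permute_ketbra φ φ (Equiv.swap i j) k f
  have hswapa : permute (Equiv.swap i j) (condensate φ i (condensate φ j Φ)) =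
      condensate φ i (condensate φ j Φ) := by
    rw [hswapP, hswapP, hs, Equiv.swap_apply_left, Equiv.swap_apply_right, hP.comm]
  have hswapb : permute (Equiv.swap i j) (condensate φ i (Φ - condensate φ j Φ)) =
      condensate φ j (Φ - condensate φ i Φ) := by
    rw [hswapP, map_sub (permute (Equiv.swap i j)), hswapP, hs, Equiv.swap_apply_left,
      Equiv.swap_apply_right]
  have hRb₁ : ‖pairRoot v i j (condensate φ i (Φ - condensate φ j Φ))‖ ^ 2 ≤
      2 * ‖φ'‖ * excitation (condensate φ) Φ := by
    refine (norm_pairRoot_sq_le_of_condensate hv h1 hφ hij _ (hP.idem i _)).trans ?_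
    refine mul_le_mul_of_nonneg_left (le_trans ?_ hqj) (by positivity)
    exact pow_le_pow_left₀ (norm_nonneg _) (hP.norm_apply_le i _) 2
  have hRb₂ : ‖pairRoot v i j (condensate φ j (Φ - condensate φ i Φ))‖ ^ 2 ≤
      2 * ‖φ'‖ * excitation (condensate φ) Φ := by
    rw [← hswapb, ← hswap, LinearIsometry.norm_map]
    exact hRb₁
  have hab₂ : ‖inner ℂ (pairRoot v i j (condensate φ i (condensate φ j Φ)))
      (pairRoot v i j (condensate φ j (Φ - condensate φ i Φ)))‖ ≤
      2 * ‖φ'‖ * (excitation (condensate φ) Φ + 1 / Real.sqrt N) := by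
    rw [← hswapb, ← hswapa, ← hswap, ← hswap, LinearIsometry.inner_map_map]
    exact hab₁
  have hΦsum : Φ = condensate φ i (condensate φ j Φ) + (condensate φ i (Φ - condensate φ j Φ) +
      condensate φ j (Φ - condensate φ i Φ) +
      (Φ - condensate φ j Φ - condensate φ i (Φ - condensate φ j Φ))) := by
    rw [map_sub, map_sub, hP.comm j i]
    abel
  have hR : pairRoot v i j Φ = pairRoot v i j (condensate φ i (condensate φ j Φ)) +
      (pairRoot v i j (condensate φ i (Φ - condensate φ j Φ)) +
        pairRoot v i j (condensate φ j (Φ - condensate φ i Φ)) +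
        pairRoot v i j (Φ - condensate φ j Φ - condensate φ i (Φ - condensate φ j Φ))) := by
    rw [← map_add, ← map_add, ← map_add, ← hΦsum]
  have hexp := abs_norm_add_sq_sub_norm_sq_le (pairRoot v i j (condensate φ i (condensate φ j Φ)))
    (pairRoot v i j (condensate φ i (Φ - condensate φ j Φ)))
    (pairRoot v i j (condensate φ j (Φ - condensate φ i Φ)))
    (pairRoot v i j (Φ - condensate φ j Φ - condensate φ i (Φ - condensate φ j Φ)))
  rw [← hR, hRa] at hexp
  have hβg := mul_le_mul_of_nonneg_right hA1 hβ0
  generalize ‖condensate φ i (condensate φ j Φ)‖ ^ 2 = m at hmass hexp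
  have m1 : selfEnergy v φ * m ≤ selfEnergy v φ := mul_le_of_le_one_right hA0 hmass.2
  have m2 := mul_le_mul_of_nonneg_left hmass.1 hA0
  have hgn : 0 ≤ ‖φ'‖ * (1 / Real.sqrt N) := by positivity
  have hgβ := mul_nonneg (norm_nonneg φ') hβ0
  have hD0 := sq_nonneg ‖Φ' - ketbra φ' φ i Φ‖
  rw [abs_le] at hexp ⊢
  constructor <;> linarith [hexp.1, hexp.2]

end StaticEstimates

/-! ### One-particle regularity -/

section Regularity

variable {f : ℝ → ℂ}

/-- A continuous function on the line is a primitive of its weak derivative. Both sides are the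
derivative at `s = 0` of `∫ x in a..b, f (x + s)`. -/
theorem sub_eq_inner_of_hasDirDeriv (hc : Continuous f) (hf : MemLp f 2 volume) {g : L2 ℝ}
    (h : HasDirDeriv (1 : ℝ) (hf.toLp f) g) {a b : ℝ} (hab : a ≤ b) :
    f b - f a = inner ℂ (indicatorConstLp 2 (measurableSet_Ioc (a := a) (b := b))
      (measure_Ioc_lt_top (μ := volume)).ne (1 : ℂ)) g := by
  have h1 := (hasDerivAt_const (0 : ℝ) (indicatorConstLp 2 (measurableSet_Ioc (a := a) (b := b))
      (measure_Ioc_lt_top (μ := volume)).ne (1 : ℂ))).inner ℂ h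
  simp only [inner_zero_left, add_zero] at h1
  have h2 : ∀ s : ℝ, inner ℂ (indicatorConstLp 2 (measurableSet_Ioc (a := a) (b := b))
      (measure_Ioc_lt_top (μ := volume)).ne (1 : ℂ)) (shift (1 : ℝ) s (hf.toLp f)) =
      (∫ x in (0 : ℝ)..(b + s), f x) - ∫ x in (0 : ℝ)..(a + s), f x := by
    intro s
    rw [L2.inner_indicatorConstLp_one, intervalIntegral.integral_interval_sub_left
      (hc.intervalIntegrable _ _) (hc.intervalIntegrable _ _),
      ← intervalIntegral.integral_comp_add_right (fun x => f x) s,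
      intervalIntegral.integral_of_le hab]
    refine integral_congr_ae (ae_restrict_of_ae ?_)
    have h3 := (measurePreserving_add_right (volume : Measure ℝ)
      (s • (1 : ℝ))).quasiMeasurePreserving.ae hf.coeFn_toLp
    filter_upwards [coeFn_shift (1 : ℝ) s (hf.toLp f), h3] with x e1 e2
    rw [e1, e2, smul_eq_mul, mul_one]
  have h3 : ∀ c : ℝ, HasDerivAt (fun s => ∫ x in (0 : ℝ)..(c + s), f x) (f c) 0 := by
    intro c
    have e : HasDerivAt (fun z => ∫ x in (0 : ℝ)..z, f x) (f (c + 0)) (c + 0) :=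
      intervalIntegral.integral_hasDerivAt_right (hc.intervalIntegrable _ _)
        (hc.stronglyMeasurableAtFilter _ _) hc.continuousAt
    have := e.comp_const_add c 0
    rwa [add_zero] at this
  exact ((h3 b).sub (h3 a)).unique
    (h1.congr_of_eventuallyEq (Eventually.of_forall fun s => (h2 s).symm))

theorem norm_sub_le_of_hasDirDeriv (hc : Continuous f) (hf : MemLp f 2 volume) {g : L2 ℝ}
    (h : HasDirDeriv (1 : ℝ) (hf.toLp f) g) (a b : ℝ) :
    ‖f a - f b‖ ≤ ‖g‖ * |a - b| ^ (1 / 2 : ℝ) := by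
  wlog hab : b ≤ a generalizing a b
  · rw [norm_sub_rev, abs_sub_comm]
    exact this b a (le_of_not_ge hab)
  rw [sub_eq_inner_of_hasDirDeriv hc hf h hab, mul_comm]
  refine (norm_inner_le_norm _ _).trans (mul_le_mul_of_nonneg_right ?_ (norm_nonneg _))
  rw [norm_indicatorConstLp (by norm_num) (by norm_num), norm_one, one_mul, Measure.real,
    Real.volume_Ioc, ENNReal.toReal_ofReal (sub_nonneg.2 hab), abs_of_nonneg (sub_nonneg.2 hab)]
  norm_num

theorem memHolder_of_hasDirDeriv (hc : Continuous f) (hf : MemLp f 2 volume) {g : L2 ℝ}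
    (h : HasDirDeriv (1 : ℝ) (hf.toLp f) g) : MemHolder (1 / 2) f := by
  refine ⟨‖g‖₊, fun x y => ?_⟩
  have e := norm_sub_le_of_hasDirDeriv hc hf h x y
  rw [edist_dist, edist_dist, dist_eq_norm, Real.dist_eq, ENNReal.ofReal_rpow_of_nonneg
    (abs_nonneg _) (by positivity), ← ENNReal.ofReal_coe_nnreal, coe_nnnorm,
    ← ENNReal.ofReal_mul (norm_nonneg _)]
  refine ENNReal.ofReal_le_ofReal ?_
  simpa using e

theorem norm_le_of_hasDirDeriv (hc : Continuous f) (hf : MemLp f 2 volume) {g : L2 ℝ}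
    (h : HasDirDeriv (1 : ℝ) (hf.toLp f) g) (x : ℝ) :
    ‖f x‖ ≤ (∫ y in x..(x + 1), ‖f y‖ ^ 2) + 1 + ‖g‖ := by
  have h1 : ∀ y ∈ Set.Icc x (x + 1), ‖f x‖ - ‖g‖ - 1 ≤ ‖f y‖ ^ 2 := by
    intro y hy
    have e := norm_sub_le_of_hasDirDeriv hc hf h x y
    have e2 : |x - y| ^ (1 / 2 : ℝ) ≤ 1 :=
      Real.rpow_le_one (abs_nonneg _) (by rw [abs_le]; constructor <;> linarith [hy.1, hy.2])
        (by norm_num)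
    have e3 := mul_le_mul_of_nonneg_left e2 (norm_nonneg g)
    have e4 := norm_sub_norm_le (f x) (f y)
    -- `‖f y‖ ≤ ‖f y‖² + 1`
    nlinarith [sq_nonneg (‖f y‖ - 1 / 2)]
  have h2 := intervalIntegral.integral_mono_on (by linarith)
    (intervalIntegrable_const (μ := volume))
    ((show Continuous fun y => ‖f y‖ ^ 2 by fun_prop).intervalIntegrable x (x + 1)) h1
  rw [intervalIntegral.integral_const, add_sub_cancel_left, one_smul] at h2
  linarith

theorem exists_norm_le_of_hasDirDeriv (hc : Continuous f) (hf : MemLp f 2 volume) {g : L2 ℝ}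
    (h : HasDirDeriv (1 : ℝ) (hf.toLp f) g) : ∃ C, ∀ x, ‖f x‖ ≤ C := by
  refine ⟨(∫ y, ‖f y‖ ^ 2) + 1 + ‖g‖, fun x => (norm_le_of_hasDirDeriv hc hf h x).trans ?_⟩
  gcongr
  rw [intervalIntegral.integral_of_le (by linarith)]
  exact setIntegral_le_integral ((memLp_two_iff_integrable_sq_norm hf.1).1 hf)
    (Eventually.of_forall fun y => by positivity)

theorem norm_le_eLpNorm_top (hc : Continuous f) (hb : ∃ C, ∀ x, ‖f x‖ ≤ C) (x : ℝ) :
    ‖f x‖ ≤ (eLpNorm f ⊤ volume).toReal := by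
  obtain ⟨C, hC⟩ := hb
  have hm : MemLp f ⊤ volume := memLp_top_of_bound hc.aestronglyMeasurable C
    (Eventually.of_forall hC)
  have hae : ∀ᵐ y, ‖f y‖ ≤ (eLpNorm f ⊤ volume).toReal := by
    filter_upwards [ae_le_eLpNormEssSup (f := f) (μ := volume)] with y hy
    rw [← eLpNorm_exponent_top] at hy
    have := (ENNReal.toReal_le_toReal (by simp) hm.2.ne).2 hy
    simpa using this
  have hcl : IsClosed {y | ‖f y‖ ≤ (eLpNorm f ⊤ volume).toReal} :=
    isClosed_le hc.norm continuous_const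
  have hd := Measure.dense_of_ae hae
  rw [Dense, hcl.closure_eq] at hd
  exact hd x

/-- The `C^{1/2}` norm controls the oscillation of the density. -/
theorem abs_norm_sq_sub_norm_sq_le (hc : Continuous f) (hb : ∃ C, ∀ x, ‖f x‖ ≤ C)
    (hh : MemHolder (1 / 2) f) (x y : ℝ) :
    |‖f x‖ ^ 2 - ‖f y‖ ^ 2| ≤ holderHalfNorm f ^ 2 * |x - y| ^ (1 / 2 : ℝ) := by
  have h1 := norm_le_eLpNorm_top hc hb x
  have h2 := norm_le_eLpNorm_top hc hb y
  have h3 : ‖f x - f y‖ ≤ (eHolderNorm (1 / 2) f).toReal * |x - y| ^ (1 / 2 : ℝ) := by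
    have := hh.holderWith.dist_le x y
    rw [dist_eq_norm, Real.dist_eq] at this
    simpa [nnHolderNorm, ENNReal.toReal] using this
  have h4 := (abs_norm_sub_norm_le (f x) (f y)).trans h3
  rw [sq_sub_sq, abs_mul, abs_of_nonneg (by positivity)]
  have h5 : ‖f x‖ + ‖f y‖ ≤ 2 * (eLpNorm f ⊤ volume).toReal := by linarith
  have hM : 0 ≤ (eLpNorm f ⊤ volume).toReal := ENNReal.toReal_nonneg
  have hS : 0 ≤ (eHolderNorm (1 / 2) f).toReal := ENNReal.toReal_nonneg
  have hr : 0 ≤ |x - y| ^ (1 / 2 : ℝ) := by positivity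
  refine (mul_le_mul h5 h4 (abs_nonneg _) (by positivity)).trans ?_
  rw [holderHalfNorm, ← mul_assoc]
  refine mul_le_mul_of_nonneg_right ?_ hr
  nlinarith [sq_nonneg (eLpNorm f ⊤ volume).toReal, sq_nonneg (eHolderNorm (1 / 2) f).toReal]

end Regularity

section H2

variable {φ : ℝ → ℂ}

theorem MemH2.memLp_grad (h : MemH2 φ) : MemLp (grad φ) 2 volume := weakDeriv_memLp h.deriv_one

theorem MemH2.memLp_lap (h : MemH2 φ) : MemLp (lap φ) 2 volume := weakDeriv_memLp h.deriv_two

theorem MemH2.hasDirDeriv_one (h : MemH2 φ) :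
    HasDirDeriv (1 : ℝ) (h.memLp.toLp φ) (h.memLp_grad.toLp (grad φ)) :=
  h.deriv_one.hasDirDeriv h.memLp

theorem MemH2.hasDirDeriv_two (h : MemH2 φ) :
    HasDirDeriv (1 : ℝ) (h.memLp_grad.toLp (grad φ))
      (h.memLp_lap.toLp (lap φ)) :=
  h.deriv_two.hasDirDeriv h.memLp_grad

theorem MemH2.l2Norm_grad (h : MemH2 φ) :
    l2Norm (grad φ) = ‖h.memLp_grad.toLp (grad φ)‖ :=
  l2Norm_eq_norm _

theorem MemH2.l2Norm_lap (h : MemH2 φ) :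
    l2Norm (lap φ) = ‖h.memLp_lap.toLp (lap φ)‖ :=
  l2Norm_eq_norm _

theorem MemH2.exists_norm_le (h : MemH2 φ) : ∃ C, ∀ x, ‖φ x‖ ≤ C :=
  exists_norm_le_of_hasDirDeriv h.continuous h.memLp h.hasDirDeriv_one

theorem MemH2.memHolder (h : MemH2 φ) : MemHolder (1 / 2) φ :=
  memHolder_of_hasDirDeriv h.continuous h.memLp h.hasDirDeriv_one

theorem h2Norm_sq (φ : ℝ → ℂ) :
    h2Norm φ ^ 2 = l2Norm φ ^ 2 + 2 * l2Norm (grad φ) ^ 2 + l2Norm (lap φ) ^ 2 :=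
  Real.sq_sqrt (by positivity)

/-- For a normalized function, the `H²` norm dominates `1 + ‖∇φ‖²` and `‖Δφ‖`, since
`‖∇φ‖² ≤ ‖Δφ‖`. -/
theorem MemH2.le_h2Norm (h : MemH2 φ) (h1 : l2Norm φ = 1) :
    1 + l2Norm (grad φ) ^ 2 ≤ h2Norm φ ∧ l2Norm (lap φ) ≤ h2Norm φ := by
  have e := h2Norm_sq φ
  have hn : ‖h.memLp.toLp φ‖ = 1 := by rw [← l2Norm_eq_norm, h1]
  have e1 := norm_sq_deriv_le h.hasDirDeriv_one h.hasDirDeriv_two hn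
  rw [← h.l2Norm_grad, ← h.l2Norm_lap] at e1
  rw [h1] at e
  have hl : 0 ≤ l2Norm (lap φ) := ENNReal.toReal_nonneg
  have h0 : 0 ≤ h2Norm φ := Real.sqrt_nonneg _
  constructor
  · refine abs_le_of_sq_le_sq' ?_ h0 |>.2
    nlinarith [sq_nonneg (l2Norm (grad φ))]
  · refine abs_le_of_sq_le_sq' ?_ h0 |>.2
    nlinarith [sq_nonneg (l2Norm (grad φ))]

end H2

/-! ### The rescaled potential -/

section Scaling

variable {V : ℝ → ℝ}

theorem IsShortRange.exists_norm_scaled_le (hV : IsShortRange V) (ε : ℝ) :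
    ∃ M, ∀ x, ‖scaled V ε x‖ ≤ M := by
  obtain ⟨M, hM⟩ := hV.bounded
  refine ⟨‖ε⁻¹‖ * M, fun x => ?_⟩
  rw [scaled, norm_mul, Real.norm_of_nonneg (hV.nonneg _)]
  exact mul_le_mul_of_nonneg_left (hM _) (norm_nonneg _)

theorem IsShortRange.continuous_scaled (hV : IsShortRange V) (ε : ℝ) :
    Continuous (scaled V ε) :=
  continuous_const.mul (hV.continuous.comp (continuous_const.mul continuous_id))

/-- The rescaled potential as a bounded continuous function. -/
def IsShortRange.scaledPot (hV : IsShortRange V) (ε : ℝ) : ℝ →ᵇ ℝ :=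
  BoundedContinuousFunction.ofNormedAddCommGroup (scaled V ε) (hV.continuous_scaled ε)
    (hV.exists_norm_scaled_le ε).choose (hV.exists_norm_scaled_le ε).choose_spec

theorem IsShortRange.scaledPot_apply (hV : IsShortRange V) (ε x : ℝ) :
    hV.scaledPot ε x = ε⁻¹ * V (ε⁻¹ * x) := rfl

theorem IsShortRange.scaledPot_neg (hV : IsShortRange V) (ε x : ℝ) :
    hV.scaledPot ε (-x) = hV.scaledPot ε x := by
  rw [hV.scaledPot_apply, hV.scaledPot_apply, mul_neg, hV.even]

theorem IsShortRange.isUnitPotential (hV : IsShortRange V) {ε : ℝ} (hε : 0 < ε) :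
    IsUnitPotential (hV.scaledPot ε) where
  nonneg x := mul_nonneg (inv_nonneg.2 hε.le) (hV.nonneg _)
  integrable := (hV.integrable.comp_mul_left' (inv_ne_zero hε.ne')).const_mul _
  integral_eq_one := by
    simp only [hV.scaledPot_apply]
    rw [integral_const_mul, Measure.integral_comp_mul_left, hV.integral_eq_one, inv_inv,
      abs_of_pos hε, smul_eq_mul, mul_one, inv_mul_cancel₀ hε.ne']

theorem IsShortRange.rpow_mul_scaledPot (hV : IsShortRange V) {ε : ℝ} (hε : 0 < ε) (x : ℝ) :
    |x| ^ (1 / 2 : ℝ) * hV.scaledPot ε x =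
      ε ^ (1 / 2 : ℝ) * (ε⁻¹ * (|ε⁻¹ * x| ^ (1 / 2 : ℝ) * V (ε⁻¹ * x))) := by
  have e : |x| ^ (1 / 2 : ℝ) = ε ^ (1 / 2 : ℝ) * |ε⁻¹ * x| ^ (1 / 2 : ℝ) := by
    rw [← Real.mul_rpow hε.le (abs_nonneg _), abs_mul, abs_of_pos (inv_pos.2 hε),
      mul_inv_cancel_left₀ hε.ne']
  rw [hV.scaledPot_apply, e]
  ring

theorem IsShortRange.integrable_rpow_mul_scaledPot (hV : IsShortRange V) {ε : ℝ} (hε : 0 < ε) :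
    Integrable fun x => |x| ^ (1 / 2 : ℝ) * hV.scaledPot ε x := by
  simp only [hV.rpow_mul_scaledPot hε]
  exact ((hV.moment.comp_mul_left' (inv_ne_zero hε.ne')).const_mul _).const_mul _

theorem IsShortRange.integral_rpow_mul_scaledPot (hV : IsShortRange V) {ε : ℝ} (hε : 0 < ε) :
    ∫ x, |x| ^ (1 / 2 : ℝ) * hV.scaledPot ε x =
      ε ^ (1 / 2 : ℝ) * ∫ x, |x| ^ (1 / 2 : ℝ) * V x := by
  simp only [hV.rpow_mul_scaledPot hε]
  rw [integral_const_mul, integral_const_mul,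
    Measure.integral_comp_mul_left (fun x => |x| ^ (1 / 2 : ℝ) * V x), inv_inv, abs_of_pos hε,
    smul_eq_mul, inv_mul_cancel_left₀ hε.ne']

/-- The potential is an approximate identity: its mean field is close to the density. -/
theorem IsShortRange.abs_meanField_sub_le (hV : IsShortRange V) {ε : ℝ} (hε : 0 < ε)
    {φ : ℝ → ℂ} (hc : Continuous φ) (hφ : MemLp φ 2 volume) (hb : ∃ C, ∀ x, ‖φ x‖ ≤ C)
    (hh : MemHolder (1 / 2) φ) (z : ℝ) :
    |meanField (hV.scaledPot ε) (hφ.toLp φ) z - ‖φ z‖ ^ 2| ≤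
      (∫ x, |x| ^ (1 / 2 : ℝ) * V x) * (ε ^ (1 / 2 : ℝ) * holderHalfNorm φ ^ 2) := by
  have hu := hV.isUnitPotential hε
  have e1 : meanField (hV.scaledPot ε) (hφ.toLp φ) z =
      ∫ y, hV.scaledPot ε (y - z) * ‖φ y‖ ^ 2 := by
    refine integral_congr_ae ?_
    filter_upwards [hφ.coeFn_toLp] with y hy
    rw [hy]
  have e2 : ‖φ z‖ ^ 2 = ∫ y, hV.scaledPot ε (y - z) * ‖φ z‖ ^ 2 := by
    rw [integral_mul_const, integral_sub_right_eq_self (fun y => hV.scaledPot ε y),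
      hu.integral_eq_one, one_mul]
  have i1 : Integrable fun y => hV.scaledPot ε (y - z) * ‖φ y‖ ^ 2 := by
    refine (integrable_mul_norm_sq ((hV.scaledPot ε).compContinuous
      ⟨fun y => y - z, by fun_prop⟩) (hφ.toLp φ)).congr ?_
    filter_upwards [hφ.coeFn_toLp] with y hy
    rw [hy]
    rfl
  have i2 : Integrable fun y => hV.scaledPot ε (y - z) * ‖φ z‖ ^ 2 :=
    (hu.integrable.comp_sub_right z).mul_const _
  have i3 := ((hV.integrable_rpow_mul_scaledPot hε).comp_sub_right z).const_mul
    (holderHalfNorm φ ^ 2)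
  rw [e1, e2, ← integral_sub i1 i2, ← Real.norm_eq_abs]
  refine (norm_integral_le_of_norm_le i3 (Eventually.of_forall fun y => ?_)).trans_eq ?_
  · rw [← mul_sub, norm_mul, Real.norm_of_nonneg (hu.nonneg _), Real.norm_eq_abs]
    refine (mul_le_mul_of_nonneg_left (abs_norm_sq_sub_norm_sq_le hc hb hh y z)
      (hu.nonneg _)).trans_eq ?_
    ring
  · rw [integral_const_mul, integral_sub_right_eq_self
      (fun y => |y| ^ (1 / 2 : ℝ) * hV.scaledPot ε y), hV.integral_rpow_mul_scaledPot hε]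
    ring

/-- The self-energy is close to the quartic term of the NLS energy. -/
theorem IsShortRange.abs_selfEnergy_sub_le (hV : IsShortRange V) {ε : ℝ} (hε : 0 < ε)
    {φ : ℝ → ℂ} (h : MemH2 φ) (h1 : l2Norm φ = 1) :
    |selfEnergy (hV.scaledPot ε) (h.memLp.toLp φ) - ∫ x, ‖φ x‖ ^ 4| ≤
      (∫ x, |x| ^ (1 / 2 : ℝ) * V x) * (ε ^ (1 / 2 : ℝ) * holderHalfNorm φ ^ 2) := by
  have hn := h1
  rw [l2Norm_eq_norm h.memLp] at hn
  have e1 : selfEnergy (hV.scaledPot ε) (h.memLp.toLp φ) =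
      ∫ z, meanField (hV.scaledPot ε) (h.memLp.toLp φ) z * ‖φ z‖ ^ 2 := by
    refine integral_congr_ae ?_
    filter_upwards [h.memLp.coeFn_toLp] with y hy
    rw [hy]
  have i0 : Integrable fun z => ‖φ z‖ ^ 2 := (memLp_two_iff_integrable_sq_norm h.memLp.1).1 h.memLp
  have i1 : Integrable fun z => meanField (hV.scaledPot ε) (h.memLp.toLp φ) z * ‖φ z‖ ^ 2 := by
    refine (integrable_mul_norm_sq (meanField (hV.scaledPot ε) (h.memLp.toLp φ))
      (h.memLp.toLp φ)).congr ?_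
    filter_upwards [h.memLp.coeFn_toLp] with y hy
    rw [hy]
  have i2 : Integrable fun z => ‖φ z‖ ^ 4 := by
    obtain ⟨C, hC⟩ := h.exists_norm_le
    refine (i0.const_mul (C ^ 2)).mono' (h.memLp.1.norm.pow 4) (Eventually.of_forall fun z => ?_)
    have := pow_le_pow_left₀ (norm_nonneg _) (hC z) 2
    rw [Real.norm_of_nonneg (by positivity)]
    nlinarith [sq_nonneg ‖φ z‖]
  rw [e1, ← integral_sub i1 i2, ← Real.norm_eq_abs]
  have hsq : ∫ z, ‖φ z‖ ^ 2 = 1 := by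
    rw [← one_pow 2, ← hn, ← integral_norm_sq]
    refine integral_congr_ae ?_
    filter_upwards [h.memLp.coeFn_toLp] with y hy
    rw [hy]
  refine (norm_integral_le_of_norm_le (i0.const_mul ((∫ x, |x| ^ (1 / 2 : ℝ) * V x) *
    (ε ^ (1 / 2 : ℝ) * holderHalfNorm φ ^ 2))) (Eventually.of_forall fun z => ?_)).trans_eq
    (by rw [integral_const_mul, hsq, mul_one])
  rw [show ‖φ z‖ ^ 4 = ‖φ z‖ ^ 2 * ‖φ z‖ ^ 2 by ring, ← sub_mul, norm_mul,
    Real.norm_of_nonneg (sq_nonneg ‖φ z‖), Real.norm_eq_abs]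
  exact mul_le_mul_of_nonneg_right (hV.abs_meanField_sub_le hε h.continuous h.memLp
    h.exists_norm_le h.memHolder z) (sq_nonneg _)

end Scaling

/-! ### Conservation of the `L²` norm -/

section MassOneParticle

theorem hasDerivAt_inner_self_zero {H : Type*} [NormedAddCommGroup H] [InnerProductSpace ℂ H]
    {u : ℝ → H} {w : H} {t : ℝ} (hu : HasDerivAt u (Complex.I • w) t)
    (hw : inner ℂ (u t) w = inner ℂ w (u t)) :
    HasDerivAt (fun s => inner ℂ (u s) (u s)) (0 : ℂ) t := by
  have h := hu.inner ℂ hu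
  rwa [inner_smul_right, inner_smul_left, Complex.conj_I, hw, neg_mul, add_neg_cancel] at h

/-- The nonlinear potential `κ |φ|²` as a bounded continuous function. -/
def MemH2.nonlinearPot {φ : ℝ → ℂ} (h : MemH2 φ) (κ : ℝ) : ℝ →ᵇ ℝ :=
  BoundedContinuousFunction.ofNormedAddCommGroup (fun x => κ * ‖φ x‖ ^ 2)
    (continuous_const.mul (h.continuous.norm.pow 2)) (‖κ‖ * h.exists_norm_le.choose ^ 2)
    fun x => by
      rw [norm_mul, norm_pow, norm_norm]
      exact mul_le_mul_of_nonneg_left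
        (pow_le_pow_left₀ (norm_nonneg _) (h.exists_norm_le.choose_spec x) 2) (norm_nonneg _)

variable {κ : ℝ} {φ : ℝ → ℝ → ℂ}

/-- In `L²`, the nonlinear equation reads `∂ₜ φ = i (Δ φ - κ |φ|² φ)`. -/
theorem IsNLSSolution.hasDerivAt (h : IsNLSSolution κ φ) (t : ℝ) :
    HasDerivAt (fun s => (h.memH2 s).memLp.toLp (φ s))
      (Complex.I • ((h.memH2 t).memLp_lap.toLp (lap (φ t)) -
        mulOp ((h.memH2 t).nonlinearPot κ) ((h.memH2 t).memLp.toLp (φ t)))) t := by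
  rw [hasDerivAt_iff_tendsto_slope, tendsto_iff_norm_sub_tendsto_zero]
  refine (h.equation t).congr fun s => ?_
  rw [mulOp_toLp, ← MemLp.toLp_sub, ← MemLp.toLp_const_smul, slope_def_module, ← MemLp.toLp_sub,
    ← MemLp.toLp_const_smul, ← MemLp.toLp_sub, ← l2Norm_eq_norm]
  congr 1
  funext x
  simp only [Pi.sub_apply, Pi.smul_apply, smul_eq_mul, div_eq_inv_mul, Complex.real_smul,
    Complex.ofReal_inv]
  rfl

theorem IsNLSSolution.l2Norm_eq_one (h : IsNLSSolution κ φ) (h0 : l2Norm (φ 0) = 1) (t : ℝ) :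
    l2Norm (φ t) = 1 := by
  have hd : ∀ t, HasDerivAt (fun s => inner ℂ ((h.memH2 s).memLp.toLp (φ s))
      ((h.memH2 s).memLp.toLp (φ s))) (0 : ℂ) t := by
    intro t
    refine hasDerivAt_inner_self_zero (h.hasDerivAt t) ?_
    have e1 := (h.memH2 t).hasDirDeriv_one.inner_add_inner (h.memH2 t).hasDirDeriv_two
    have e2 := (h.memH2 t).hasDirDeriv_two.inner_add_inner (h.memH2 t).hasDirDeriv_one
    rw [inner_sub_left, inner_sub_right, inner_mulOp_right]
    linear_combination e1 - e2
  have hc := is_const_of_deriv_eq_zero (fun t => (hd t).differentiableAt) (fun t => (hd t).deriv)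
    t 0
  simp only [inner_self_eq_norm_sq_to_K] at hc
  rw [l2Norm_eq_norm (h.memH2 0).memLp] at h0
  rw [l2Norm_eq_norm (h.memH2 t).memLp]
  rw [h0] at hc
  refine (pow_eq_one_iff_of_nonneg (norm_nonneg _) two_ne_zero).1 (Complex.ofReal_injective ?_)
  rw [Complex.ofReal_pow]
  exact hc.trans (by simp)

end MassOneParticle

section MassManyBody

/-- If a curve `U` solves an evolution equation only weakly, its norm is still conserved
provided that `‖U s - U t‖² = o(s - t)`. -/
theorem hasDerivAt_norm_sq_zero {H : Type*} [NormedAddCommGroup H] [InnerProductSpace ℂ H]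
    {U : ℝ → H} {t : ℝ} {w : ℂ} (hw : w.re = 0)
    (hU : HasDerivAt (fun s => inner ℂ (U t) (U s)) w t) {h : ℝ → ℝ}
    (hh : Tendsto h (𝓝 t) (𝓝 0)) (hUh : ∀ᶠ s in 𝓝 t, ‖U s - U t‖ ^ 2 ≤ h s * |s - t|) :
    HasDerivAt (fun s => ‖U s‖ ^ 2) 0 t := by
  have e : ∀ s, ‖U s‖ ^ 2 = ‖U t‖ ^ 2 + 2 * ((inner ℂ (U t) (U s)).re - ‖U t‖ ^ 2) +
      ‖U s - U t‖ ^ 2 := by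
    intro s
    have h1 := norm_sub_sq (𝕜 := ℂ) (U s) (U t)
    rw [inner_re_symm, RCLike.re_eq_complex_re] at h1
    linarith
  have h1 : HasDerivAt (fun s => (inner ℂ (U t) (U s)).re) 0 t := by
    have := Complex.reCLM.hasFDerivAt.comp_hasDerivAt t hU
    rwa [Complex.reCLM_apply, hw] at this
  have h2 : HasDerivAt (fun s => ‖U s - U t‖ ^ 2) 0 t := by
    rw [hasDerivAt_iff_isLittleO]
    simp only [sub_self, norm_zero, ne_eq, OfNat.ofNat_ne_zero, not_false_eq_true, zero_pow,
      sub_zero, smul_zero]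
    rw [Asymptotics.isLittleO_iff]
    intro c hc
    filter_upwards [hUh, hh.eventually_le_const hc] with s hs1 hs2
    rw [Real.norm_of_nonneg (sq_nonneg _), Real.norm_eq_abs]
    exact hs1.trans (mul_le_mul_of_nonneg_right hs2 (abs_nonneg _))
  have h3 := (((h1.sub_const (‖U t‖ ^ 2)).const_mul 2).const_add (‖U t‖ ^ 2)).add h2
  rw [mul_zero, add_zero] at h3
  exact h3.congr_of_eventuallyEq (Eventually.of_forall e)

variable {N : ℕ} {f g : (Fin N → ℝ) → ℂ}

/-- The class in `L²` of the derivative of an `H¹` function in the `i`-th variable. -/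
def MemH1.gradL2 (h : MemH1 f) (i : Fin N) : ManyBody N :=
  (weakDeriv_memLp (h.deriv i)).toLp (partialGrad i f)

theorem MemH1.hasDirDeriv (h : MemH1 f) (i : Fin N) :
    HasDirDeriv (Pi.single i (1 : ℝ)) (h.memLp.toLp f) (h.gradL2 i) :=
  (h.deriv i).hasDirDeriv h.memLp

theorem MemH1.sub (hf : MemH1 f) (hg : MemH1 g) : MemH1 (f - g) where
  memLp := hf.memLp.sub hg.memLp
  deriv i := HasDirDeriv.hasL2Deriv (hf.memLp.sub hg.memLp)
    (g := hf.gradL2 i - hg.gradL2 i) (by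
      rw [MemLp.toLp_sub hf.memLp hg.memLp]
      exact (hf.hasDirDeriv i).sub (hg.hasDirDeriv i))

theorem MemH1.gradL2_sub (hf : MemH1 f) (hg : MemH1 g) (i : Fin N) :
    (hf.sub hg).gradL2 i = hf.gradL2 i - hg.gradL2 i := by
  refine ((hf.sub hg).hasDirDeriv i).unique ?_
  rw [MemLp.toLp_sub hf.memLp hg.memLp]
  exact (hf.hasDirDeriv i).sub (hg.hasDirDeriv i)

theorem MemH1.norm_toLp_le (h : MemH1 f) : ‖h.memLp.toLp f‖ ≤ h1Norm f := by
  rw [← l2Norm_eq_norm]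
  refine Real.le_sqrt_of_sq_le ?_
  have : 0 ≤ ∑ i, l2Norm (partialGrad i f) ^ 2 := Finset.sum_nonneg fun i _ => sq_nonneg _
  linarith

theorem MemH1.norm_gradL2_le (h : MemH1 f) (i : Fin N) : ‖h.gradL2 i‖ ≤ h1Norm f := by
  have e : ‖h.gradL2 i‖ = l2Norm (partialGrad i f) := (l2Norm_eq_norm _).symm
  rw [e]
  refine Real.le_sqrt_of_sq_le ?_
  have : l2Norm (partialGrad i f) ^ 2 ≤ ∑ i, l2Norm (partialGrad i f) ^ 2 :=
    Finset.single_le_sum (f := fun i => l2Norm (partialGrad i f) ^ 2) (fun i _ => sq_nonneg _)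
      (Finset.mem_univ i)
  nlinarith [sq_nonneg (l2Norm f)]

variable {V : ℝ → ℝ} {κ ε : ℝ}

/-- The form of the Hamiltonian in terms of bounded operators and derivatives in `L²`. -/
theorem IsShortRange.hamForm_eq (hV : IsShortRange V) (hf : MemH1 f) (hg : MemH1 g) :
    hamForm κ V ε f g = ∑ i, inner ℂ (hf.gradL2 i) (hg.gradL2 i) +
      ((κ / N : ℝ) : ℂ) * ∑ i, ∑ j ∈ Finset.Ioi i, inner ℂ (hf.memLp.toLp f)
        (mulOp (pairPot (hV.scaledPot ε) i j) (hg.memLp.toLp g)) := by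
  unfold hamForm
  congr 1
  · exact Finset.sum_congr rfl fun i _ => l2Inner_eq_inner _ _
  · congr 1
    refine Finset.sum_congr rfl fun i _ => Finset.sum_congr rfl fun j _ => ?_
    rw [mulOp_toLp, ← l2Inner_eq_inner]
    rfl

theorem IsShortRange.hamForm_self_im (hV : IsShortRange V) (hf : MemH1 f) :
    (hamForm κ V ε f f).im = 0 := by
  rw [hV.hamForm_eq hf hf, Complex.add_im, Complex.im_ofReal_mul, Complex.im_sum, Complex.im_sum]
  simp only [Complex.im_sum, inner_mulOp_self, Complex.ofReal_im, Finset.sum_const_zero,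
    mul_zero, add_zero]
  exact Finset.sum_eq_zero fun i _ => inner_self_im (𝕜 := ℂ) _

theorem IsShortRange.exists_norm_hamForm_le (hV : IsShortRange V) (N : ℕ) (κ ε : ℝ) :
    ∃ C, 0 ≤ C ∧ ∀ (f g : (Fin N → ℝ) → ℂ) (hf : MemH1 f) (hg : MemH1 g) (a b : ℝ), 0 ≤ a →
      ‖hf.memLp.toLp f‖ ≤ a → (∀ i, ‖hf.gradL2 i‖ ≤ a) → ‖hg.memLp.toLp g‖ ≤ b →
      (∀ i, ‖hg.gradL2 i‖ ≤ b) → ‖hamForm κ V ε f g‖ ≤ C * (a * b) := by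
  refine ⟨∑ i : Fin N, 1 + ‖((κ / N : ℝ) : ℂ)‖ * ∑ i : Fin N, ∑ j ∈ Finset.Ioi i,
    ‖mulOp (pairPot (hV.scaledPot ε) i j)‖, by positivity, ?_⟩
  intro f g hf hg a b ha h1 h2 h3 h4
  rw [hV.hamForm_eq hf hg, add_mul, mul_assoc, Finset.sum_mul, Finset.sum_mul]
  refine (norm_add_le _ _).trans (add_le_add ?_ ?_)
  · refine norm_sum_le_of_le _ fun i _ => ?_
    rw [one_mul]
    exact (norm_inner_le_norm _ _).trans (mul_le_mul (h2 i) (h4 i) (norm_nonneg _) ha)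
  · rw [norm_mul]
    refine mul_le_mul_of_nonneg_left (norm_sum_le_of_le _ fun i _ => ?_) (norm_nonneg _)
    rw [Finset.sum_mul]
    refine norm_sum_le_of_le _ fun j _ => (norm_inner_le_norm _ _).trans ?_
    rw [mul_left_comm]
    refine mul_le_mul h1 ?_ (norm_nonneg _) ha
    exact (ContinuousLinearMap.le_opNorm _ _).trans
      (mul_le_mul_of_nonneg_left h3 (norm_nonneg _))

variable {Φ : ℝ → (Fin N → ℝ) → ℂ}

/-- A finite-energy solution satisfies `‖Φ s - Φ t‖² = o(s - t)` in `L²`: test the equation with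
`Φ s - Φ t`, which tends to zero in `H¹`. -/
theorem IsRegSchrodingerSolution.exists_norm_sub_sq_le (hV : IsShortRange V)
    (h : IsRegSchrodingerSolution κ V ε Φ) (t : ℝ) :
    ∃ K, ∀ᶠ s in 𝓝 t, ‖(h.memH1 s).memLp.toLp (Φ s) - (h.memH1 t).memLp.toLp (Φ t)‖ ^ 2 ≤
      K * h1Norm (Φ s - Φ t) * |s - t| := by
  obtain ⟨C, hC0, hC⟩ := hV.exists_norm_hamForm_le N κ ε
  have hnear := (h.continuous t).eventually_le_const one_pos
  obtain ⟨δ, hδ, hball⟩ := Metric.eventually_nhds_iff_ball.1 hnear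
  refine ⟨C * (h1Norm (Φ t) + 1), ?_⟩
  filter_upwards [Metric.ball_mem_nhds t hδ] with s hs
  have hd := (h.memH1 s).sub (h.memH1 t)
  -- mean value inequality between `t` and `s` for the fixed test function `Φ s - Φ t`
  have hmv := (convex_ball t δ).norm_image_sub_le_of_norm_hasDerivWithin_le
    (f := fun r => l2Inner (Φ s - Φ t) (Φ r))
    (C := C * (h1Norm (Φ s - Φ t) * (h1Norm (Φ t) + 1)))
    (fun r _ => (h.equation _ hd r).hasDerivWithinAt) (fun r hr => ?_)
    (Metric.mem_ball_self hδ) hs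
  · simp only [l2Inner_eq_inner hd.memLp (h.memH1 _).memLp] at hmv
    rw [← inner_sub_right, MemLp.toLp_sub (h.memH1 s).memLp (h.memH1 t).memLp,
      inner_self_eq_norm_sq_to_K, Real.norm_eq_abs] at hmv
    refine le_trans (le_of_eq ?_) (hmv.trans_eq (by ring))
    simp
  · rw [norm_mul, norm_neg, Complex.norm_I, one_mul]
    have hr' := (h.memH1 r).sub (h.memH1 t)
    have hle := hball r hr
    refine hC _ _ hd (h.memH1 r) _ _ (Real.sqrt_nonneg _) hd.norm_toLp_le hd.norm_gradL2_le ?_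
      fun i => ?_
    · have e1 := hr'.norm_toLp_le
      rw [MemLp.toLp_sub (h.memH1 r).memLp (h.memH1 t).memLp] at e1
      have e2 := norm_le_norm_add_norm_sub' ((h.memH1 r).memLp.toLp (Φ r))
        ((h.memH1 t).memLp.toLp (Φ t))
      have e3 := (h.memH1 t).norm_toLp_le
      linarith
    · have e1 := hr'.norm_gradL2_le i
      rw [(h.memH1 r).gradL2_sub (h.memH1 t)] at e1
      have e2 := norm_le_norm_add_norm_sub' ((h.memH1 r).gradL2 i) ((h.memH1 t).gradL2 i)
      have e3 := (h.memH1 t).norm_gradL2_le i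
      linarith

theorem IsRegSchrodingerSolution.l2Norm_eq_one (hV : IsShortRange V)
    (h : IsRegSchrodingerSolution κ V ε Φ) (h0 : l2Norm (Φ 0) = 1) (t : ℝ) :
    l2Norm (Φ t) = 1 := by
  have hd : ∀ t, HasDerivAt (fun s => ‖(h.memH1 s).memLp.toLp (Φ s)‖ ^ 2) 0 t := by
    intro t
    obtain ⟨K, hK⟩ := h.exists_norm_sub_sq_le hV t
    have e := h.equation (Φ t) (h.memH1 t) t
    simp only [l2Inner_eq_inner (h.memH1 t).memLp (h.memH1 _).memLp] at e
    refine hasDerivAt_norm_sq_zero ?_ e (h := fun s => K * h1Norm (Φ s - Φ t)) ?_ hK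
    · simp [hV.hamForm_self_im (h.memH1 t)]
    · simpa using (h.continuous t).const_mul K
  have hc := is_const_of_deriv_eq_zero (fun t => (hd t).differentiableAt) (fun t => (hd t).deriv)
    t 0
  rw [← l2Norm_eq_norm, ← l2Norm_eq_norm, h0, one_pow] at hc
  have hn : 0 ≤ l2Norm (Φ t) := ENNReal.toReal_nonneg
  exact (pow_eq_one_iff_of_nonneg hn two_ne_zero).1 hc

end MassManyBody

/-! ### The counting functional and the energy per particle in terms of operators on `L²` -/

section Bridge

variable {N : ℕ} {φ : ℝ → ℂ} {Φ : (Fin N → ℝ) → ℂ}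

theorem IsBosonic.permute_eq (h : IsBosonic Φ) (hΦ : MemLp Φ 2 volume)
    (σ : Equiv.Perm (Fin N)) : permute σ (hΦ.toLp Φ) = hΦ.toLp Φ := by
  rw [permute_toLp, MemLp.toLp_eq_toLp_iff]
  exact h σ

theorem memLp_pOp (hφ : MemLp φ 2 volume) (j : Fin N) (hΦ : MemLp Φ 2 volume) :
    MemLp (pOp φ j Φ) 2 volume := memLp_rankOne j hφ hφ hΦ

theorem memLp_qOp (hφ : MemLp φ 2 volume) (j : Fin N) (hΦ : MemLp Φ 2 volume) :
    MemLp (qOp φ j Φ) 2 volume := hΦ.sub (memLp_pOp hφ j hΦ)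

theorem toLp_pOp (hφ : MemLp φ 2 volume) (j : Fin N) (hΦ : MemLp Φ 2 volume) :
    (memLp_pOp hφ j hΦ).toLp _ = condensate (hφ.toLp φ) j (hΦ.toLp Φ) :=
  (ketbra_toLp j hφ hφ hΦ).symm

theorem toLp_qOp (hφ : MemLp φ 2 volume) (j : Fin N) (hΦ : MemLp Φ 2 volume) :
    (memLp_qOp hφ j hΦ).toLp _ = hΦ.toLp Φ - condensate (hφ.toLp φ) j (hΦ.toLp Φ) := by
  rw [← toLp_pOp]
  exact MemLp.toLp_sub hΦ (memLp_pOp hφ j hΦ)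

/-- Partial products of the projectors, defined on representatives, agree in `L²` with the partial
products of bounded operators. -/
theorem exists_toLp_foldr (hφ : MemLp φ 2 volume) (hΦ : MemLp Φ 2 volume) (S : Finset (Fin N))
    (L : List (Fin N)) :
    ∃ h : MemLp (L.foldr (fun j Ψ => if j ∈ S then qOp φ j Ψ else pOp φ j Ψ) Φ) 2 volume,
      h.toLp _ = listSector (condensate (hφ.toLp φ)) S L (hΦ.toLp Φ) := by
  induction L with
  | nil => exact ⟨hΦ, by simp [listSector]⟩
  | cons j L ih =>
    obtain ⟨h, e⟩ := ih
    rw [List.foldr_cons, listSector_cons, ← e]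
    by_cases hj : j ∈ S
    · simp only [if_pos hj]
      exact ⟨memLp_qOp hφ j h, toLp_qOp hφ j h⟩
    · simp only [if_neg hj]
      exact ⟨memLp_pOp hφ j h, toLp_pOp hφ j h⟩

theorem memLp_prodOp (hφ : MemLp φ 2 volume) (hΦ : MemLp Φ 2 volume) (S : Finset (Fin N)) :
    MemLp (prodOp φ S Φ) 2 volume := (exists_toLp_foldr hφ hΦ S _).choose

theorem toLp_prodOp (hφ : MemLp φ 2 volume) (hΦ : MemLp Φ 2 volume) (S : Finset (Fin N)) :
    (memLp_prodOp hφ hΦ S).toLp _ = sector (condensate (hφ.toLp φ)) S (hΦ.toLp Φ) :=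
  (exists_toLp_foldr hφ hΦ S _).choose_spec

theorem l2Inner_sum {ι : Type*} (s : Finset ι) {f : ι → (Fin N → ℝ) → ℂ}
    (hΦ : MemLp Φ 2 volume) (hf : ∀ i, MemLp (f i) 2 volume) :
    l2Inner Φ (∑ i ∈ s, f i) = ∑ i ∈ s, l2Inner Φ (f i) := by
  simp only [l2Inner, Finset.sum_apply, Finset.mul_sum]
  refine integral_finsetSum _ fun i _ => ?_
  have := L2.integrable_inner (𝕜 := ℂ) (hΦ.toLp Φ) ((hf i).toLp (f i))
  refine this.congr ?_
  filter_upwards [hΦ.coeFn_toLp, (hf i).coeFn_toLp] with x h1 h2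
  simp [h1, h2, mul_comm]

theorem l2Inner_smul (c : ℂ) (f : (Fin N → ℝ) → ℂ) : l2Inner Φ (c • f) = c * l2Inner Φ f := by
  simp only [l2Inner, Pi.smul_apply, smul_eq_mul, mul_left_comm _ c, integral_const_mul]

/-- The counting functional is the excitation of the wave function out of the condensate. -/
theorem beta_eq_excitation (hφ : MemLp φ 2 volume) (h1 : l2Norm φ = 1)
    (hΦ : MemLp Φ 2 volume) :
    beta Φ φ = excitation (condensate (hφ.toLp φ)) (hΦ.toLp Φ) := by
  rw [l2Norm_eq_norm hφ] at h1
  have hP := commutingProjections_condensate (N := N) h1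
  have hs : ∀ S, l2Inner Φ (prodOp φ S Φ) =
      ((‖sector (condensate (hφ.toLp φ)) S (hΦ.toLp Φ)‖ ^ 2 : ℝ) : ℂ) := by
    intro S
    rw [l2Inner_eq_inner hΦ (memLp_prodOp hφ hΦ S), toLp_prodOp hφ hΦ, hP.inner_sector_self]
  have hk : ∀ k, MemLp (kOp φ k Φ) 2 volume := fun k =>
    memLp_finsetSum' _ fun S _ => memLp_prodOp hφ hΦ S
  rw [beta, hatOp, l2Inner_sum _ hΦ fun k => (hk k).const_smul _, Complex.re_sum, excitation,
    ← Finset.powerset_univ, Finset.sum_powerset, Finset.card_univ, Fintype.card_fin]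
  refine Finset.sum_congr rfl fun k _ => ?_
  rw [l2Inner_smul, Complex.re_ofReal_mul, kOp, l2Inner_sum _ hΦ fun S => memLp_prodOp hφ hΦ S,
    Complex.re_sum, Finset.mul_sum]
  refine Finset.sum_congr rfl fun S hS => ?_
  rw [hs, Complex.ofReal_re, (Finset.mem_powersetCard.1 hS).2, weight]

theorem exists_perm_apply_eq {i j k l : Fin N} (hij : i ≠ j) (hkl : k ≠ l) :
    ∃ σ : Equiv.Perm (Fin N), σ i = k ∧ σ j = l := by
  have hne : k ≠ Equiv.swap i k j := by
    intro h
    have := congrArg (Equiv.swap i k) h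
    rw [Equiv.swap_apply_self, Equiv.swap_apply_right] at this
    exact hij this
  refine ⟨Equiv.swap i k |>.trans (Equiv.swap (Equiv.swap i k j) l), ?_, ?_⟩
  · rw [Equiv.trans_apply, Equiv.swap_apply_left, Equiv.swap_apply_of_ne_of_ne hne hkl]
  · rw [Equiv.trans_apply, Equiv.swap_apply_left]

theorem sum_card_Ioi (N : ℕ) : (∑ i : Fin N, ((Finset.Ioi i).card : ℝ)) = N * (N - 1) / 2 := by
  have h : ∑ i : Fin N, (Finset.Ioi i).card = ∑ i ∈ Finset.range N, i := by
    rw [← Finset.sum_range_reflect, ← Fin.sum_univ_eq_sum_range (fun i => N - 1 - i) N]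
    exact Finset.sum_congr rfl fun i _ => Fin.card_Ioi i
  have h2 := Finset.sum_range_id_mul_two N
  rw [← h] at h2
  have h3 : ((∑ i : Fin N, (Finset.Ioi i).card : ℕ) : ℝ) * 2 = N * (N - 1) := by
    rcases N with _ | N
    · simp
    · have := congrArg (Nat.cast (R := ℝ)) h2
      push_cast at this ⊢
      simpa using this
  push_cast at h3
  linarith

variable {V : ℝ → ℝ} {κ ε : ℝ}

theorem norm_gradL2_eq (h : MemH1 Φ) (hs : IsBosonic Φ) (i j : Fin N) :
    ‖h.gradL2 j‖ = ‖h.gradL2 i‖ := by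
  have e := (h.hasDirDeriv i).permute (Equiv.swap i j)
  rw [hs.permute_eq, Equiv.swap_apply_left] at e
  rw [(h.hasDirDeriv j).unique e, LinearIsometry.norm_map]

theorem norm_pairRoot_eq {v : ℝ →ᵇ ℝ} {Ψ : ManyBody N} (hs : ∀ σ, permute σ Ψ = Ψ)
    {i j k l : Fin N} (hij : i ≠ j) (hkl : k ≠ l) :
    ‖pairRoot v k l Ψ‖ = ‖pairRoot v i j Ψ‖ := by
  obtain ⟨σ, rfl, rfl⟩ := exists_perm_apply_eq hij hkl
  rw [← LinearIsometry.norm_map (permute σ) (pairRoot v i j Ψ), permute_pairRoot, hs]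

theorem IsShortRange.regEnergy_eq_sum (hV : IsShortRange V) (hε : 0 < ε) (h : MemH1 Φ) :
    regEnergy κ V ε Φ = (1 / N : ℝ) * (∑ i, ‖h.gradL2 i‖ ^ 2 + κ / N *
      ∑ i, ∑ j ∈ Finset.Ioi i, ‖pairRoot (hV.scaledPot ε) i j (h.memLp.toLp Φ)‖ ^ 2) := by
  have e1 : ∀ f : ManyBody N, (inner ℂ f f).re = ‖f‖ ^ 2 := fun f =>
    inner_self_eq_norm_sq (𝕜 := ℂ) f
  rw [regEnergy, hV.hamForm_eq h h, Complex.add_re, Complex.re_ofReal_mul, Complex.re_sum,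
    Complex.re_sum]
  simp only [Complex.re_sum, e1, ← inner_pairRoot (hV.isUnitPotential hε)]

/-- The energy per particle of a bosonic wave function is that of one particle and half a pair. -/
theorem IsShortRange.regEnergy_eq (hV : IsShortRange V) (hε : 0 < ε) (h : MemH1 Φ)
    (hs : IsBosonic Φ) {i j : Fin N} (hij : i ≠ j) :
    regEnergy κ V ε Φ = ‖h.gradL2 i‖ ^ 2 +
      κ / 2 * ((1 - 1 / N) * ‖pairRoot (hV.scaledPot ε) i j (h.memLp.toLp Φ)‖ ^ 2) := by
  have hN : (N : ℝ) ≠ 0 := Nat.cast_ne_zero.2 i.pos.ne'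
  have e1 : ∑ k, ‖h.gradL2 k‖ ^ 2 = N * ‖h.gradL2 i‖ ^ 2 := by
    simp only [norm_gradL2_eq h hs i]
    simp
  have e2 : ∑ k, ∑ l ∈ Finset.Ioi k, ‖pairRoot (hV.scaledPot ε) k l (h.memLp.toLp Φ)‖ ^ 2 =
      (N * (N - 1) / 2) * ‖pairRoot (hV.scaledPot ε) i j (h.memLp.toLp Φ)‖ ^ 2 := by
    rw [← sum_card_Ioi, Finset.sum_mul]
    refine Finset.sum_congr rfl fun k _ => ?_
    rw [← nsmul_eq_mul]
    refine Finset.sum_eq_card_nsmul fun l hl => ?_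
    rw [norm_pairRoot_eq (hs.permute_eq h.memLp) hij (Finset.mem_Ioi.1 hl).ne]
  rw [hV.regEnergy_eq_sum hε h, e1, e2]
  field_simp

/-- The energy per particle compared with the kinetic energy of one particle and the self-energy
of the condensate. For one particle there is no interaction and `1 / √N = 1`. -/
theorem IsShortRange.abs_regEnergy_sub_le (hV : IsShortRange V) (hκ : |κ| = 1) (hε : 0 < ε)
    (hφ : MemH2 φ) (h1 : l2Norm φ = 1) (h : MemH1 Φ) (hs : IsBosonic Φ) (hΦ : l2Norm Φ = 1)
    (i : Fin N) :
    |regEnergy κ V ε Φ - ‖h.gradL2 i‖ ^ 2 -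
      κ / 2 * selfEnergy (hV.scaledPot ε) (hφ.memLp.toLp φ)| ≤
      ‖h.gradL2 i - ketbra (hφ.memLp_grad.toLp (grad φ)) (hφ.memLp.toLp φ) i
        (h.memLp.toLp Φ)‖ ^ 2 / 4 +
      (13 * l2Norm (grad φ) + 20) * beta Φ φ + 7 * l2Norm (grad φ) * (1 / Real.sqrt N) := by
  have hu := hV.isUnitPotential hε
  rw [beta_eq_excitation hφ.memLp h1 h.memLp, hφ.l2Norm_grad]
  rw [l2Norm_eq_norm hφ.memLp] at h1
  rw [l2Norm_eq_norm h.memLp] at hΦ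
  have hA0 := hu.selfEnergy_nonneg (hφ.memLp.toLp φ)
  have hA1 := hu.selfEnergy_le hφ.hasDirDeriv_one h1
  have hβ0 : 0 ≤ excitation (condensate (hφ.memLp.toLp φ)) (h.memLp.toLp Φ) :=
    excitation_nonneg
  have hg0 := norm_nonneg (hφ.memLp_grad.toLp (grad φ))
  have hX0 := sq_nonneg ‖h.gradL2 i - ketbra (hφ.memLp_grad.toLp (grad φ)) (hφ.memLp.toLp φ) i
        (h.memLp.toLp Φ)‖
  have hgβ := mul_nonneg hg0 hβ0
  by_cases hj : ∃ j, i ≠ j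
  · obtain ⟨j, hij⟩ := hj
    have hW := abs_pair_energy_sub_selfEnergy_le hu (hV.scaledPot_neg ε) hφ.hasDirDeriv_one h1
      hΦ (hs.permute_eq h.memLp) hij (h.hasDirDeriv i)
    rw [hV.regEnergy_eq hε h hs hij, add_sub_cancel_left, ← mul_sub, abs_mul, abs_div, hκ]
    have hN1 : (1 : ℝ) ≤ N := Nat.one_le_cast.2 i.pos
    have hn1 : (1 / N : ℝ) ≤ 1 := by
      rw [div_le_one (by linarith)]
      exact hN1
    have hn0 : (0 : ℝ) ≤ 1 / N := by positivity
    have hn2 : (1 / N : ℝ) ≤ 1 / Real.sqrt N := by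
      refine one_div_le_one_div_of_le (Real.sqrt_pos.2 (by linarith)) ?_
      exact Real.sqrt_le_iff.2 ⟨by linarith, by nlinarith⟩
    generalize ‖pairRoot (hV.scaledPot ε) i j (h.memLp.toLp Φ)‖ ^ 2 = W at hW ⊢
    generalize selfEnergy (hV.scaledPot ε) (hφ.memLp.toLp φ) = A at *
    have e : (1 - 1 / N : ℝ) * W - A = (1 - 1 / N) * (W - A) - 1 / N * A := by ring
    have e2 : |(1 - 1 / N : ℝ) * W - A| ≤ |W - A| + 1 / N * A := by
      rw [e]
      refine (abs_sub _ _).trans ?_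
      rw [abs_mul, abs_of_nonneg (a := (1 - 1 / N : ℝ)) (by linarith),
        abs_of_nonneg (mul_nonneg hn0 hA0)]
      gcongr
      exact mul_le_of_le_one_left (abs_nonneg _) (by linarith)
    have e3 := mul_le_mul hn2 hA1 hA0 (hn0.trans hn2)
    rw [abs_two]
    linarith
  · push Not at hj
    have hN : N = 1 := by
      have hc : Fintype.card (Fin N) = 1 := Fintype.card_eq_one_iff.2 ⟨i, fun j => (hj j).symm⟩
      rwa [Fintype.card_fin] at hc
    subst hN
    have e : regEnergy κ V ε Φ = ‖h.gradL2 i‖ ^ 2 := by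
      rw [hV.regEnergy_eq_sum hε h, Subsingleton.elim i 0]
      simp
    rw [e, sub_self, zero_sub, abs_neg, abs_mul, abs_div, hκ, abs_two, abs_of_nonneg hA0]
    rw [Nat.cast_one, Real.sqrt_one, div_one, mul_one]
    linarith

end Bridge

/-! ### The estimate at a fixed time -/

section FixedTime

variable {N : ℕ} {φ : ℝ → ℂ} {Φ : (Fin N → ℝ) → ℂ} {V : ℝ → ℝ} {κ ε : ℝ}

/-- `∇ᵢ qᵢ Φ = ∇ᵢ Φ - |∇φ⟩⟨φ|ᵢ Φ`. -/
theorem hasDirDeriv_qOp (hφ : MemH2 φ) (h : MemH1 Φ) (i : Fin N) :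
    HasDirDeriv (Pi.single i (1 : ℝ)) ((memLp_qOp hφ.memLp i h.memLp).toLp _)
      (h.gradL2 i - ketbra (hφ.memLp_grad.toLp (grad φ)) (hφ.memLp.toLp φ) i
        (h.memLp.toLp Φ)) := by
  rw [toLp_qOp hφ.memLp i h.memLp]
  exact (h.hasDirDeriv i).sub (hφ.hasDirDeriv_one.condensate_self i _)

theorem l2Norm_partialGrad_qOp (hφ : MemH2 φ) (h : MemH1 Φ) (i : Fin N) :
    l2Norm (partialGrad i (qOp φ i Φ)) =
      ‖h.gradL2 i - ketbra (hφ.memLp_grad.toLp (grad φ)) (hφ.memLp.toLp φ) i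
        (h.memLp.toLp Φ)‖ := by
  have hd := hasDirDeriv_qOp hφ h i
  rw [← hd.toLp_weakDeriv (memLp_qOp hφ.memLp i h.memLp)]
  exact l2Norm_eq_norm _

/-- The kinetic energy exceeds `‖∇φ‖²` by `‖∇ᵢ qᵢ Φ‖²` up to small terms, and the potential energy
uses up a quarter of that; hence the factor `4 / 3`. -/
theorem IsShortRange.sq_l2Norm_partialGrad_qOp_le (hV : IsShortRange V) (hκ : |κ| = 1)
    (hε : 0 < ε) (hφ : MemH2 φ) (h1 : l2Norm φ = 1) (h : MemH1 Φ) (hs : IsBosonic Φ)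
    (hΦ : l2Norm Φ = 1) (i : Fin N) :
    l2Norm (partialGrad i (qOp φ i Φ)) ^ 2 ≤
      4 / 3 * (regEnergy κ V ε Φ - nlsEnergy κ φ) +
        (40 + ∫ x, |x| ^ (1 / 2 : ℝ) * V x) * (ε ^ (1 / 2 : ℝ) * holderHalfNorm φ ^ 2 +
          h2Norm φ * beta Φ φ + h2Norm φ / Real.sqrt N) := by
  have hE := abs_le.1 (hV.abs_regEnergy_sub_le hκ hε hφ h1 h hs hΦ i)
  have hF := hV.abs_selfEnergy_sub_le hε hφ h1
  have hn := hφ.le_h2Norm h1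
  have hβ0 : 0 ≤ beta Φ φ := by
    rw [beta_eq_excitation hφ.memLp h1 h.memLp]
    exact excitation_nonneg
  have hK := kinetic_lower_bound hφ.hasDirDeriv_one hφ.hasDirDeriv_two
    ((l2Norm_eq_norm hφ.memLp).symm.trans h1) ((l2Norm_eq_norm h.memLp).symm.trans hΦ)
    (hs.permute_eq h.memLp) (h.hasDirDeriv i)
  rw [← beta_eq_excitation hφ.memLp h1 h.memLp, ← hφ.l2Norm_grad, ← hφ.l2Norm_lap] at hK
  rw [l2Norm_partialGrad_qOp hφ h i, nlsEnergy]
  have hm0 : 0 ≤ ∫ x, |x| ^ (1 / 2 : ℝ) * V x :=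
    integral_nonneg fun x => mul_nonneg (by positivity) (hV.nonneg x)
  have hδ0 : 0 ≤ ε ^ (1 / 2 : ℝ) * holderHalfNorm φ ^ 2 := by positivity
  have hr0 : 0 ≤ 1 / Real.sqrt N := by positivity
  have hκF : |κ / 2 * (selfEnergy (hV.scaledPot ε) (hφ.memLp.toLp φ) - ∫ x, ‖φ x‖ ^ 4)| ≤
      ((∫ x, |x| ^ (1 / 2 : ℝ) * V x) * (ε ^ (1 / 2 : ℝ) * holderHalfNorm φ ^ 2)) / 2 := by
    rw [abs_mul, abs_div, hκ, abs_two]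
    linarith
  rw [mul_sub] at hκF
  have hκF' := abs_le.1 hκF
  have hl0 : 0 ≤ l2Norm (lap φ) := ENNReal.toReal_nonneg
  -- `2 ‖∇φ‖ ≤ 1 + ‖∇φ‖² ≤ ‖φ‖_{H²}`
  have hg := sq_nonneg (l2Norm (grad φ) - 1)
  have hg' : l2Norm (grad φ) ≤ h2Norm φ / 2 := by nlinarith
  have hh1 : 1 ≤ h2Norm φ := by nlinarith [sq_nonneg (l2Norm (grad φ))]
  rw [← mul_one_div (h2Norm φ) (Real.sqrt N)]
  generalize 1 / Real.sqrt N = r at *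
  generalize beta Φ φ = β at *
  generalize ε ^ (1 / 2 : ℝ) * holderHalfNorm φ ^ 2 = δ at *
  generalize (∫ x, |x| ^ (1 / 2 : ℝ) * V x) = m at *
  have b1 := mul_le_mul_of_nonneg_right hn.1 hβ0
  have b2 := mul_le_mul_of_nonneg_right hn.2 hβ0
  have b3 := mul_le_mul_of_nonneg_right hn.2 hr0
  have b4 := mul_le_mul_of_nonneg_right hg' hβ0
  have b5 := mul_le_mul_of_nonneg_right hg' hr0
  have b6 := mul_le_mul_of_nonneg_right hh1 hβ0
  have b7 : 0 ≤ h2Norm φ * r := mul_nonneg (by linarith) hr0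
  have b8 := mul_nonneg hm0 hδ0
  have b9 := mul_nonneg hm0 b7
  have b10 := mul_nonneg hm0 (mul_nonneg (show (0 : ℝ) ≤ h2Norm φ by linarith) hβ0)
  linarith [hE.1, hκF'.2, hκF'.1, mul_nonneg (show (0 : ℝ) ≤ h2Norm φ by linarith) hβ0]

end FixedTime

end LiebLiniger

end

theorem proposition3p6 (V : ℝ → ℝ) (hV : IsShortRange V) :
    ∃ C₁ C₂ : ℝ, 0 < C₁ ∧ 0 < C₂ ∧
      ∀ κ : ℝ, (κ = 1 ∨ κ = -1) →
      ∀ ε : ℝ, 0 < ε →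
      ∀ (N : ℕ) (hN : 0 < N) (φ : ℝ → ℝ → ℂ) (Φ : ℝ → (Fin N → ℝ) → ℂ),
        IsNLSSolution κ φ → l2Norm (φ 0) = 1 →
        IsRegSchrodingerSolution κ V ε Φ → l2Norm (Φ 0) = 1 →
        ∀ t : ℝ,
          HasL2Deriv (Pi.single (⟨0, hN⟩ : Fin N) (1 : ℝ)) (qOp (φ t) ⟨0, hN⟩ (Φ t)) ∧
          l2Norm (partialGrad ⟨0, hN⟩ (qOp (φ t) ⟨0, hN⟩ (Φ t))) ^ 2 ≤
            C₁ * (regEnergy κ V ε (Φ t) - nlsEnergy κ (φ t)) +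
            C₂ * (ε ^ (1 / 2 : ℝ) * holderHalfNorm (φ t) ^ 2 +
              h2Norm (φ t) * beta (Φ t) (φ t) +
              h2Norm (φ t) / Real.sqrt N) := by
  have hm0 : 0 ≤ ∫ x, |x| ^ (1 / 2 : ℝ) * V x :=
    integral_nonneg fun x => mul_nonneg (by positivity) (hV.nonneg x)
  refine ⟨4 / 3, 40 + ∫ x, |x| ^ (1 / 2 : ℝ) * V x, by norm_num, by linarith, ?_⟩
  intro κ hκ ε hε N hN φ Φ hφ hφ0 hΦ hΦ0 t
  have hκ' : |κ| = 1 := by rcases hκ with rfl | rfl <;> simp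
  exact ⟨(hasDirDeriv_qOp (hφ.memH2 t) (hΦ.memH1 t) _).hasL2Deriv
      (memLp_qOp (hφ.memH2 t).memLp _ (hΦ.memH1 t).memLp),
    hV.sq_l2Norm_partialGrad_qOp_le hκ' hε (hφ.memH2 t) (hφ.l2Norm_eq_one hφ0 t) (hΦ.memH1 t)
      (hΦ.bosonic t) (hΦ.l2Norm_eq_one hV hΦ0 t) _⟩
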